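/- Let $a,b\in\mathbb{R}$ with $a^2+b^2=1$ and $b^2<1$. Let $L$ be the unitary $(L\psi)(n)=\psi(n+1)$ on $\ell^2(\mathbb{Z})$, let $\mathcal{H}=\ell^2(\mathbb{Z};\mathbb{C}^2)=\ell^2(\mathbb{Z})\oplus\ell^2(\mathbb{Z})$, $S=L\oplus L^*$, and let $$U_3=S\,C_1\,S\,C_2\,S\,C_3,\qquad C_1=\begin{pmatrix}1&0\\0&1\end{pmatrix},\quad C_2=\begin{pmatrix}b&a\\-a&b\end{pmatrix},\quad C_3=\begin{pmatrix}b&-a\\a&b\end{pmatrix},$$ where the matrices act as constant multiplication operators on $\mathcal{H}$. Let $\mathcal{K}_1=L^2([0,2\pi],dk/2\pi)$ and let $P=-i\,d/dk$ on $\mathcal{K}_1$ with domain $D(P)=\{f\in AC[0,2\pi] : f'\in\mathcal{K}_1,\ f(0)=f(2\pi)\}$. Let $\mathscr{F}:\mathcal{H}\to\mathcal{K}_1\oplus\mathcal{K}_1$ be the unitary Fourier transform, $(\mathscr{F}\psi)(k)=\sum_{x\in\mathbb{Z}}e^{-ikx}\psi(x)$ for finitely supported $\psi$. Let $\hat U_3(k)$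 be the symbol of $U_3$, i.e. the matrix by which $\mathscr{F}U_3\mathscr{F}^{-1}$ acts as a multiplication operator, $$\hat U_3(k)=\begin{pmatrix}a^2e^{ik}+b^2e^{3ik}&ab\,e^{ik}-ab\,e^{3ik}\\-ab\,e^{-ik}+ab\,e^{-3ik}&a^2e^{-ik}+b^2e^{-3ik}\end{pmatrix},$$ and denote its eigenvalues by $$\lambda_1(k)=\cos k\,(1-4b^2\sin^2k)+i\sin k\sqrt{1+(8b^2-16b^4)\cos^2k+16b^4\cos^4k},\qquad \lambda_2(k)=\overline{\lambda_1(k)}.$$ There is a Borel, $2\pi$-periodic, unitary-matrix-valued function $W(k)$ on $\mathbb{R}$ with $W(k)^{-1}\hat U_3(k)W(k)=\mathrm{diag}(\lambda_1(k),\lambda_2(k))$ for all $k$. For any such $W$ put, on natural domains, $$\hat T_j=\frac i2\left(\frac{\lambda_j}{\lambda_j'}P+P\frac{\lambda_j}{\lambda_j'}\right)\ (j=1,2),\qquad T=\mathscr{F}^{-1}W\begin{pmatrix}\hat T_1&0\\0&\hat T_2\end{pmatrix}W^{-1}\mathscr{F}.$$ A symmetric (densely defined) operator $A$ is called a time operator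 of a unitary $U$ if $AU-UA=U$ holds on some subspace $\mathcal{D}\neq\{0\}$ with $\mathcal{D}\subset D(AU)\cap D(A)$, and a strong time operator of $U$ if $U^*AU=A+1$, including equality of domains. Write $d_\pm(A)=\dim\ker(A^*\mp i)$. Then $T$ is a strong time operator of $U_3$, and the following hold. 1. If $b^2<1/4$, then $T$ is self-adjoint, $\sigma(T)=\mathbb{Z}$, and there is a unitary $V:\mathcal{H}\to\mathcal{K}_1\oplus\mathcal{K}_1$ such that $VTV^{-1}=P\oplus P$ and $VU_3V^{-1}=e^{ik}\oplus e^{ik}$. In particular, $T$ is a self-adjoint strong time operator of $U_3$. 2. If $b^2=1/4$, then $d_+(T)=d_-(T)=4$ and $\sigma(T)=\mathbb{C}$. 3. If $1/4<b^2<1$, then $d_+(T)=d_-(T)=8$ and $\sigma(T)=\mathbb{C}$. In cases 2 and 3, $T$ has self-adjoint extensions, and every self-adjoint extension of $T$ is a time operator of $U_3$. -/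

import Mathlib

open MeasureTheory Set

noncomputable section

namespace QuantumWalk

/-! ### Partially defined operators on Hilbert spaces -/

section Operators

variable {E F G : Type*}
  [NormedAddCommGroup E] [InnerProductSpace ℂ E]
  [NormedAddCommGroup F] [InnerProductSpace ℂ F]
  [NormedAddCommGroup G] [InnerProductSpace ℂ G]

/-- The product `A B` on its natural domain `{x ∈ D(B) | B x ∈ D(A)}`. -/
def natComp (A : F →ₗ.[ℂ] G) (B : E →ₗ.[ℂ] F) : E →ₗ.[ℂ] G where
  domain :=
    { carrier := {x | ∃ h : x ∈ B.domain, B ⟨x, h⟩ ∈ A.domain}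
      add_mem' := by
        rintro x y ⟨hx, hx'⟩ ⟨hy, hy'⟩
        refine ⟨B.domain.add_mem hx hy, ?_⟩
        have : B ⟨x + y, B.domain.add_mem hx hy⟩ = B ⟨x, hx⟩ + B ⟨y, hy⟩ :=
          B.map_add ⟨x, hx⟩ ⟨y, hy⟩
        rw [this]
        exact A.domain.add_mem hx' hy'
      zero_mem' := by
        refine ⟨B.domain.zero_mem, ?_⟩
        have : B ⟨0, B.domain.zero_mem⟩ = 0 := B.map_zero
        rw [this]
        exact A.domain.zero_mem
      smul_mem' := by
        rintro c x ⟨hx, hx'⟩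
        refine ⟨B.domain.smul_mem c hx, ?_⟩
        have : B ⟨c • x, B.domain.smul_mem c hx⟩ = c • B ⟨x, hx⟩ := B.map_smul c ⟨x, hx⟩
        rw [this]
        exact A.domain.smul_mem c hx' }
  toFun :=
    { toFun := fun x => A ⟨B ⟨x, x.2.fst⟩, x.2.snd⟩
      map_add' := fun x y => by
        rw [← A.map_add]
        congr 1
        exact Subtype.ext (B.map_add ⟨x, x.2.fst⟩ ⟨y, y.2.fst⟩)
      map_smul' := fun c x => by
        rw [RingHom.id_apply, ← A.map_smul]
        congr 1
        exact Subtype.ext (B.map_smul c ⟨x, x.2.fst⟩) }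

/-- An everywhere defined bounded operator, regarded as a partially defined one. -/
def ofCLM (A : E →L[ℂ] F) : E →ₗ.[ℂ] F := (A : E →ₗ[ℂ] F).toPMap ⊤

/-- A unitary operator between two spaces, regarded as a partially defined operator. -/
def ofUnitary (V : E ≃ₗᵢ[ℂ] F) : E →ₗ.[ℂ] F := ofCLM (V.toContinuousLinearEquiv : E →L[ℂ] F)

/-- The transported operator `V A V⁻¹`. -/
def conjBy (V : E ≃ₗᵢ[ℂ] F) (A : E →ₗ.[ℂ] E) : F →ₗ.[ℂ] F :=
  natComp (ofUnitary V) (natComp A (ofUnitary V.symm))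

/-- `A` is symmetric: densely defined and `A ⊂ A*`. -/
def IsSymmetricOp [CompleteSpace E] (A : E →ₗ.[ℂ] E) : Prop :=
  Dense (A.domain : Set E) ∧ A ≤ A.adjoint

/-- The resolvent set: those `z` for which `A - z` is a bijection of `D(A)` onto the whole space
with bounded inverse `R`. -/
def resolventSet (A : E →ₗ.[ℂ] E) : Set ℂ :=
  {z | ∃ R : E →L[ℂ] E,
    (∀ y, ∃ h : R y ∈ A.domain, A ⟨R y, h⟩ - z • R y = y) ∧
    ∀ x : A.domain, R (A x - z • (x : E)) = x}

/-- The spectrum `σ(A)`. -/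
def opSpectrum (A : E →ₗ.[ℂ] E) : Set ℂ := (resolventSet A)ᶜ

/-- `ker (A - z)`. -/
def eigenKer (A : E →ₗ.[ℂ] E) (z : ℂ) : Submodule ℂ A.domain :=
  LinearMap.ker (A.toFun - z • A.domain.subtype)

/-- The deficiency index `d₊(A) = dim ker (A* - i)`. -/
def dPlus [CompleteSpace E] (A : E →ₗ.[ℂ] E) : Cardinal :=
  Module.rank ℂ (eigenKer A.adjoint Complex.I)

/-- The deficiency index `d₋(A) = dim ker (A* + i)`. -/
def dMinus [CompleteSpace E] (A : E →ₗ.[ℂ] E) : Cardinal :=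
  Module.rank ℂ (eigenKer A.adjoint (-Complex.I))

/-- `T` is a time operator of the unitary operator `U`: `T` is symmetric and there is a subspace
`𝒟 ≠ {0}` with `𝒟 ⊂ D(TU) ∩ D(T)` on which `TU - UT = U`. -/
def IsTimeOperator [CompleteSpace E] (T : E →ₗ.[ℂ] E) (U : E →L[ℂ] E) : Prop :=
  U ∈ unitary (E →L[ℂ] E) ∧ IsSymmetricOp T ∧
    ∃ 𝒟 : Submodule ℂ E, 𝒟 ≠ ⊥ ∧
      ∀ ψ ∈ 𝒟, ∃ (hU : U ψ ∈ T.domain) (h : ψ ∈ T.domain),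
        T ⟨U ψ, hU⟩ - U (T ⟨ψ, h⟩) = U ψ

/-- `T` is a strong time operator of the unitary operator `U`: `T` is symmetric and
`U* T U = T + 1` as an equality of operators, domains included. -/
def IsStrongTimeOperator [CompleteSpace E] (T : E →ₗ.[ℂ] E) (U : E →L[ℂ] E) : Prop :=
  U ∈ unitary (E →L[ℂ] E) ∧ IsSymmetricOp T ∧
    natComp (ofCLM U.adjoint) (natComp T (ofCLM U)) = T + ofCLM (ContinuousLinearMap.id ℂ E)

/-- The Hilbert space direct sum `E ⊕ E`. -/
abbrev Double (E : Type*) := PiLp 2 (fun _ : Fin 2 => E)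

/-- The direct sum `A₀ ⊕ A₁` of two partially defined operators. -/
def directSum (A : Fin 2 → (E →ₗ.[ℂ] E)) : Double E →ₗ.[ℂ] Double E where
  domain :=
    { carrier := {f | ∀ i, f i ∈ (A i).domain}
      add_mem' := fun hf hg i => (A i).domain.add_mem (hf i) (hg i)
      zero_mem' := fun i => (A i).domain.zero_mem
      smul_mem' := fun c _ hf i => (A i).domain.smul_mem c (hf i) }
  toFun :=
    { toFun := fun f => WithLp.toLp 2 fun i => A i ⟨(f : Double E) i, f.2 i⟩
      map_add' := fun f g => by
        ext1 i
        exact (A i).map_add ⟨_, f.2 i⟩ ⟨_, g.2 i⟩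
      map_smul' := fun c f => by
        ext1 i
        exact (A i).map_smul c ⟨_, f.2 i⟩ }

/-- The bounded operator on `E ⊕ E` given by a `2 × 2` matrix of bounded operators on `E`. -/
def blockOp (A : Matrix (Fin 2) (Fin 2) (E →L[ℂ] E)) : Double E →L[ℂ] Double E :=
  ((PiLp.continuousLinearEquiv 2 ℂ (fun _ : Fin 2 => E)).symm :
      (Fin 2 → E) →L[ℂ] Double E) ∘L
    ContinuousLinearMap.pi fun i => ∑ j, A i j ∘L PiLp.proj 2 (fun _ : Fin 2 => E) j

lemma blockOp_apply (A : Matrix (Fin 2) (Fin 2) (E →L[ℂ] E)) (f : Double E) (i : Fin 2) :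
    blockOp A f i = ∑ j, A i j (f j) := by
  simp [blockOp]

end Operators

/-! ### The walk on `ℓ²(ℤ; ℂ²) = ℓ²(ℤ) ⊕ ℓ²(ℤ)` -/

/-- The Hilbert space `ℓ²(ℤ)`. -/
abbrev EllTwo := lp (fun _ : ℤ => ℂ) 2

/-- The state space `ℓ²(ℤ) ⊕ ℓ²(ℤ)` of the walker. -/
abbrev StateSpace := Double EllTwo

/-- The translation `(L ψ)(n) = ψ (n + 1)` on `ℓ²(ℤ)`, as a linear isometry. -/
def translationIsometry : EllTwo →ₗᵢ[ℂ] EllTwo where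
  toFun ψ := ⟨fun n => ψ (n + 1), by
    have h := (memℓp_gen_iff (by norm_num)).mp (lp.memℓp ψ)
    exact (memℓp_gen_iff (by norm_num)).mpr ((Equiv.addRight (1 : ℤ)).summable_iff.mpr h)⟩
  map_add' _ _ := rfl
  map_smul' _ _ := rfl
  norm_map' ψ := by
    rw [lp.norm_eq_tsum_rpow (by norm_num), lp.norm_eq_tsum_rpow (by norm_num)]
    congr 1
    exact (Equiv.addRight (1 : ℤ)).tsum_eq (fun n => ‖ψ n‖ ^ (2 : ENNReal).toReal)

/-- The translation `L` as a bounded operator. -/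
def translation : EllTwo →L[ℂ] EllTwo := translationIsometry.toContinuousLinearMap

lemma translation_apply (ψ : EllTwo) (n : ℤ) : translation ψ n = ψ (n + 1) := rfl

/-- The shift operator `S = L ⊕ L*`. -/
def shiftOp : StateSpace →L[ℂ] StateSpace := blockOp !![translation, 0; 0, translation.adjoint]

/-- The coin operator: multiplication by a constant `2 × 2` matrix. -/
def coinOp (C : Matrix (Fin 2) (Fin 2) ℂ) : StateSpace →L[ℂ] StateSpace :=
  blockOp (C.map fun c => c • ContinuousLinearMap.id ℂ EllTwo)

/-- The time evolution `U₃ = S C₁ S C₂ S C₃` of the three-step walk. -/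
def U₃ (a b : ℝ) : StateSpace →L[ℂ] StateSpace :=
  shiftOp ∘L coinOp !![1, 0; 0, 1] ∘L shiftOp ∘L coinOp !![(b : ℂ), (a : ℂ); -(a : ℂ), (b : ℂ)] ∘L
    shiftOp ∘L coinOp !![(b : ℂ), -(a : ℂ); (a : ℂ), (b : ℂ)]

/-! ### Momentum space -/

/-- The measure `dk / 2π` on `[0, 2π]`. -/
def momentumMeasure : Measure ℝ :=
  ENNReal.ofReal (2 * Real.pi)⁻¹ • volume.restrict (Icc 0 (2 * Real.pi))

/-- The Hilbert space `𝒦₁ = L²([0, 2π], dk / 2π)`. -/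
abbrev K₁ := Lp ℂ 2 momentumMeasure

lemma momentumMeasure_def :
    momentumMeasure = ENNReal.ofReal (2 * Real.pi)⁻¹ • volume.restrict (Icc 0 (2 * Real.pi)) := rfl

lemma ae_momentumMeasure : ae momentumMeasure = ae (volume.restrict (Icc 0 (2 * Real.pi))) :=
  Measure.ae_ennreal_smul_measure_eq (by simp [Real.pi_pos]) _

instance : IsFiniteMeasure momentumMeasure :=
  Measure.smul_finite _ ENNReal.ofReal_ne_top

lemma ae_differentiableAt_of_ac {F : ℝ → ℂ}
    (hF : AbsolutelyContinuousOnInterval F 0 (2 * Real.pi)) :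
    ∀ᵐ k ∂momentumMeasure, DifferentiableAt ℝ F k := by
  rw [ae_momentumMeasure, ae_restrict_iff' measurableSet_Icc]
  have h := hF.boundedVariationOn.ae_differentiableAt_of_mem_uIcc
  rwa [uIcc_of_le Real.two_pi_pos.le] at h

lemma mul_add_ae (g : ℝ → ℂ) (f h : K₁) :
    (fun k => g k * (f + h : K₁) k) =ᵐ[momentumMeasure]
      (fun k => g k * f k) + fun k => g k * h k := by
  filter_upwards [Lp.coeFn_add f h] with k hk
  simp only [hk, Pi.add_apply, mul_add]

lemma mul_smul_ae (g : ℝ → ℂ) (c : ℂ) (f : K₁) :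
    (fun k => g k * (c • f : K₁) k) =ᵐ[momentumMeasure] c • fun k => g k * f k := by
  filter_upwards [Lp.coeFn_smul c f] with k hk
  simp only [hk, Pi.smul_apply, smul_eq_mul]
  ring

/-- The graph of `P`: the pairs `(f, -i f')` with `f` absolutely continuous on `[0, 2π]`,
`f' ∈ 𝒦₁` and `f(0) = f(2π)`. -/
def momentumGraph : Submodule ℂ (K₁ × K₁) where
  carrier := {p | ∃ F : ℝ → ℂ, AbsolutelyContinuousOnInterval F 0 (2 * Real.pi) ∧
    F 0 = F (2 * Real.pi) ∧ p.1 =ᵐ[momentumMeasure] F ∧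
    p.2 =ᵐ[momentumMeasure] fun k => -Complex.I * deriv F k}
  add_mem' := by
    rintro p q ⟨F, hF, hF0, hp, hp'⟩ ⟨G, hG, hG0, hq, hq'⟩
    refine ⟨F + G, hF.add hG, by simp [hF0, hG0], ?_, ?_⟩
    · exact (Lp.coeFn_add p.1 q.1).trans (hp.add hq)
    · refine (Lp.coeFn_add p.2 q.2).trans ?_
      filter_upwards [hp', hq', ae_differentiableAt_of_ac hF, ae_differentiableAt_of_ac hG]
        with k h1 h2 h3 h4
      rw [Pi.add_apply, h1, h2, deriv_add h3 h4]
      ring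
  zero_mem' := by
    refine ⟨0, ?_, rfl, Lp.coeFn_zero ℂ 2 momentumMeasure, ?_⟩
    · simp [AbsolutelyContinuousOnInterval, tendsto_const_nhds]
    · refine (Lp.coeFn_zero ℂ 2 momentumMeasure).trans (Filter.Eventually.of_forall fun k => ?_)
      simp
  smul_mem' := by
    rintro c p ⟨F, hF, hF0, hp, hp'⟩
    refine ⟨fun k => c • F k, hF.const_smul c, by simp [hF0], ?_, ?_⟩
    · exact (Lp.coeFn_smul c p.1).trans (hp.const_smul c)
    · refine (Lp.coeFn_smul c p.2).trans ?_
      filter_upwards [hp', ae_differentiableAt_of_ac hF] with k h1 h3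
      rw [Pi.smul_apply, h1, deriv_fun_const_smul c h3]
      simp only [smul_eq_mul]
      ring

/-- `P f = -i f'` is well defined. -/
lemma momentumGraph_singleValued :
    ∀ p : K₁ × K₁, p ∈ momentumGraph → p.1 = 0 → p.2 = 0 := by
  rintro p ⟨F, hF, -, hp, hp'⟩ h0
  have hc : ContinuousOn F (Icc 0 (2 * Real.pi)) := by
    have := hF.continuousOn
    rwa [uIcc_of_le Real.two_pi_pos.le] at this
  have hae : F =ᵐ[volume.restrict (Icc 0 (2 * Real.pi))] fun _ => 0 := by
    rw [← ae_momentumMeasure]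
    have h1 : p.1 =ᵐ[momentumMeasure] (0 : ℝ → ℂ) := by
      rw [h0]
      exact Lp.coeFn_zero ℂ 2 momentumMeasure
    exact hp.symm.trans h1
  have hz : EqOn F (fun _ => 0) (Icc 0 (2 * Real.pi)) :=
    Measure.eqOn_Icc_of_ae_eq volume Real.two_pi_pos.ne hae hc continuousOn_const
  have hd : ∀ᵐ k ∂momentumMeasure, deriv F k = 0 := by
    rw [ae_momentumMeasure, ← restrict_Ioo_eq_restrict_Icc, ae_restrict_iff' measurableSet_Ioo]
    refine Filter.Eventually.of_forall fun k hk => ?_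
    have : F =ᶠ[nhds k] fun _ => (0 : ℂ) := by
      filter_upwards [Ioo_mem_nhds hk.1 hk.2] with x hx
      exact hz (Ioo_subset_Icc_self hx)
    rw [this.deriv_eq]
    simp
  refine Lp.ext ?_
  filter_upwards [hp', hd, Lp.coeFn_zero ℂ 2 momentumMeasure] with k h1 h2 h3
  rw [h1, h2, h3]
  simp

/-- The operator `P f = -i f'` on `𝒦₁` with periodic boundary condition. -/
def momentumOp : K₁ →ₗ.[ℂ] K₁ := momentumGraph.toLinearPMap

lemma momentumOp_graph : momentumOp.graph = momentumGraph :=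
  momentumGraph.toLinearPMap_graph_eq momentumGraph_singleValued

/-- Multiplication by the function `g` on its maximal domain in `𝒦₁`. -/
def mulOp (g : ℝ → ℂ) : K₁ →ₗ.[ℂ] K₁ where
  domain :=
    { carrier := {f | MemLp (fun k => g k * f k) 2 momentumMeasure}
      add_mem' := fun {f h} hf hh => (hf.add hh).ae_eq (mul_add_ae g f h).symm
      zero_mem' := by
        refine MemLp.zero.ae_eq (Filter.EventuallyEq.symm ?_)
        filter_upwards [Lp.coeFn_zero ℂ 2 momentumMeasure] with k hk
        rw [hk, Pi.zero_apply, mul_zero]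
      smul_mem' := fun c f hf => (hf.const_smul c).ae_eq (mul_smul_ae g c f).symm }
  toFun :=
    { toFun := fun f => MemLp.toLp (fun k => g k * (f : K₁) k) f.2
      map_add' := fun f h => by
        rw [← MemLp.toLp_add, MemLp.toLp_eq_toLp_iff]
        exact mul_add_ae g f h
      map_smul' := fun c f => by
        rw [RingHom.id_apply, ← MemLp.toLp_const_smul, MemLp.toLp_eq_toLp_iff]
        exact mul_smul_ae g c f }

lemma mulVec_add_ae (M : ℝ → Matrix (Fin 2) (Fin 2) ℂ) (f h : Double K₁) (i : Fin 2) :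
    (fun k => (M k).mulVec (fun j => (f + h) j k) i) =ᵐ[momentumMeasure]
      (fun k => (M k).mulVec (fun j => f j k) i) +
        fun k => (M k).mulVec (fun j => h j k) i := by
  filter_upwards [Lp.coeFn_add (f 0) (h 0), Lp.coeFn_add (f 1) (h 1)] with k h0 h1
  simp only [Matrix.mulVec, dotProduct, Fin.sum_univ_two, Pi.add_apply, PiLp.add_apply, h0, h1]
  ring

lemma mulVec_smul_ae (M : ℝ → Matrix (Fin 2) (Fin 2) ℂ) (c : ℂ) (f : Double K₁) (i : Fin 2) :
    (fun k => (M k).mulVec (fun j => (c • f) j k) i) =ᵐ[momentumMeasure]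
      c • fun k => (M k).mulVec (fun j => f j k) i := by
  filter_upwards [Lp.coeFn_smul c (f 0), Lp.coeFn_smul c (f 1)] with k h0 h1
  simp only [Matrix.mulVec, dotProduct, Fin.sum_univ_two, Pi.smul_apply, PiLp.smul_apply, h0, h1,
    smul_eq_mul]
  ring

/-- Multiplication by the matrix-valued function `M` on its maximal domain in
`𝒦 = 𝒦₁ ⊕ 𝒦₁`. -/
def mulMatrixOp (M : ℝ → Matrix (Fin 2) (Fin 2) ℂ) : Double K₁ →ₗ.[ℂ] Double K₁ where
  domain :=
    { carrier := {f | ∀ i, MemLp (fun k => (M k).mulVec (fun j => f j k) i) 2 momentumMeasure}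
      add_mem' := fun {f h} hf hh i =>
        ((hf i).add (hh i)).ae_eq (mulVec_add_ae M f h i).symm
      zero_mem' := fun i => by
        refine MemLp.zero.ae_eq (Filter.EventuallyEq.symm ?_)
        filter_upwards [Lp.coeFn_zero ℂ 2 momentumMeasure] with k hk
        simp only [Matrix.mulVec, dotProduct, PiLp.zero_apply, hk, Pi.zero_apply, mul_zero,
          Finset.sum_const_zero]
      smul_mem' := fun c f hf i =>
        ((hf i).const_smul c).ae_eq (mulVec_smul_ae M c f i).symm }
  toFun :=
    { toFun := fun f => WithLp.toLp 2 fun i =>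
        MemLp.toLp (fun k => (M k).mulVec (fun j => (f : Double K₁) j k) i) (f.2 i)
      map_add' := fun f h => by
        ext1 i
        simp only [PiLp.add_apply]
        rw [← MemLp.toLp_add, MemLp.toLp_eq_toLp_iff]
        exact mulVec_add_ae M f h i
      map_smul' := fun c f => by
        ext1 i
        simp only [PiLp.smul_apply, RingHom.id_apply]
        rw [← MemLp.toLp_const_smul, MemLp.toLp_eq_toLp_iff]
        exact mulVec_smul_ae M c f i }

lemma memLp_fourierMode (n : ℤ) :
    MemLp (fun k : ℝ => Complex.exp (-Complex.I * n * k)) 2 momentumMeasure := by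
  refine MemLp.of_bound (Continuous.aestronglyMeasurable (by fun_prop)) 1
    (Filter.Eventually.of_forall fun k => ?_)
  simp [Complex.norm_exp]

/-- The function `k ↦ e^{-ink}` as an element of `𝒦₁`. -/
def fourierMode (n : ℤ) : K₁ := (memLp_fourierMode n).toLp _

lemma inner_fourierMode (n : ℤ) (f : K₁) :
    inner ℂ (fourierMode n) f =
      fourierCoeffOn Real.two_pi_pos (f : ℝ → ℂ) (-n) := by
  rw [fourierCoeffOn_eq_integral, L2.inner_def]
  have hm : ∀ G : ℝ → ℂ, ∫ k, G k ∂momentumMeasure =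
      (ENNReal.ofReal (2 * Real.pi)⁻¹).toReal • ∫ k in Icc 0 (2 * Real.pi), G k :=
    fun G => integral_smul_measure _ _
  rw [hm, intervalIntegral.integral_of_le Real.two_pi_pos.le,
    ← integral_Icc_eq_integral_Ioc, sub_zero, one_div,
    ENNReal.toReal_ofReal (by positivity)]
  congr 1
  have h : fourierMode n =ᵐ[volume.restrict (Icc 0 (2 * Real.pi))]
      fun k : ℝ => Complex.exp (-Complex.I * n * k) := by
    rw [← ae_momentumMeasure]
    exact (memLp_fourierMode n).coeFn_toLp
  refine integral_congr_ae ?_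
  filter_upwards [h] with k hk
  rw [hk, neg_neg, fourier_coe_apply, RCLike.inner_apply', smul_eq_mul, ← Complex.exp_conj]
  congr 2
  have : (Real.pi : ℂ) ≠ 0 := by exact_mod_cast Real.pi_ne_zero
  simp
  field_simp

lemma fourierMode_orthonormal : Orthonormal ℂ fourierMode := by
  have : Fact (0 < 2 * Real.pi - 0) := ⟨by simpa using Real.two_pi_pos⟩
  rw [orthonormal_iff_ite]
  intro n m
  rw [inner_fourierMode]
  have h : fourierCoeffOn Real.two_pi_pos (fourierMode m : ℝ → ℂ) (-n) =
      fourierCoeff (fourier (T := 2 * Real.pi - 0) (-m)) (-n) := by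
    rw [fourierCoeffOn_eq_integral, fourierCoeff_eq_intervalIntegral _ _ 0, zero_add, sub_zero,
      intervalIntegral.integral_of_le Real.two_pi_pos.le,
      intervalIntegral.integral_of_le Real.two_pi_pos.le, ← integral_Icc_eq_integral_Ioc,
      ← integral_Icc_eq_integral_Ioc]
    congr 1
    have h : fourierMode m =ᵐ[volume.restrict (Icc 0 (2 * Real.pi))]
        fun k : ℝ => Complex.exp (-Complex.I * m * k) := by
      rw [← ae_momentumMeasure]
      exact (memLp_fourierMode m).coeFn_toLp
    refine integral_congr_ae ?_
    filter_upwards [h] with k hk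
    rw [hk, fourier_coe_apply, fourier_coe_apply]
    have : (Real.pi : ℂ) ≠ 0 := by exact_mod_cast Real.pi_ne_zero
    congr 2
    simp
    field_simp
  rw [h, fourierCoeff_fourier, Pi.single_apply]
  simp

lemma fourierMode_complete : (Submodule.span ℂ (range fourierMode))ᗮ = ⊥ := by
  rw [eq_bot_iff]
  intro f hf
  have h0 : ∀ n, fourierCoeffOn Real.two_pi_pos (f : ℝ → ℂ) n = 0 := fun n => by
    have h := (Submodule.mem_orthogonal _ f).mp hf (fourierMode (-n))
      (Submodule.subset_span ⟨-n, rfl⟩)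
    rwa [inner_fourierMode, neg_neg] at h
  have hf2 : MemLp (f : ℝ → ℂ) 2 (volume.restrict (Icc 0 (2 * Real.pi))) := by
    refine (Lp.memLp f).of_measure_le_smul (c := ENNReal.ofReal (2 * Real.pi))
      ENNReal.ofReal_ne_top ?_
    rw [momentumMeasure_def, smul_smul, ← ENNReal.ofReal_mul Real.two_pi_pos.le,
      mul_inv_cancel₀ Real.two_pi_pos.ne', ENNReal.ofReal_one, one_smul]
  have hs := hasSum_sq_fourierCoeffOn Real.two_pi_pos
    (hf2.mono_measure (Measure.restrict_mono Ioc_subset_Icc_self le_rfl))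
  simp only [h0, norm_zero, ne_eq, OfNat.ofNat_ne_zero, not_false_eq_true, zero_pow] at hs
  have hi := hs.unique hasSum_zero
  rw [sub_zero, smul_eq_mul, intervalIntegral.integral_of_le Real.two_pi_pos.le,
    ← integral_Icc_eq_integral_Ioc] at hi
  have hi' := (mul_eq_zero.mp hi).resolve_left (by simp [Real.pi_ne_zero])
  rw [integral_eq_zero_iff_of_nonneg (fun _ => by positivity) hf2.norm.integrable_sq] at hi'
  refine Lp.ext ?_
  have h1 := Lp.coeFn_zero ℂ 2 momentumMeasure
  rw [Filter.EventuallyEq, ae_momentumMeasure] at h1 ⊢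
  filter_upwards [hi', h1] with k hk hk'
  rw [hk']
  simpa using hk

/-- The unitary Fourier transform `ψ ↦ ∑ₙ ψ(n) e^{-ink}` from `ℓ²(ℤ)` onto `𝒦₁`. -/
def fourierUnitary₁ : EllTwo ≃ₗᵢ[ℂ] K₁ :=
  (HilbertBasis.mkOfOrthogonalEqBot fourierMode_orthonormal fourierMode_complete).repr.symm

lemma fourierUnitary₁_single (n : ℤ) :
    fourierUnitary₁ (lp.single 2 n (1 : ℂ)) = fourierMode n := by
  classical
  unfold fourierUnitary₁
  rw [HilbertBasis.repr_symm_single, HilbertBasis.coe_mkOfOrthogonalEqBot]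

/-- The Fourier transform `ℱ : ℓ²(ℤ) ⊕ ℓ²(ℤ) → 𝒦₁ ⊕ 𝒦₁`, acting componentwise. -/
def fourierUnitary : StateSpace ≃ₗᵢ[ℂ] Double K₁ :=
  LinearIsometryEquiv.piLpCongrRight 2 fun _ => fourierUnitary₁

/-! ### The time operator -/

/-- The symbol of the three-step walk: `ℱ U₃ ℱ⁻¹` is multiplication by this matrix. -/
def walkSymbol (a b : ℝ) (k : ℝ) : Matrix (Fin 2) (Fin 2) ℂ :=
  let e : ℤ → ℂ := fun n => Complex.exp (Complex.I * n * k)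
  !![a ^ 2 * e 1 + b ^ 2 * e 3, a * b * e 1 - a * b * e 3;
    -a * b * e (-1) + a * b * e (-3), a ^ 2 * e (-1) + b ^ 2 * e (-3)]

/-- The eigenvalue
`λ₁(k) = cos k (1 - 4b² sin² k) + i sin k √(1 + (8b² - 16b⁴) cos² k + 16b⁴ cos⁴ k)`. -/
def eigenvalue₁ (b k : ℝ) : ℂ :=
  (Real.cos k * (1 - 4 * b ^ 2 * Real.sin k ^ 2) : ℝ) +
    Complex.I * (Real.sin k *
      √(1 + (8 * b ^ 2 - 16 * b ^ 4) * Real.cos k ^ 2 + 16 * b ^ 4 * Real.cos k ^ 4) : ℝ)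

/-- The eigenvalues `λ₁(k)` and `λ₂(k)`, the latter being the complex conjugate of `λ₁(k)`. -/
def eigenvalue (b : ℝ) (j : Fin 2) (k : ℝ) : ℂ :=
  ![eigenvalue₁ b k, (starRingEnd ℂ) (eigenvalue₁ b k)] j

/-- `W(k) = (v₁(k), v₂(k))` is a Borel, `2π`-periodic choice of an orthonormal basis of
eigenvectors of the symbol, for the eigenvalues `λ₁(k)`, `λ₂(k)` in this order. -/
structure IsEigenframe (a b : ℝ) (W : ℝ → Matrix (Fin 2) (Fin 2) ℂ) : Prop where
  measurable : ∀ i j, Measurable fun k => W k i j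
  periodic : ∀ k, W (k + 2 * Real.pi) = W k
  unitary : ∀ k, W k ∈ Matrix.unitaryGroup (Fin 2) ℂ
  diagonalizes : ∀ k, (W k)⁻¹ * walkSymbol a b k * W k = Matrix.diagonal fun j => eigenvalue b j k

/-- `T̂ⱼ = (i/2) ((λⱼ/λⱼ') P + P (λⱼ/λⱼ'))` on its natural domain. -/
def timeOpMomentum (b : ℝ) (j : Fin 2) : K₁ →ₗ.[ℂ] K₁ :=
  let q := mulOp fun k => eigenvalue b j k / deriv (eigenvalue b j) k
  (Complex.I / 2) • (natComp q momentumOp + natComp momentumOp q)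

/-- `T = ℱ⁻¹ W (T̂₁ ⊕ T̂₂) W⁻¹ ℱ`. -/
def timeOp (b : ℝ) (W : ℝ → Matrix (Fin 2) (Fin 2) ℂ) : StateSpace →ₗ.[ℂ] StateSpace :=
  conjBy fourierUnitary.symm
    (natComp (mulMatrixOp W)
      (natComp (directSum (timeOpMomentum b)) (mulMatrixOp fun k => (W k)⁻¹)))

end QuantumWalk

end

open QuantumWalk

/-!
The phase of the eigenvalue `λ₁ = e^{iθ}` moves with the speed `τ = θ'`,
`τ(k) = (1 - 4b² + 12b² cos² k) / √R(k)`, where `R` is the expression under the square root in `λ₁`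
(`hasDerivAt_eigenvalue₁`). Since `λ₁ / λ₁' = 1 / (iτ)`, and the speed of `λ₂` is `-τ`, both `T̂₁`
and `T̂₂` are instances of the single operator `speedOp τ = (i/2) (q P + P q)` with `q = 1 / (iτ)`,
studied for a general `C¹` periodic speed `τ`. In the variable `E = f / τ` it is
`τ E ↦ -i (E' + (τ' / 2τ) E)` (`mem_graph_speedOp`). Multiplication by `λ` with `λ' = iτλ` therefore
shifts it by one (`mul_mem_graph_speedOp`). The walk is multiplication by the `λⱼ` in an eigenframe
(`U₃_diagonalizer`), which makes `T` a strong time operator.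

A function `f` in the domain of the adjoint of `speedOp τ` is such that `τ f` is absolutely
continuous and periodic (`exists_of_mem_adjoint_graph`). There are then two cases, according to the
zeros of `τ`.

* For `b² < 1/4` the speed is positive, `speedOp τ` is self-adjoint, and `θ` is a bijection of
  `[0, 2π]`. The functions `√τ e^{inθ}`, `n ∈ ℤ`, form an orthonormal basis of eigenvectors with
  eigenvalues `n`, on which multiplication by `e^{iθ}` is a shift (`exists_hilbertBasis`). The
  change of basis to `e^{ink}` carries `T̂ⱼ` to `P` and `λⱼ` to `e^{ik}`.
* For `b² ≥ 1/4` the speed has `m` zeros on the circle, two at the threshold and four above it. An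
  eigenfunction of the adjoint for `z` solves a first order equation, with solution `√|τ| e^{izθ}`
  on each of the `m` arcs between the zeros, and the constants on the arcs are independent because
  the solution vanishes at the zeros. Hence `ker (T̂ⱼ* - z)` has dimension `m` for every `z`
  (`rank_eigenSpace_adjoint`), so that the deficiency indices of `T` are `2m` and its spectrum is
  `ℂ`.

Self-adjoint extensions of `T ≅ speedOp τ ⊕ (-speedOp τ)` are explicit: for every symmetric `A`, the
operator `(f, g) ↦ (A* f, -A* g)` on the pairs with `f - g ∈ D(A**)` is a self-adjoint extension of
`A ⊕ (-A)` (`IsSymmetricOp.exists_selfAdjoint_extension`). An arbitrary extension satisfies the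
commutation relation on `D(T)`, which `U₃` maps into itself.
-/

noncomputable section

namespace QuantumWalk

/-! ### Graphs of partially defined operators -/

section Graphs

variable {E F G : Type*}
  [NormedAddCommGroup E] [InnerProductSpace ℂ E]
  [NormedAddCommGroup F] [InnerProductSpace ℂ F]
  [NormedAddCommGroup G] [InnerProductSpace ℂ G]

lemma mem_graph_iff_exists {A : E →ₗ.[ℂ] F} {x : E} {y : F} :
    (x, y) ∈ A.graph ↔ ∃ h : x ∈ A.domain, A ⟨x, h⟩ = y := by
  rw [LinearPMap.mem_graph_iff]
  constructor
  · rintro ⟨⟨x', hx'⟩, h1, h2⟩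
    obtain rfl : x' = x := h1
    exact ⟨hx', h2⟩
  · rintro ⟨h, rfl⟩
    exact ⟨⟨x, h⟩, rfl, rfl⟩

lemma graph_ext {A B : E →ₗ.[ℂ] F} (h : ∀ x y, (x, y) ∈ A.graph ↔ (x, y) ∈ B.graph) : A = B :=
  LinearPMap.eq_of_eq_graph (Submodule.ext fun p => h p.1 p.2)

lemma mem_graph_natComp {A : F →ₗ.[ℂ] G} {B : E →ₗ.[ℂ] F} {x : E} {y : G} :
    (x, y) ∈ (natComp A B).graph ↔ ∃ w, (x, w) ∈ B.graph ∧ (w, y) ∈ A.graph := by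
  simp only [mem_graph_iff_exists]
  constructor
  · rintro ⟨⟨h1, h2⟩, h3⟩
    exact ⟨_, ⟨h1, rfl⟩, h2, h3⟩
  · rintro ⟨w, ⟨h1, rfl⟩, h2, h3⟩
    exact ⟨⟨h1, h2⟩, h3⟩

lemma mem_graph_ofCLM {A : E →L[ℂ] F} {x : E} {y : F} :
    (x, y) ∈ (ofCLM A).graph ↔ y = A x := by
  rw [mem_graph_iff_exists]
  exact ⟨fun ⟨_, h⟩ => h.symm, fun h => ⟨trivial, h.symm⟩⟩

lemma mem_graph_ofUnitary {V : E ≃ₗᵢ[ℂ] F} {x : E} {y : F} :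
    (x, y) ∈ (ofUnitary V).graph ↔ y = V x :=
  mem_graph_ofCLM

lemma mem_graph_conjBy {V : E ≃ₗᵢ[ℂ] F} {A : E →ₗ.[ℂ] E} {x y : F} :
    (x, y) ∈ (conjBy V A).graph ↔ (V.symm x, V.symm y) ∈ A.graph := by
  simp only [conjBy, mem_graph_natComp, mem_graph_ofUnitary]
  constructor
  · rintro ⟨w, ⟨u, rfl, h⟩, rfl⟩
    simpa using h
  · intro h
    exact ⟨V.symm y, ⟨_, rfl, h⟩, by simp⟩

lemma mem_graph_directSum {A : Fin 2 → (E →ₗ.[ℂ] E)} {f h : Double E} :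
    (f, h) ∈ (directSum A).graph ↔ ∀ i, (f i, h i) ∈ (A i).graph := by
  simp only [mem_graph_iff_exists]
  constructor
  · rintro ⟨h1, rfl⟩ i
    exact ⟨h1 i, rfl⟩
  · intro H
    refine ⟨fun i => (H i).1, ?_⟩
    ext1 i
    exact (H i).2

lemma mem_graph_neg {A : E →ₗ.[ℂ] F} {x : E} {y : F} :
    (x, y) ∈ (-A).graph ↔ (x, -y) ∈ A.graph := by
  simp only [mem_graph_iff_exists]
  exact exists_congr fun h => neg_eq_iff_eq_neg

lemma mem_graph_adjoint [CompleteSpace E] {A : E →ₗ.[ℂ] F} (hA : Dense (A.domain : Set E))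
    {x : F} {y : E} :
    (x, y) ∈ A.adjoint.graph ↔ ∀ u v, (u, v) ∈ A.graph → inner ℂ v x = inner ℂ u y := by
  rw [LinearPMap.adjoint_graph_eq_graph_adjoint hA, Submodule.mem_adjoint_iff]
  simp only [sub_eq_zero]

lemma conjBy_domain (V : E ≃ₗᵢ[ℂ] F) (A : E →ₗ.[ℂ] E) :
    ((conjBy V A).domain : Set F) = V.symm ⁻¹' (A.domain : Set E) := by
  ext x
  simp only [SetLike.mem_coe, LinearPMap.mem_domain_iff, mem_graph_conjBy, mem_preimage]
  constructor
  · rintro ⟨y, h⟩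
    exact ⟨_, h⟩
  · rintro ⟨y, h⟩
    exact ⟨V y, by simpa using h⟩

lemma dense_conjBy (V : E ≃ₗᵢ[ℂ] F) {A : E →ₗ.[ℂ] E} (hA : Dense (A.domain : Set E)) :
    Dense ((conjBy V A).domain : Set F) := by
  rw [conjBy_domain]
  exact hA.preimage V.symm.toHomeomorph.isOpenMap

lemma dense_directSum {A : Fin 2 → (E →ₗ.[ℂ] E)} (hA : ∀ i, Dense ((A i).domain : Set E)) :
    Dense ((directSum A).domain : Set (Double E)) := by
  have h : Dense (Set.univ.pi fun i => ((A i).domain : Set E)) := dense_pi _ fun i _ => hA i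
  have h2 := h.preimage
    (PiLp.continuousLinearEquiv 2 ℂ (fun _ : Fin 2 => E)).toHomeomorph.isOpenMap
  refine h2.mono fun f hf => ?_
  exact fun i => hf i trivial

lemma adjoint_conjBy [CompleteSpace E] [CompleteSpace F] (V : E ≃ₗᵢ[ℂ] F) {A : E →ₗ.[ℂ] E}
    (hA : Dense (A.domain : Set E)) : (conjBy V A).adjoint = conjBy V A.adjoint := by
  refine graph_ext fun x y => ?_
  rw [mem_graph_adjoint (dense_conjBy V hA), mem_graph_conjBy, mem_graph_adjoint hA]
  constructor
  · intro H u v huv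
    have := H (V u) (V v) (by rwa [mem_graph_conjBy, V.symm_apply_apply, V.symm_apply_apply])
    rwa [← V.inner_map_map, ← V.inner_map_map, V.apply_symm_apply, V.apply_symm_apply]
  · intro H u v huv
    rw [mem_graph_conjBy] at huv
    have := H _ _ huv
    rwa [V.symm.inner_map_map, V.symm.inner_map_map] at this

lemma adjoint_directSum [CompleteSpace E] {A : Fin 2 → (E →ₗ.[ℂ] E)}
    (hA : ∀ i, Dense ((A i).domain : Set E)) :
    (directSum A).adjoint = directSum fun i => (A i).adjoint := by
  refine graph_ext fun x y => ?_
  rw [mem_graph_adjoint (dense_directSum hA), mem_graph_directSum]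
  constructor
  · intro H i
    rw [mem_graph_adjoint (hA i)]
    intro u v huv
    have := H (WithLp.toLp 2 (Pi.single i u)) (WithLp.toLp 2 (Pi.single i v)) (by
      rw [mem_graph_directSum]
      intro j
      rcases eq_or_ne j i with rfl | hj
      · simpa using huv
      · simp [Pi.single_eq_of_ne hj])
    simp only [PiLp.inner_apply] at this
    rw [Finset.sum_eq_single i, Finset.sum_eq_single i] at this
    · simpa using this
    · intro j _ hj
      simp [Pi.single_eq_of_ne hj]
    · simp
    · intro j _ hj
      simp [Pi.single_eq_of_ne hj]
    · simp
  · intro H u v huv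
    rw [mem_graph_directSum] at huv
    simp only [PiLp.inner_apply]
    exact Finset.sum_congr rfl fun i _ => (mem_graph_adjoint (hA i)).1 (H i) _ _ (huv i)

lemma isSelfAdjoint_conjBy [CompleteSpace E] [CompleteSpace F] (V : E ≃ₗᵢ[ℂ] F)
    {A : E →ₗ.[ℂ] E} (hA : IsSelfAdjoint A) : IsSelfAdjoint (conjBy V A) := by
  rw [LinearPMap.isSelfAdjoint_def, adjoint_conjBy V hA.dense_domain,
    LinearPMap.isSelfAdjoint_def.1 hA]

lemma isSelfAdjoint_directSum [CompleteSpace E] {A : Fin 2 → (E →ₗ.[ℂ] E)}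
    (hA : ∀ i, IsSelfAdjoint (A i)) : IsSelfAdjoint (directSum A) := by
  rw [LinearPMap.isSelfAdjoint_def, adjoint_directSum fun i => (hA i).dense_domain]
  congr 1
  funext i
  exact LinearPMap.isSelfAdjoint_def.1 (hA i)

/-- For a densely defined operator, symmetry is the symmetry of its sesquilinear form. -/
lemma isSymmetricOp_iff [CompleteSpace E] {A : E →ₗ.[ℂ] E} (hA : Dense (A.domain : Set E)) :
    IsSymmetricOp A ↔ ∀ u v x y, (u, v) ∈ A.graph → (x, y) ∈ A.graph →
      inner ℂ v x = inner ℂ u y := by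
  rw [IsSymmetricOp, ← LinearPMap.le_graph_iff]
  constructor
  · rintro ⟨-, h⟩ u v x y huv hxy
    exact (mem_graph_adjoint hA).1 (h hxy) u v huv
  · refine fun h => ⟨hA, ?_⟩
    rintro ⟨x, y⟩ hxy
    exact (mem_graph_adjoint hA).2 fun u v huv => h u v x y huv hxy

lemma isSymmetricOp_of_isSelfAdjoint [CompleteSpace E] {A : E →ₗ.[ℂ] E} (hA : IsSelfAdjoint A) :
    IsSymmetricOp A :=
  ⟨hA.dense_domain, (LinearPMap.isSelfAdjoint_def.1 hA).ge⟩

lemma isSymmetricOp_conjBy [CompleteSpace E] [CompleteSpace F] (V : E ≃ₗᵢ[ℂ] F)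
    {A : E →ₗ.[ℂ] E} (hA : IsSymmetricOp A) : IsSymmetricOp (conjBy V A) := by
  rw [isSymmetricOp_iff (dense_conjBy V hA.1)]
  intro u v x y huv hxy
  rw [mem_graph_conjBy] at huv hxy
  have := (isSymmetricOp_iff hA.1).1 hA _ _ _ _ huv hxy
  rwa [V.symm.inner_map_map, V.symm.inner_map_map] at this

lemma isSymmetricOp_directSum [CompleteSpace E] {A : Fin 2 → (E →ₗ.[ℂ] E)}
    (hA : ∀ i, IsSymmetricOp (A i)) : IsSymmetricOp (directSum A) := by
  rw [isSymmetricOp_iff (dense_directSum fun i => (hA i).1)]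
  intro u v x y huv hxy
  rw [mem_graph_directSum] at huv hxy
  simp only [PiLp.inner_apply]
  exact Finset.sum_congr rfl fun i _ =>
    (isSymmetricOp_iff (hA i).1).1 (hA i) _ _ _ _ (huv i) (hxy i)

lemma IsSymmetricOp.isSelfAdjoint [CompleteSpace E] {A : E →ₗ.[ℂ] E} (hA : IsSymmetricOp A)
    (h : A.adjoint.domain ≤ A.domain) : IsSelfAdjoint A := by
  rw [LinearPMap.isSelfAdjoint_def]
  exact (LinearPMap.eq_of_le_of_domain_eq hA.2 (le_antisymm hA.2.1 h)).symm

/-! ### Spectrum and deficiency spaces -/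

lemma mem_resolventSet_iff {A : E →ₗ.[ℂ] E} {z : ℂ} :
    z ∈ resolventSet A ↔ ∃ R : E →L[ℂ] E, (∀ y, (R y, y + z • R y) ∈ A.graph) ∧
      ∀ x y, (x, y) ∈ A.graph → R (y - z • x) = x := by
  simp only [resolventSet, mem_ofPred_eq, mem_graph_iff_exists, sub_eq_iff_eq_add]
  refine exists_congr fun R => and_congr_right fun _ => ?_
  constructor
  · rintro H x y ⟨h, rfl⟩
    exact H ⟨x, h⟩
  · exact fun H x => H _ _ ⟨x.2, rfl⟩

lemma resolventSet_conjBy (V : E ≃ₗᵢ[ℂ] F) (A : E →ₗ.[ℂ] E) :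
    resolventSet A ⊆ resolventSet (conjBy V A) := by
  intro z hz
  rw [mem_resolventSet_iff] at hz ⊢
  obtain ⟨R, h1, h2⟩ := hz
  refine ⟨(V.toContinuousLinearEquiv : E →L[ℂ] F) ∘L R ∘L
    (V.symm.toContinuousLinearEquiv : F →L[ℂ] E), fun y => ?_, fun x y hxy => ?_⟩
  · rw [mem_graph_conjBy]
    simpa using h1 (V.symm y)
  · rw [mem_graph_conjBy] at hxy
    have := h2 _ _ hxy
    simpa using congrArg V this

lemma conjBy_symm_conjBy (V : E ≃ₗᵢ[ℂ] F) (A : E →ₗ.[ℂ] E) : conjBy V.symm (conjBy V A) = A :=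
  graph_ext fun x y => by
    rw [mem_graph_conjBy, mem_graph_conjBy, V.symm_symm, V.symm_apply_apply, V.symm_apply_apply]

lemma conjBy_conjBy (V : E ≃ₗᵢ[ℂ] F) (W : F ≃ₗᵢ[ℂ] G) (A : E →ₗ.[ℂ] E) :
    conjBy W (conjBy V A) = conjBy (V.trans W) A :=
  graph_ext fun x y => by simp only [mem_graph_conjBy, LinearIsometryEquiv.symm_trans,
    LinearIsometryEquiv.trans_apply]

lemma opSpectrum_conjBy (V : E ≃ₗᵢ[ℂ] F) (A : E →ₗ.[ℂ] E) :
    opSpectrum (conjBy V A) = opSpectrum A := by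
  unfold opSpectrum
  congr 1
  refine (resolventSet_conjBy V A).antisymm' ?_
  have := resolventSet_conjBy V.symm (conjBy V A)
  rwa [conjBy_symm_conjBy] at this

/-- The space of the vectors `x` with `A x = z x`, as a subspace of the ambient space. -/
def eigenSpace (A : E →ₗ.[ℂ] E) (z : ℂ) : Submodule ℂ E :=
  A.graph.comap (LinearMap.id.prod (z • LinearMap.id))

lemma mem_eigenSpace {A : E →ₗ.[ℂ] E} {z : ℂ} {x : E} :
    x ∈ eigenSpace A z ↔ (x, z • x) ∈ A.graph := Iff.rfl

lemma rank_eigenKer (A : E →ₗ.[ℂ] E) (z : ℂ) :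
    Module.rank ℂ (eigenKer A z) = Module.rank ℂ (eigenSpace A z) := by
  refine LinearEquiv.rank_eq (LinearEquiv.ofBijective
    ((A.domain.subtype ∘ₗ (eigenKer A z).subtype).codRestrict (eigenSpace A z) ?_) ⟨?_, ?_⟩)
  · rintro ⟨⟨x, hx⟩, h⟩
    rw [mem_eigenSpace, mem_graph_iff_exists]
    exact ⟨hx, sub_eq_zero.1 h⟩
  · rintro ⟨⟨x, hx⟩, h⟩ ⟨⟨y, hy⟩, h'⟩ hxy
    simpa [Subtype.ext_iff] using hxy
  · rintro ⟨x, hx⟩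
    obtain ⟨h1, h2⟩ := mem_graph_iff_exists.1 (mem_eigenSpace.1 hx)
    refine ⟨⟨⟨x, h1⟩, ?_⟩, ?_⟩
    · simp only [eigenKer, LinearMap.mem_ker, LinearMap.sub_apply, LinearMap.smul_apply,
        Submodule.subtype_apply, sub_eq_zero]
      exact h2
    · rfl

lemma rank_eigenSpace_conjBy (V : E ≃ₗᵢ[ℂ] F) {A : E →ₗ.[ℂ] E} {z : ℂ} {m : ℕ}
    (hm : Module.rank ℂ (eigenSpace A z) = m) :
    Module.rank ℂ (eigenSpace (conjBy V A) z) = m := by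
  have h : eigenSpace (conjBy V A) z = (eigenSpace A z).map (V.toLinearEquiv : E →ₗ[ℂ] F) := by
    ext x
    rw [mem_eigenSpace, mem_graph_conjBy, Submodule.mem_map]
    constructor
    · intro H
      rw [map_smul] at H
      exact ⟨V.symm x, mem_eigenSpace.2 H, V.apply_symm_apply x⟩
    · rintro ⟨y, hy, rfl⟩
      change (V.symm (V y), V.symm (z • V y)) ∈ _
      rw [map_smul, V.symm_apply_apply]
      exact hy
  rw [h]
  have := (V.toLinearEquiv.submoduleMap (eigenSpace A z)).lift_rank_eq
  rw [hm, Cardinal.lift_natCast] at this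
  simpa using this.symm

lemma mem_eigenSpace_directSum {A : Fin 2 → (E →ₗ.[ℂ] E)} {z : ℂ} {f : Double E} :
    f ∈ eigenSpace (directSum A) z ↔ ∀ i, f i ∈ eigenSpace (A i) z := by
  simp only [mem_eigenSpace, mem_graph_directSum, PiLp.smul_apply]

lemma rank_eigenSpace_directSum {A : Fin 2 → (E →ₗ.[ℂ] E)} {z : ℂ} {m : ℕ}
    (h : ∀ i, Module.rank ℂ (eigenSpace (A i) z) = m) :
    Module.rank ℂ (eigenSpace (directSum A) z) = (2 * m : ℕ) := by
  let l : (i : Fin 2) → eigenSpace (directSum A) z →ₗ[ℂ] eigenSpace (A i) z := fun i =>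
    (PiLp.projₗ (𝕜 := ℂ) 2 (fun _ : Fin 2 => E) i).restrict fun x hx =>
      mem_eigenSpace_directSum.1 hx i
  have e := LinearEquiv.ofBijective (LinearMap.pi l) ⟨fun x y hxy => ?_, fun x => ?_⟩
  · simp [e.rank_eq, rank_pi, h]
  · refine Subtype.ext (PiLp.ext fun i => ?_)
    exact congrArg Subtype.val (congrFun hxy i)
  · have hx : WithLp.toLp 2 (fun i => (x i : E)) ∈ eigenSpace (directSum A) z :=
      mem_eigenSpace_directSum.2 fun i => (x i).2
    refine ⟨⟨_, hx⟩, funext fun i => Subtype.ext ?_⟩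
    rfl

/-- If `z̄` is an eigenvalue of `A*`, then `A - z` does not have dense range, so `z` lies in the
spectrum. -/
lemma mem_opSpectrum_of_eigenSpace_adjoint [CompleteSpace E] {A : E →ₗ.[ℂ] E}
    (hA : Dense (A.domain : Set E)) {z : ℂ}
    (h : eigenSpace A.adjoint ((starRingEnd ℂ) z) ≠ ⊥) : z ∈ opSpectrum A := by
  obtain ⟨x, hx, hx0⟩ := Submodule.exists_mem_ne_zero_of_ne_bot h
  intro hz
  obtain ⟨R, h1, -⟩ := mem_resolventSet_iff.1 hz
  have := (mem_graph_adjoint hA).1 (mem_eigenSpace.1 hx) _ _ (h1 x)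
  rw [inner_add_left, inner_smul_left, inner_smul_right, add_eq_right, inner_self_eq_zero] at this
  exact hx0 this

/-! ### Self-adjoint extensions of `A ⊕ (-A)` -/

/-- The operator `(f, g) ↦ (A* f, -A* g)` on the pairs with `f - g ∈ D(A**)`. The condition makes
the boundary forms of the two components cancel. -/
def doubledExtension [CompleteSpace E] (A : E →ₗ.[ℂ] E) : Double E →ₗ.[ℂ] Double E where
  domain := (directSum ![A.adjoint, -A.adjoint]).domain ⊓
    A.adjoint.adjoint.domain.comap
      (PiLp.projₗ (𝕜 := ℂ) 2 (fun _ : Fin 2 => E) 0 - PiLp.projₗ (𝕜 := ℂ) 2 (fun _ : Fin 2 => E) 1)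
  toFun := (directSum ![A.adjoint, -A.adjoint]).toFun ∘ₗ Submodule.inclusion inf_le_left

lemma mem_graph_doubledExtension [CompleteSpace E] {A : E →ₗ.[ℂ] E} {f h : Double E} :
    (f, h) ∈ (doubledExtension A).graph ↔ (f 0, h 0) ∈ A.adjoint.graph ∧
      (f 1, -h 1) ∈ A.adjoint.graph ∧ f 0 - f 1 ∈ A.adjoint.adjoint.domain := by
  have e : (f, h) ∈ (directSum ![A.adjoint, -A.adjoint]).graph ↔
      (f 0, h 0) ∈ A.adjoint.graph ∧ (f 1, -h 1) ∈ A.adjoint.graph := by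
    rw [mem_graph_directSum, Fin.forall_fin_two]
    exact and_congr Iff.rfl mem_graph_neg
  rw [← and_assoc, ← e, mem_graph_iff_exists, mem_graph_iff_exists]
  constructor
  · rintro ⟨⟨h1, h2⟩, h3⟩
    exact ⟨⟨h1, h3⟩, h2⟩
  · rintro ⟨⟨h1, h3⟩, h2⟩
    exact ⟨⟨h1, h2⟩, h3⟩

/-- For every symmetric `A`, the operator `A ⊕ (-A)` has a self-adjoint extension, given explicitly
by `doubledExtension`; no deficiency theory is needed. -/
lemma IsSymmetricOp.exists_selfAdjoint_extension [CompleteSpace E] {A : E →ₗ.[ℂ] E}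
    (hA : IsSymmetricOp A) :
    ∃ B : Double E →ₗ.[ℂ] Double E, directSum ![A, -A] ≤ B ∧ IsSelfAdjoint B := by
  have hle : ∀ {x y}, (x, y) ∈ A.graph → (x, y) ∈ A.adjoint.graph :=
    fun h => LinearPMap.le_graph_of_le hA.2 h
  have hd : Dense (A.adjoint.domain : Set E) := hA.1.mono hA.2.1
  -- `A ⊂ A**`
  have hle2 : ∀ {x y}, (x, y) ∈ A.graph → (x, y) ∈ A.adjoint.adjoint.graph := by
    intro x y hxy
    rw [mem_graph_adjoint hd]
    intro u v huv
    have := (mem_graph_adjoint hA.1).1 huv x y hxy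
    rw [← inner_conj_symm, ← this, inner_conj_symm]
  -- `A** ⊂ A*`
  have hle3 : ∀ {x y}, (x, y) ∈ A.adjoint.adjoint.graph → (x, y) ∈ A.adjoint.graph := by
    intro x y hxy
    rw [mem_graph_adjoint hd] at hxy
    rw [mem_graph_adjoint hA.1]
    exact fun u v huv => hxy u v (hle huv)
  have hext : directSum ![A, -A] ≤ doubledExtension A := by
    rw [← LinearPMap.le_graph_iff]
    rintro ⟨f, h⟩ hfh
    rw [mem_graph_directSum, Fin.forall_fin_two] at hfh
    obtain ⟨h0, h1⟩ := hfh
    replace h1 : (f 1, -h 1) ∈ A.graph := mem_graph_neg.1 h1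
    replace h0 : (f 0, h 0) ∈ A.graph := h0
    rw [mem_graph_doubledExtension]
    exact ⟨hle h0, hle h1, Submodule.sub_mem _ (LinearPMap.mem_domain_of_mem_graph (hle2 h0))
      (LinearPMap.mem_domain_of_mem_graph (hle2 h1))⟩
  have hdd : Dense ((doubledExtension A).domain : Set (Double E)) := by
    refine Dense.mono hext.1 (dense_directSum fun i => ?_)
    fin_cases i
    · exact hA.1
    · exact hA.1
  refine ⟨doubledExtension A, hext, ?_⟩
  refine IsSymmetricOp.isSelfAdjoint ((isSymmetricOp_iff hdd).2 ?_) ?_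
  · intro u v x y huv hxy
    rw [mem_graph_doubledExtension] at huv hxy
    obtain ⟨hu0, hu1, hu⟩ := huv
    obtain ⟨hx0, hx1, hx⟩ := hxy
    obtain ⟨w, hw⟩ := LinearPMap.mem_domain_iff.1 hu
    obtain ⟨t, ht⟩ := LinearPMap.mem_domain_iff.1 hx
    have hw' : v 0 + v 1 = w := by
      refine LinearPMap.mem_graph_snd_inj _ ?_ (hle3 hw) rfl
      simpa using A.adjoint.graph.sub_mem hu0 hu1
    have ht' : y 0 + y 1 = t := by
      refine LinearPMap.mem_graph_snd_inj _ ?_ (hle3 ht) rfl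
      simpa using A.adjoint.graph.sub_mem hx0 hx1
    subst hw' ht'
    -- the boundary form vanishes when one argument lies in `D(A**)`
    have e1 := (mem_graph_adjoint hd).1 ht _ _ hu0
    have e2 := (mem_graph_adjoint hd).1 hw _ _ hx1
    have e3 := congrArg (starRingEnd ℂ) e2
    rw [inner_conj_symm, inner_conj_symm] at e3
    simp only [PiLp.inner_apply, Fin.sum_univ_two]
    simp only [inner_add_left, inner_add_right, inner_sub_left, inner_sub_right,
      inner_neg_right] at e1 e3 ⊢
    linear_combination e1 - e3
  · intro x hx
    obtain ⟨y, hxy⟩ := LinearPMap.mem_domain_iff.1 hx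
    rw [mem_graph_adjoint hdd] at hxy
    have key : ∀ u v : Double E, (u 0, v 0) ∈ A.adjoint.graph → (u 1, -v 1) ∈ A.adjoint.graph →
        u 0 - u 1 ∈ A.adjoint.adjoint.domain →
        inner ℂ (v 0) (x 0) + inner ℂ (v 1) (x 1) =
          inner ℂ (u 0) (y 0) + inner ℂ (u 1) (y 1) := by
      intro u v h0 h1 h2
      have := hxy u v (mem_graph_doubledExtension.2 ⟨h0, h1, h2⟩)
      simpa only [PiLp.inner_apply, Fin.sum_univ_two] using this
    have hx0 : (x 0, y 0) ∈ A.adjoint.graph := by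
      rw [mem_graph_adjoint hA.1]
      intro u v huv
      have := key (WithLp.toLp 2 ![u, 0]) (WithLp.toLp 2 ![v, 0]) (by simpa using hle huv)
        (by simp)
        (by simpa using! LinearPMap.mem_domain_of_mem_graph (hle2 huv))
      simpa using this
    have hx1 : (x 1, -y 1) ∈ A.adjoint.graph := by
      rw [mem_graph_adjoint hA.1]
      intro u v huv
      have := key (WithLp.toLp 2 ![0, u]) (WithLp.toLp 2 ![0, -v])
        A.adjoint.graph.zero_mem (by simpa using hle huv)
        (by simpa using LinearPMap.mem_domain_of_mem_graph (hle2 huv))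
      simp only [Matrix.cons_val_zero, Matrix.cons_val_one, inner_zero_left, zero_add,
        inner_neg_left] at this
      rw [inner_neg_right, ← this, neg_neg]
    have hx01 : x 0 - x 1 ∈ A.adjoint.adjoint.domain := by
      refine LinearPMap.mem_domain_of_mem_graph (y := y 0 + y 1) ?_
      rw [mem_graph_adjoint hd]
      intro u v huv
      have := key (WithLp.toLp 2 ![u, u]) (WithLp.toLp 2 ![v, -v])
        (by simpa using huv) (by simpa using huv) (by simp)
      simp only [Matrix.cons_val_zero, Matrix.cons_val_one, inner_neg_left] at this
      rw [inner_sub_right, inner_add_right, ← this]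
      ring
    exact LinearPMap.mem_domain_of_mem_graph
      (mem_graph_doubledExtension.2 ⟨hx0, hx1, hx01⟩)

end Graphs

/-! ### Absolutely continuous functions -/

section AbsolutelyContinuous

lemma absolutelyContinuousOnInterval_of_dist_le {X Y : Type*} [PseudoMetricSpace X]
    [PseudoMetricSpace Y] {f : ℝ → X} {g : ℝ → Y} {a b : ℝ}
    (hf : AbsolutelyContinuousOnInterval f a b)
    (h : ∀ x ∈ uIcc a b, ∀ y ∈ uIcc a b, dist (g x) (g y) ≤ dist (f x) (f y)) :
    AbsolutelyContinuousOnInterval g a b := by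
  refine squeeze_zero' (Filter.Eventually.of_forall fun t =>
    Finset.sum_nonneg fun i _ => dist_nonneg) ?_ hf
  filter_upwards [Filter.mem_inf_of_right (Filter.mem_principal_self _)] with t ht
  exact Finset.sum_le_sum fun i hi => h _ (ht.1 i hi).1 _ (ht.1 i hi).2

/-- `F` is absolutely continuous between `a` and `b`, with derivative `F'` almost everywhere. -/
structure HasACDeriv (F F' : ℝ → ℂ) (a b : ℝ) : Prop where
  ac : AbsolutelyContinuousOnInterval F a b
  deriv : ∀ᵐ x, x ∈ uIcc a b → HasDerivAt F (F' x) x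

variable {F F' G G' : ℝ → ℂ} {a b c d : ℝ}

lemma hasACDeriv_of_ac (hF : AbsolutelyContinuousOnInterval F a b) :
    HasACDeriv F (_root_.deriv F) a b := by
  refine ⟨hF, ?_⟩
  filter_upwards [hF.boundedVariationOn.ae_differentiableAt_of_mem_uIcc] with x hx hx'
  exact (hx hx').hasDerivAt

lemma HasACDeriv.congr_deriv (hF : HasACDeriv F F' a b)
    (h : ∀ᵐ x, x ∈ uIcc a b → F' x = G' x) : HasACDeriv F G' a b := by
  refine ⟨hF.ac, ?_⟩
  filter_upwards [hF.deriv, h] with x h1 h2 hx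
  rw [← h2 hx]
  exact h1 hx

lemma HasACDeriv.mono (hF : HasACDeriv F F' a b) (h : uIcc c d ⊆ uIcc a b) :
    HasACDeriv F F' c d := by
  refine ⟨hF.ac.mono h, ?_⟩
  filter_upwards [hF.deriv] with x h1 hx
  exact h1 (h hx)

lemma HasACDeriv.continuousOn (hF : HasACDeriv F F' a b) : ContinuousOn F (uIcc a b) :=
  hF.ac.continuousOn

lemma HasACDeriv.mul (hF : HasACDeriv F F' a b) (hG : HasACDeriv G G' a b) :
    HasACDeriv (fun x => F x * G x) (fun x => F' x * G x + F x * G' x) a b := by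
  refine ⟨hF.ac.fun_smul hG.ac, ?_⟩
  filter_upwards [hF.deriv, hG.deriv] with x h1 h2 hx
  exact (h1 hx).mul (h2 hx)

lemma HasACDeriv.sub (hF : HasACDeriv F F' a b) (hG : HasACDeriv G G' a b) :
    HasACDeriv (fun x => F x - G x) (fun x => F' x - G' x) a b := by
  refine ⟨hF.ac.fun_sub hG.ac, ?_⟩
  filter_upwards [hF.deriv, hG.deriv] with x h1 h2 hx
  exact (h1 hx).sub (h2 hx)

lemma HasACDeriv.const_mul (r : ℂ) (hF : HasACDeriv F F' a b) :
    HasACDeriv (fun x => r * F x) (fun x => r * F' x) a b := by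
  refine ⟨hF.ac.const_smul r, ?_⟩
  filter_upwards [hF.deriv] with x h1 hx
  exact (h1 hx).const_mul r

lemma HasACDeriv.conj (hF : HasACDeriv F F' a b) :
    HasACDeriv (fun x => (starRingEnd ℂ) (F x)) (fun x => (starRingEnd ℂ) (F' x)) a b := by
  refine ⟨absolutelyContinuousOnInterval_of_dist_le hF.ac fun x _ y _ => ?_, ?_⟩
  · exact (Complex.dist_conj_conj _ _).le
  · filter_upwards [hF.deriv] with x h1 hx
    exact Complex.conjCLE.toContinuousLinearMap.hasFDerivAt.comp_hasDerivAt x (h1 hx)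

lemma hasACDeriv_of_hasDerivAt (h : ∀ x ∈ uIcc a b, HasDerivAt F (F' x) x)
    (hc : ContinuousOn F' (uIcc a b)) : HasACDeriv F F' a b := by
  refine ⟨?_, Filter.Eventually.of_forall h⟩
  obtain ⟨C, hC⟩ := isCompact_uIcc.exists_bound_of_continuousOn hc
  refine LipschitzOnWith.absolutelyContinuousOnInterval (K := C.toNNReal)
    ((convex_uIcc a b).lipschitzOnWith_of_nnnorm_hasDerivWithin_le
      (fun x hx => (h x hx).hasDerivWithinAt) fun x hx => ?_)
  exact NNReal.coe_le_coe.1 ((hC x hx).trans (Real.le_coe_toNNReal C))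

lemma HasACDeriv.intervalIntegrable (hF : HasACDeriv F F' a b) :
    IntervalIntegrable F' volume a b := by
  have h1 : AbsolutelyContinuousOnInterval (fun x => (F x).re) a b :=
    absolutelyContinuousOnInterval_of_dist_le hF.ac fun x _ y _ => by
      rw [Real.dist_eq, Complex.dist_eq, ← Complex.sub_re]
      exact Complex.abs_re_le_norm _
  have h2 : AbsolutelyContinuousOnInterval (fun x => (F x).im) a b :=
    absolutelyContinuousOnInterval_of_dist_le hF.ac fun x _ y _ => by
      rw [Real.dist_eq, Complex.dist_eq, ← Complex.sub_im]
      exact Complex.abs_im_le_norm _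
  have h3 : IntervalIntegrable
      (fun x => ((_root_.deriv (fun x => (F x).re) x : ℝ) : ℂ)) volume a b :=
    ⟨h1.intervalIntegrable_deriv.1.ofReal, h1.intervalIntegrable_deriv.2.ofReal⟩
  have h4 : IntervalIntegrable
      (fun x => ((_root_.deriv (fun x => (F x).im) x : ℝ) : ℂ)) volume a b :=
    ⟨h2.intervalIntegrable_deriv.1.ofReal, h2.intervalIntegrable_deriv.2.ofReal⟩
  refine (h3.add (h4.mul_const Complex.I)).congr_ae ?_
  rw [Filter.EventuallyEq, ae_restrict_iff' measurableSet_uIoc]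
  filter_upwards [hF.deriv] with x hx hx'
  have hd := hx (uIoc_subset_uIcc hx')
  have e1 : HasDerivAt (fun x => (F x).re) (F' x).re x :=
    Complex.reCLM.hasFDerivAt.comp_hasDerivAt x hd
  have e2 : HasDerivAt (fun x => (F x).im) (F' x).im x :=
    Complex.imCLM.hasFDerivAt.comp_hasDerivAt x hd
  rw [e1.deriv, e2.deriv]
  exact Complex.re_add_im _

lemma hasACDeriv_primitive (h : IntervalIntegrable F' volume a b) :
    HasACDeriv (fun x => ∫ t in a..x, F' t) F' a b := by
  refine ⟨?_, ?_⟩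
  · have hi : ∀ x ∈ uIcc a b, IntervalIntegrable F' volume a x := fun x hx =>
      h.mono_set (uIcc_subset_uIcc left_mem_uIcc hx)
    refine absolutelyContinuousOnInterval_of_dist_le
      (h.norm.absolutelyContinuousOnInterval_intervalIntegral left_mem_uIcc) fun x hx y hy => ?_
    rw [dist_comm, dist_comm (∫ v in a..x, ‖F' v‖), dist_eq_norm, dist_eq_norm,
      intervalIntegral.integral_interval_sub_left (hi y hy) (hi x hx),
      intervalIntegral.integral_interval_sub_left (hi y hy).norm (hi x hx).norm, Real.norm_eq_abs]
    exact intervalIntegral.norm_integral_le_abs_integral_norm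
  · filter_upwards [h.ae_hasDerivAt_integral] with x hx hx'
    exact hx hx' a left_mem_uIcc

lemma HasACDeriv.eq_of_deriv_eq_zero (hF : HasACDeriv F F' a b)
    (h : ∀ᵐ x, x ∈ uIcc a b → F' x = 0) {x y : ℝ} (hx : x ∈ uIcc a b) (hy : y ∈ uIcc a b) :
    F x = F y := by
  obtain ⟨C, hC⟩ := hF.ac.const_of_ae_hasDerivAt_zero (by
    filter_upwards [hF.deriv, h] with x h1 h2 hx
    rw [← h2 hx]
    exact h1 hx)
  rw [hC x hx, hC y hy]

lemma HasACDeriv.integral_eq_sub (hF : HasACDeriv F F' a b) :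
    ∫ x in a..b, F' x = F b - F a := by
  have := (hF.sub (hasACDeriv_primitive hF.intervalIntegrable)).eq_of_deriv_eq_zero
    (by simp) (right_mem_uIcc (a := a) (b := b)) left_mem_uIcc
  simp only [intervalIntegral.integral_same, sub_zero] at this
  rw [← this]
  ring

/-- Functions that agree almost everywhere on an interval and are absolutely continuous there have
the same derivative almost everywhere. -/
lemma HasACDeriv.deriv_unique (hab : a < b) (hF : HasACDeriv F F' a b) (hG : HasACDeriv G G' a b)
    (h : ∀ᵐ x, x ∈ uIcc a b → F x = G x) :
    EqOn F G (uIcc a b) ∧ ∀ᵐ x, x ∈ uIcc a b → F' x = G' x := by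
  rw [uIcc_of_le hab.le] at h ⊢
  have he : EqOn F G (Icc a b) := by
    refine Measure.eqOn_Icc_of_ae_eq volume hab.ne ?_ ?_ ?_
    · rwa [Filter.EventuallyEq, ae_restrict_iff' measurableSet_Icc]
    · exact uIcc_of_le hab.le ▸ hF.continuousOn
    · exact uIcc_of_le hab.le ▸ hG.continuousOn
  refine ⟨he, ?_⟩
  have h1 : ∀ᵐ x : ℝ, x ≠ a := by simp [ae_iff, measure_singleton]
  have h2 : ∀ᵐ x : ℝ, x ≠ b := by simp [ae_iff, measure_singleton]
  filter_upwards [hF.deriv, hG.deriv, h1, h2] with x hx hx' h1 h2 hm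
  have hm' : x ∈ uIcc a b := by rwa [uIcc_of_le hab.le]
  refine (hx hm').unique ((hx' hm').congr_of_eventuallyEq ?_)
  filter_upwards [Icc_mem_nhds (lt_of_le_of_ne hm.1 h1.symm) (lt_of_le_of_ne hm.2 h2)] with y hy
  exact he hy

/-- The fundamental theorem of calculus for a function that is continuous on a closed interval,
absolutely continuous in its interior, and has an integrable derivative. -/
lemma integral_eq_sub_of_hasACDeriv_interior (hab : a < b) (hc : ContinuousOn F (Icc a b))
    (hF : ∀ x y, a < x → x ≤ y → y < b → HasACDeriv F F' x y)
    (hi : IntervalIntegrable F' volume a b) : ∫ x in a..b, F' x = F b - F a := by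
  set D : ℝ → ℂ := fun x => F x - ∫ t in a..x, F' t with hD
  have hDc : ContinuousOn D (Icc a b) := by
    have := (hasACDeriv_primitive hi).continuousOn
    rw [uIcc_of_le hab.le] at this
    exact hc.sub this
  have h1 : ∀ x y, a < x → x ≤ y → y < b → D x = D y := by
    intro x y hx hxy hy
    have hs : uIcc x y ⊆ uIcc a b := by
      rw [uIcc_of_le hxy, uIcc_of_le hab.le]
      exact Icc_subset_Icc hx.le hy.le
    exact ((hF x y hx hxy hy).sub ((hasACDeriv_primitive hi).mono hs)).eq_of_deriv_eq_zero
      (by simp) left_mem_uIcc right_mem_uIcc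
  obtain ⟨m, hm⟩ := exists_between hab
  have h2 : EqOn D (fun _ => D m) (Ioo a b) := by
    intro x hx
    rcases le_total x m with h | h
    · exact h1 x m hx.1 h hm.2
    · exact (h1 m x hm.1 h hx.2).symm
  have h3 : EqOn D (fun _ => D m) (Icc a b) := by
    refine h2.of_subset_closure hDc continuousOn_const Ioo_subset_Icc_self ?_
    rw [closure_Ioo hab.ne]
  have h4 : D b = D a :=
    (h3 (right_mem_Icc.2 hab.le)).trans (h3 (left_mem_Icc.2 hab.le)).symm
  simp only [hD, intervalIntegral.integral_same, sub_zero] at h4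
  rw [← h4]
  ring

end AbsolutelyContinuous

/-! ### The momentum operator -/

lemma ae_momentumMeasure_iff {p : ℝ → Prop} :
    (∀ᵐ k ∂momentumMeasure, p k) ↔ ∀ᵐ k, k ∈ uIcc 0 (2 * Real.pi) → p k := by
  rw [ae_momentumMeasure, ae_restrict_iff' measurableSet_Icc, uIcc_of_le Real.two_pi_pos.le]

lemma integral_momentumMeasure (G : ℝ → ℂ) :
    ∫ k, G k ∂momentumMeasure = (2 * Real.pi)⁻¹ * ∫ k in (0)..(2 * Real.pi), G k := by
  rw [momentumMeasure_def, integral_smul_measure,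
    intervalIntegral.integral_of_le Real.two_pi_pos.le, ← integral_Icc_eq_integral_Ioc,
    ENNReal.toReal_ofReal (by positivity), Complex.real_smul]

lemma intervalIntegrable_of_integrable {G : ℝ → ℂ} (h : Integrable G momentumMeasure) :
    IntervalIntegrable G volume 0 (2 * Real.pi) := by
  rw [intervalIntegrable_iff_integrableOn_Icc_of_le Real.two_pi_pos.le]
  rwa [momentumMeasure_def, integrable_smul_measure (by simp [Real.pi_pos])
    ENNReal.ofReal_ne_top] at h

lemma inner_K₁ (f g : K₁) :
    inner ℂ f g = ∫ k, (starRingEnd ℂ) (f k) * g k ∂momentumMeasure := by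
  rw [L2.inner_def]
  refine integral_congr_ae (Filter.Eventually.of_forall fun k => ?_)
  exact RCLike.inner_apply' _ _

lemma integrable_conj_mul (f g : K₁) :
    Integrable (fun k => (starRingEnd ℂ) (f k) * g k) momentumMeasure := by
  have := L2.integrable_inner (𝕜 := ℂ) f g
  refine this.congr (Filter.Eventually.of_forall fun k => ?_)
  exact RCLike.inner_apply' _ _

/-- Two inner products agree if the difference of their integrands is the derivative of a function
with equal values at `0` and `2π`. -/
lemma inner_eq_inner_of_hasACDeriv {f g u v : K₁} {H H' : ℝ → ℂ}
    (hH : HasACDeriv H H' 0 (2 * Real.pi)) (h0 : H 0 = H (2 * Real.pi))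
    (h : ∀ᵐ k ∂momentumMeasure,
      (starRingEnd ℂ) (f k) * g k - (starRingEnd ℂ) (u k) * v k = H' k) :
    inner ℂ f g = inner ℂ u v := by
  rw [← sub_eq_zero, inner_K₁, inner_K₁,
    ← integral_sub (integrable_conj_mul f g) (integrable_conj_mul u v), integral_congr_ae h,
    integral_momentumMeasure, hH.integral_eq_sub, h0, sub_self, mul_zero]

lemma memLp_of_continuousOn {G : ℝ → ℂ} (hG : ContinuousOn G (uIcc 0 (2 * Real.pi))) :
    MemLp G 2 momentumMeasure := by
  obtain ⟨C, hC⟩ := isCompact_uIcc.exists_bound_of_continuousOn hG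
  refine MemLp.of_bound ?_ C (ae_momentumMeasure_iff.2 (Filter.Eventually.of_forall hC))
  rw [momentumMeasure_def]
  refine AEStronglyMeasurable.smul_measure ?_ _
  rw [uIcc_of_le Real.two_pi_pos.le] at hG
  exact hG.aestronglyMeasurable measurableSet_Icc

lemma memLp_mul_of_continuousOn {G f : ℝ → ℂ} (hG : ContinuousOn G (uIcc 0 (2 * Real.pi)))
    (hf : MemLp f 2 momentumMeasure) : MemLp (fun k => G k * f k) 2 momentumMeasure := by
  obtain ⟨C, hC⟩ := isCompact_uIcc.exists_bound_of_continuousOn hG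
  refine hf.of_le_mul (c := C)
    ((memLp_of_continuousOn hG).aestronglyMeasurable.mul hf.aestronglyMeasurable) ?_
  refine ae_momentumMeasure_iff.2 (Filter.Eventually.of_forall fun k hk => ?_)
  rw [norm_mul]
  exact mul_le_mul_of_nonneg_right (hC k hk) (norm_nonneg _)

lemma mem_momentumOp_graph {f h : K₁} :
    (f, h) ∈ momentumOp.graph ↔ ∃ F F' : ℝ → ℂ, HasACDeriv F F' 0 (2 * Real.pi) ∧
      F 0 = F (2 * Real.pi) ∧ f =ᵐ[momentumMeasure] F ∧
      h =ᵐ[momentumMeasure] fun k => -Complex.I * F' k := by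
  rw [momentumOp_graph]
  constructor
  · rintro ⟨F, h1, h2, h3, h4⟩
    exact ⟨F, _, hasACDeriv_of_ac h1, h2, h3, h4⟩
  · rintro ⟨F, F', h1, h2, h3, h4⟩
    refine ⟨F, h1.ac, h2, h3, ?_⟩
    filter_upwards [h4, ae_momentumMeasure_iff.2 h1.deriv] with k h5 h6
    rw [h5, h6.deriv]

lemma hasDerivAt_fourierMode (n : ℤ) (k : ℝ) :
    HasDerivAt (fun k : ℝ => Complex.exp (-Complex.I * n * k))
      (-Complex.I * n * Complex.exp (-Complex.I * n * k)) k := by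
  have h1 : HasDerivAt (fun k : ℝ => -Complex.I * n * (k : ℂ)) (-Complex.I * n * 1) k :=
    (Complex.ofRealCLM.hasDerivAt (x := k)).const_mul _
  convert! h1.cexp using 1
  ring

lemma exp_two_pi_periodic (n : ℤ) (k : ℝ) :
    Complex.exp (-Complex.I * n * ((k + 2 * Real.pi : ℝ) : ℂ)) =
      Complex.exp (-Complex.I * n * k) := by
  rw [Complex.exp_eq_exp_iff_exists_int]
  refine ⟨-n, ?_⟩
  push_cast
  ring

lemma fourierMode_mem_momentumOp_graph (n : ℤ) :
    (fourierMode n, (-n : ℂ) • fourierMode n) ∈ momentumOp.graph := by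
  refine mem_momentumOp_graph.2 ⟨_, _, hasACDeriv_of_hasDerivAt
    (fun k _ => hasDerivAt_fourierMode n k) (by fun_prop), ?_, (memLp_fourierMode n).coeFn_toLp, ?_⟩
  · have := exp_two_pi_periodic n 0
    rw [zero_add] at this
    exact this.symm
  · filter_upwards [(memLp_fourierMode n).coeFn_toLp, Lp.coeFn_smul (-n : ℂ) (fourierMode n)]
      with k h1 h2
    rw [h2, Pi.smul_apply, smul_eq_mul]
    rw [fourierMode, h1]
    linear_combination (-(n : ℂ) * Complex.exp (-Complex.I * n * k)) * Complex.I_mul_I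

lemma eq_zero_of_inner_fourierMode {f : K₁} (h : ∀ n, inner ℂ (fourierMode n) f = 0) : f = 0 := by
  have : f ∈ (Submodule.span ℂ (range fourierMode))ᗮ := by
    rw [Submodule.mem_orthogonal]
    intro u hu
    induction hu using Submodule.span_induction with
    | mem x hx => obtain ⟨n, rfl⟩ := hx; exact h n
    | zero => exact inner_zero_left _
    | add x y _ _ hx hy => rw [inner_add_left, hx, hy, add_zero]
    | smul c x _ hx => rw [inner_smul_left, hx, mul_zero]
  rwa [fourierMode_complete, Submodule.mem_bot] at this

lemma dense_of_orthogonal_eq_zero {E : Type*} [NormedAddCommGroup E] [InnerProductSpace ℂ E]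
    [CompleteSpace E] {S : Submodule ℂ E} (h : ∀ f, (∀ u ∈ S, inner ℂ u f = 0) → f = 0) :
    Dense (S : Set E) := by
  rw [Submodule.dense_iff_topologicalClosure_eq_top,
    Submodule.topologicalClosure_eq_top_iff, eq_bot_iff]
  exact fun f hf => h f ((Submodule.mem_orthogonal _ f).1 hf)

lemma dense_momentumOp : Dense (momentumOp.domain : Set K₁) :=
  dense_of_orthogonal_eq_zero fun _ hf => eq_zero_of_inner_fourierMode fun n =>
    hf _ (LinearPMap.mem_domain_of_mem_graph (fourierMode_mem_momentumOp_graph n))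

lemma isSymmetricOp_momentumOp : IsSymmetricOp momentumOp := by
  rw [isSymmetricOp_iff dense_momentumOp]
  intro u v x y huv hxy
  obtain ⟨F, F', hF, hF0, hu, hv⟩ := mem_momentumOp_graph.1 huv
  obtain ⟨G, G', hG, hG0, hx, hy⟩ := mem_momentumOp_graph.1 hxy
  refine inner_eq_inner_of_hasACDeriv ((hF.conj.mul hG).const_mul Complex.I) ?_ ?_
  · simp only [hF0, hG0]
  · filter_upwards [hu, hv, hx, hy] with k h1 h2 h3 h4
    rw [h1, h2, h3, h4, map_mul, map_neg, Complex.conj_I]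
    ring

/-- The momentum operator with periodic boundary condition is self-adjoint: the equation
`f ∈ D(P*)`, `P* f = h`, tested against the Fourier modes, says that `f` and `∫ i h` have the
same Fourier coefficients, up to the one of index `0`. -/
lemma isSelfAdjoint_momentumOp : IsSelfAdjoint momentumOp := by
  refine isSymmetricOp_momentumOp.isSelfAdjoint fun f hf => ?_
  obtain ⟨h, hfh⟩ := LinearPMap.mem_domain_iff.1 hf
  rw [mem_graph_adjoint dense_momentumOp] at hfh
  have hfn : ∀ n : ℤ, -n * inner ℂ (fourierMode n) f = inner ℂ (fourierMode n) h := by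
    intro n
    have := hfh _ _ (fourierMode_mem_momentumOp_graph n)
    rwa [inner_smul_left, map_neg, map_intCast] at this
  have hint : IntervalIntegrable (fun k => Complex.I * h k) volume 0 (2 * Real.pi) :=
    (intervalIntegrable_of_integrable ((Lp.memLp h).integrable (by norm_num))).const_mul _
  set F : ℝ → ℂ := fun x => ∫ t in (0)..x, Complex.I * h t with hFdef
  have hF := hasACDeriv_primitive hint
  have hF0 : F 0 = F (2 * Real.pi) := by
    have h0 := hfn 0
    rw [inner_K₁, inner_K₁] at h0
    have : ∫ k, (starRingEnd ℂ) (fourierMode 0 k) * h k ∂momentumMeasure =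
        ∫ k, h k ∂momentumMeasure := by
      refine integral_congr_ae ?_
      filter_upwards [(memLp_fourierMode 0).coeFn_toLp] with k hk
      rw [fourierMode, hk]
      simp
    rw [this] at h0
    simp only [Int.cast_zero, neg_zero, zero_mul] at h0
    rw [eq_comm, integral_momentumMeasure] at h0
    have h1 : ∫ k in (0)..(2 * Real.pi), h k = 0 := by
      refine (mul_eq_zero.1 h0).resolve_left ?_
      simp [Real.pi_ne_zero]
    simp only [hFdef, intervalIntegral.integral_same, intervalIntegral.integral_const_mul, h1,
      mul_zero]
  have hFL : MemLp F 2 momentumMeasure := memLp_of_continuousOn hF.continuousOn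
  have hg : (hFL.toLp F, h) ∈ momentumOp.graph := by
    refine mem_momentumOp_graph.2 ⟨F, _, hF, hF0, hFL.coeFn_toLp,
      Filter.Eventually.of_forall fun k => ?_⟩
    linear_combination (h k) * Complex.I_mul_I
  set g := hFL.toLp F
  have hgn : ∀ n : ℤ, -n * inner ℂ (fourierMode n) g = inner ℂ (fourierMode n) h := by
    intro n
    have := (isSymmetricOp_iff dense_momentumOp).1 isSymmetricOp_momentumOp _ _ _ _
      (fourierMode_mem_momentumOp_graph n) hg
    rwa [inner_smul_left, map_neg, map_intCast] at this
  have hz : f - g - inner ℂ (fourierMode 0) (f - g) • fourierMode 0 = 0 := by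
    refine eq_zero_of_inner_fourierMode fun n => ?_
    rw [inner_sub_right, inner_smul_right, orthonormal_iff_ite.1 fourierMode_orthonormal]
    rcases eq_or_ne n 0 with rfl | hn
    · simp
    · rw [if_neg hn, mul_zero, sub_zero, inner_sub_right, sub_eq_zero]
      have hn' : (-n : ℂ) ≠ 0 := by exact_mod_cast neg_ne_zero.2 hn
      exact mul_left_cancel₀ hn' ((hfn n).trans (hgn n).symm)
  have hf' : f = inner ℂ (fourierMode 0) (f - g) • fourierMode 0 + g := by
    rw [sub_eq_zero] at hz
    rw [← hz]
    abel
  rw [hf']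
  exact momentumOp.domain.add_mem (momentumOp.domain.smul_mem _
    (LinearPMap.mem_domain_of_mem_graph (fourierMode_mem_momentumOp_graph 0)))
    (LinearPMap.mem_domain_of_mem_graph hg)

/-! ### The operator `(i/2) (q P + P q)` with `q = 1 / (i τ)` -/

section Graphs

variable {E F : Type*} [NormedAddCommGroup E] [InnerProductSpace ℂ E]
  [NormedAddCommGroup F] [InnerProductSpace ℂ F]

lemma mem_graph_smul {A : E →ₗ.[ℂ] F} {c : ℂ} {x : E} {y : F} :
    (x, y) ∈ (c • A).graph ↔ ∃ v, (x, v) ∈ A.graph ∧ y = c • v := by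
  simp only [mem_graph_iff_exists]
  constructor
  · rintro ⟨h, rfl⟩
    exact ⟨_, ⟨h, rfl⟩, rfl⟩
  · rintro ⟨v, ⟨h, rfl⟩, rfl⟩
    exact ⟨h, rfl⟩

lemma mem_graph_add {A B : E →ₗ.[ℂ] F} {x : E} {y : F} :
    (x, y) ∈ (A + B).graph ↔ ∃ u v, (x, u) ∈ A.graph ∧ (x, v) ∈ B.graph ∧ y = u + v := by
  simp only [mem_graph_iff_exists]
  constructor
  · rintro ⟨h, rfl⟩
    exact ⟨_, _, ⟨h.1, rfl⟩, ⟨h.2, rfl⟩, rfl⟩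
  · rintro ⟨u, v, ⟨h, rfl⟩, ⟨h', rfl⟩, rfl⟩
    exact ⟨⟨h, h'⟩, rfl⟩

end Graphs

lemma mem_graph_mulOp {g : ℝ → ℂ} {f h : K₁} :
    (f, h) ∈ (mulOp g).graph ↔ h =ᵐ[momentumMeasure] fun k => g k * f k := by
  rw [mem_graph_iff_exists]
  constructor
  · rintro ⟨hf, rfl⟩
    exact MemLp.coeFn_toLp hf
  · intro h1
    have hf : MemLp (fun k => g k * f k) 2 momentumMeasure := (Lp.memLp h).ae_eq h1
    exact ⟨hf, Lp.ext ((MemLp.coeFn_toLp hf).trans h1.symm)⟩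

/-- Multiplication by a continuous function. -/
def mulCont (g : ℝ → ℂ) (hg : Continuous g) (f : K₁) : K₁ :=
  (memLp_mul_of_continuousOn hg.continuousOn (Lp.memLp f)).toLp _

lemma mulCont_ae (g : ℝ → ℂ) (hg : Continuous g) (f : K₁) :
    mulCont g hg f =ᵐ[momentumMeasure] fun k => g k * f k :=
  MemLp.coeFn_toLp _

lemma inner_eq_of_ae {f g u v : K₁} (h : ∀ᵐ k ∂momentumMeasure,
    (starRingEnd ℂ) (f k) * g k = (starRingEnd ℂ) (u k) * v k) : inner ℂ f g = inner ℂ u v := by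
  rw [inner_K₁, inner_K₁]
  exact integral_congr_ae h

lemma inner_mulCont_left {g : ℝ → ℝ} (hg : Continuous fun k => (g k : ℂ)) (u v : K₁) :
    inner ℂ (mulCont _ hg u) v = inner ℂ u (mulCont _ hg v) := by
  refine inner_eq_of_ae ?_
  filter_upwards [mulCont_ae _ hg u, mulCont_ae _ hg v] with k h1 h2
  rw [h1, h2, map_mul, Complex.conj_ofReal]
  ring

/-- A real `C¹` function `τ` with derivative `τ'`, equal values at the ends of `[0, 2π]`, and
almost no zeros. It plays the role of the derivative of the phase of an eigenvalue. -/
structure IsSpeed (τ τ' : ℝ → ℝ) : Prop where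
  hasDerivAt : ∀ k, HasDerivAt τ (τ' k) k
  continuous_deriv : Continuous τ'
  periodic : τ 0 = τ (2 * Real.pi)
  ae_ne_zero : ∀ᵐ k ∂momentumMeasure, τ k ≠ 0

/-- The operator `(i/2) (q P + P q)` on its natural domain, where `q = 1 / (i τ)`. -/
def speedOp (τ : ℝ → ℝ) : K₁ →ₗ.[ℂ] K₁ :=
  let q := mulOp fun k => -Complex.I / (τ k : ℂ)
  (Complex.I / 2) • (natComp q momentumOp + natComp momentumOp q)

namespace IsSpeed

variable {τ τ' : ℝ → ℝ}

lemma continuous (hτ : IsSpeed τ τ') : Continuous τ :=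
  continuous_iff_continuousAt.2 fun k => (hτ.hasDerivAt k).continuousAt

lemma continuous_ofReal (hτ : IsSpeed τ τ') : Continuous fun k => (τ k : ℂ) :=
  Complex.continuous_ofReal.comp hτ.continuous

lemma continuous_deriv_ofReal (hτ : IsSpeed τ τ') : Continuous fun k => (τ' k : ℂ) :=
  Complex.continuous_ofReal.comp hτ.continuous_deriv

lemma hasACDeriv (hτ : IsSpeed τ τ') (a b : ℝ) :
    HasACDeriv (fun k => (τ k : ℂ)) (fun k => (τ' k : ℂ)) a b :=
  hasACDeriv_of_hasDerivAt (fun k _ => (hτ.hasDerivAt k).ofReal_comp)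
    hτ.continuous_deriv_ofReal.continuousOn

lemma neg (hτ : IsSpeed τ τ') : IsSpeed (fun k => -τ k) (fun k => -τ' k) where
  hasDerivAt k := (hτ.hasDerivAt k).neg
  continuous_deriv := hτ.continuous_deriv.neg
  periodic := by rw [hτ.periodic]
  ae_ne_zero := by
    filter_upwards [hτ.ae_ne_zero] with k hk
    exact neg_ne_zero.2 hk

/-- The elements of the domain are the functions `τ E`, with `E` absolutely continuous and
periodic, `E' ∈ L²` and `(τ' / τ) E ∈ L²`; the operator maps `τ E` to
`-i (E' + (τ' / 2τ) E)`. -/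
lemma mem_graph_speedOp (hτ : IsSpeed τ τ') {f h : K₁} :
    (f, h) ∈ (speedOp τ).graph ↔ ∃ E E' : ℝ → ℂ, HasACDeriv E E' 0 (2 * Real.pi) ∧
      E 0 = E (2 * Real.pi) ∧ MemLp E' 2 momentumMeasure ∧
      MemLp (fun k => (τ' k : ℂ) / τ k * E k) 2 momentumMeasure ∧
      f =ᵐ[momentumMeasure] (fun k => τ k * E k) ∧
      h =ᵐ[momentumMeasure] fun k => -Complex.I * (E' k + τ' k / (2 * τ k) * E k) := by
  have hI := Complex.I_mul_I
  simp only [speedOp, mem_graph_smul, mem_graph_add, mem_graph_natComp, mem_graph_mulOp,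
    mem_momentumOp_graph]
  constructor
  · rintro ⟨_, ⟨u, v, ⟨w, ⟨F, F', hF, hF0, hf, hw⟩, hu⟩, ⟨w', hw', G, G', hG, hG0, hw2, hv⟩, rfl⟩,
      rfl⟩
    have hE := hG.const_mul Complex.I
    have hfE : f =ᵐ[momentumMeasure] fun k => τ k * (Complex.I * G k) := by
      filter_upwards [hw', hw2, hτ.ae_ne_zero] with k h1 h2 h3
      have h3' : (τ k : ℂ) ≠ 0 := by exact_mod_cast h3
      rw [← h2, h1]
      field_simp
      linear_combination (f k) * hI
    have hder := (hF.deriv_unique Real.two_pi_pos ((hτ.hasACDeriv _ _).mul hE)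
      (ae_momentumMeasure_iff.1 (hf.symm.trans hfE))).2
    rw [← ae_momentumMeasure_iff] at hder
    have hvE : v =ᵐ[momentumMeasure] fun k => -(Complex.I * G' k) := by
      filter_upwards [hv] with k h1
      rw [h1]
      ring
    have huE : u =ᵐ[momentumMeasure] fun k =>
        -((τ' k : ℂ) / τ k * (Complex.I * G k) + Complex.I * G' k) := by
      filter_upwards [hu, hw, hder, hτ.ae_ne_zero] with k h1 h2 h3 h4
      have h4' : (τ k : ℂ) ≠ 0 := by exact_mod_cast h4
      rw [h1, h2, h3]
      field_simp
      linear_combination (τ' k * G k + τ k * G' k) * hI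
    refine ⟨_, _, hE, by rw [hG0], ?_, ?_, hfE, ?_⟩
    · refine (Lp.memLp v).neg.ae_eq ?_
      filter_upwards [hvE] with k h1
      rw [Pi.neg_apply, h1, neg_neg]
    · refine ((Lp.memLp v).sub (Lp.memLp u)).ae_eq ?_
      filter_upwards [hvE, huE] with k h1 h2
      rw [Pi.sub_apply, h1, h2]
      ring
    · filter_upwards [hvE, huE, Lp.coeFn_add u v, Lp.coeFn_smul (Complex.I / 2) (u + v)]
        with k h1 h2 h3 h4
      rw [h4, Pi.smul_apply, h3, Pi.add_apply, h1, h2, smul_eq_mul]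
      ring
  · rintro ⟨E, E', hE, hE0, hE', hτE, hf, hh⟩
    have hF := (hτ.hasACDeriv 0 (2 * Real.pi)).mul hE
    have hEm : MemLp E 2 momentumMeasure := memLp_of_continuousOn hE.continuousOn
    have hw : MemLp (fun k => -Complex.I * (τ' k * E k + τ k * E' k)) 2 momentumMeasure :=
      ((memLp_mul_of_continuousOn hτ.continuous_deriv_ofReal.continuousOn hEm).add
        (memLp_mul_of_continuousOn hτ.continuous_ofReal.continuousOn hE')).const_mul _
    have hu : MemLp (fun k => -((τ' k : ℂ) / τ k * E k + E' k)) 2 momentumMeasure :=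
      (hτE.add hE').neg
    have hv : MemLp (fun k => -E' k) 2 momentumMeasure := hE'.neg
    have hw' : MemLp (fun k => -Complex.I * E k) 2 momentumMeasure := hEm.const_mul _
    refine ⟨hu.toLp _ + hv.toLp _, ⟨_, _, ⟨hw.toLp _, ⟨_, _, hF, by rw [hE0, hτ.periodic], hf,
      hw.coeFn_toLp⟩, ?_⟩, ⟨hw'.toLp _, ?_, _, _, hE.const_mul (-Complex.I), by rw [hE0],
      hw'.coeFn_toLp, ?_⟩, rfl⟩, ?_⟩
    · filter_upwards [hu.coeFn_toLp, hw.coeFn_toLp, hτ.ae_ne_zero] with k h1 h2 h3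
      have h3' : (τ k : ℂ) ≠ 0 := by exact_mod_cast h3
      rw [h1, h2]
      field_simp
      linear_combination (-(τ' k * E k + τ k * E' k)) * hI
    · filter_upwards [hw'.coeFn_toLp, hf, hτ.ae_ne_zero] with k h1 h2 h3
      have h3' : (τ k : ℂ) ≠ 0 := by exact_mod_cast h3
      rw [h1, h2]
      field_simp
    · filter_upwards [hv.coeFn_toLp] with k h1
      rw [h1]
      linear_combination (-E' k) * hI
    · refine Lp.ext ?_
      filter_upwards [hh, hu.coeFn_toLp, hv.coeFn_toLp, Lp.coeFn_add (hu.toLp _) (hv.toLp _),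
        Lp.coeFn_smul (Complex.I / 2) (hu.toLp _ + hv.toLp _)] with k h0 h1 h2 h3 h4
      rw [h4, Pi.smul_apply, h3, Pi.add_apply, h1, h2, smul_eq_mul, h0]
      ring

lemma speedOp_neg (hτ : IsSpeed τ τ') : speedOp (fun k => -τ k) = -speedOp τ := by
  refine graph_ext fun f h => ?_
  rw [mem_graph_neg, hτ.neg.mem_graph_speedOp, hτ.mem_graph_speedOp]
  constructor
  · rintro ⟨E, E', hE, hE0, hE', hτE, hf, hh⟩
    refine ⟨_, _, hE.const_mul (-1), by rw [hE0], hE'.const_mul _, ?_, ?_, ?_⟩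
    · refine (hτE.const_mul (-1)).ae_eq (Filter.Eventually.of_forall fun k => ?_)
      simp only [Complex.ofReal_neg, neg_div_neg_eq]
      ring
    · filter_upwards [hf] with k hk
      rw [hk]
      push_cast
      ring
    · filter_upwards [hh, Lp.coeFn_neg h] with k hk hk'
      rw [hk', Pi.neg_apply, hk]
      push_cast
      rw [mul_neg, neg_div_neg_eq]
      ring
  · rintro ⟨E, E', hE, hE0, hE', hτE, hf, hh⟩
    refine ⟨_, _, hE.const_mul (-1), by rw [hE0], hE'.const_mul _, ?_, ?_, ?_⟩
    · refine (hτE.const_mul (-1)).ae_eq (Filter.Eventually.of_forall fun k => ?_)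
      simp only [Complex.ofReal_neg, neg_div_neg_eq]
      ring
    · filter_upwards [hf] with k hk
      rw [hk]
      push_cast
      ring
    · filter_upwards [hh, Lp.coeFn_neg h] with k hk hk'
      rw [hk', Pi.neg_apply, neg_eq_iff_eq_neg] at hk
      rw [hk]
      push_cast
      rw [mul_neg, neg_div_neg_eq]
      ring

/-- The domain contains `τ² η` for `η ∈ D(P)`: the factor cancels the singularity of `1 / τ`. -/
lemma mulCont_sq_mem_graph (hτ : IsSpeed τ τ') {η ω : K₁} (h : (η, ω) ∈ momentumOp.graph) :
    (mulCont (fun k => ((τ k ^ 2 : ℝ) : ℂ))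
        (Complex.continuous_ofReal.comp (hτ.continuous.pow 2)) η,
      mulCont _ hτ.continuous_ofReal ω +
        (-Complex.I * (3 / 2)) • mulCont _ hτ.continuous_deriv_ofReal η) ∈ (speedOp τ).graph := by
  obtain ⟨N, N', hN, hN0, hη, hω⟩ := mem_momentumOp_graph.1 h
  have hN' : MemLp N' 2 momentumMeasure := by
    refine ((Lp.memLp ω).const_mul Complex.I).ae_eq ?_
    filter_upwards [hω] with k hk
    rw [hk]
    linear_combination (-N' k) * Complex.I_mul_I
  have hNm : MemLp N 2 momentumMeasure := memLp_of_continuousOn hN.continuousOn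
  have h1 := memLp_mul_of_continuousOn hτ.continuous_deriv_ofReal.continuousOn hNm
  refine hτ.mem_graph_speedOp.2 ⟨_, _, (hτ.hasACDeriv _ _).mul hN, by rw [hN0, hτ.periodic],
    h1.add (memLp_mul_of_continuousOn hτ.continuous_ofReal.continuousOn hN'), ?_, ?_, ?_⟩
  · refine h1.ae_eq ?_
    filter_upwards [hτ.ae_ne_zero] with k hk
    have hk' : (τ k : ℂ) ≠ 0 := by exact_mod_cast hk
    field_simp
  · filter_upwards [mulCont_ae (fun k => ((τ k ^ 2 : ℝ) : ℂ))
        (Complex.continuous_ofReal.comp (hτ.continuous.pow 2)) η, hη] with k h1 h2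
    rw [h1, h2]
    push_cast
    ring
  · filter_upwards [mulCont_ae _ hτ.continuous_ofReal ω,
      mulCont_ae _ hτ.continuous_deriv_ofReal η, hη, hω, hτ.ae_ne_zero,
      Lp.coeFn_add (mulCont _ hτ.continuous_ofReal ω)
        ((-Complex.I * (3 / 2)) • mulCont _ hτ.continuous_deriv_ofReal η),
      Lp.coeFn_smul (-Complex.I * (3 / 2)) (mulCont _ hτ.continuous_deriv_ofReal η)]
      with k h1 h2 h3 h4 h5 h6 h7
    have h5' : (τ k : ℂ) ≠ 0 := by exact_mod_cast h5
    rw [h6, Pi.add_apply, h7, Pi.smul_apply, h1, h2, h3, h4, smul_eq_mul]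
    field_simp
    ring

lemma dense_speedOp (hτ : IsSpeed τ τ') : Dense ((speedOp τ).domain : Set K₁) := by
  refine dense_of_orthogonal_eq_zero fun f hf => ?_
  have hc : Continuous fun k => ((τ k ^ 2 : ℝ) : ℂ) :=
    Complex.continuous_ofReal.comp (hτ.continuous.pow 2)
  have h0 : mulCont _ hc f = 0 := by
    refine eq_zero_of_inner_fourierMode fun n => ?_
    rw [← inner_mulCont_left]
    exact hf _ (LinearPMap.mem_domain_of_mem_graph
      (hτ.mulCont_sq_mem_graph (fourierMode_mem_momentumOp_graph n)))
  refine Lp.ext ?_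
  have h1 := mulCont_ae _ hc f
  rw [h0] at h1
  filter_upwards [h1, hτ.ae_ne_zero, Lp.coeFn_zero ℂ 2 momentumMeasure] with k h1 h2 h3
  rw [h3] at h1 ⊢
  refine (mul_eq_zero.1 h1.symm).resolve_left ?_
  exact_mod_cast pow_ne_zero 2 h2

lemma isSymmetricOp_speedOp (hτ : IsSpeed τ τ') : IsSymmetricOp (speedOp τ) := by
  rw [isSymmetricOp_iff hτ.dense_speedOp]
  intro u v x y huv hxy
  obtain ⟨E, E', hE, hE0, -, -, hu, hv⟩ := hτ.mem_graph_speedOp.1 huv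
  obtain ⟨G, G', hG, hG0, -, -, hx, hy⟩ := hτ.mem_graph_speedOp.1 hxy
  refine inner_eq_inner_of_hasACDeriv
    (((hE.conj.mul hG).mul (hτ.hasACDeriv _ _)).const_mul Complex.I) ?_ ?_
  · simp only [hE0, hG0, hτ.periodic]
  · filter_upwards [hu, hv, hx, hy, hτ.ae_ne_zero] with k h1 h2 h3 h4 h5
    have h5' : (τ k : ℂ) ≠ 0 := by exact_mod_cast h5
    rw [h1, h2, h3, h4]
    simp only [map_mul, map_neg, map_add, map_div₀, Complex.conj_I, Complex.conj_ofReal, map_ofNat]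
    field_simp
    ring

/-- An element `f` of the domain of the adjoint is such that `τ f` is absolutely continuous and
periodic. This is the self-adjointness of `P`, applied through the test functions `τ² η`. -/
lemma exists_of_mem_adjoint_graph (hτ : IsSpeed τ τ') {f h : K₁}
    (hfh : (f, h) ∈ (speedOp τ).adjoint.graph) :
    ∃ F F' : ℝ → ℂ, HasACDeriv F F' 0 (2 * Real.pi) ∧ F 0 = F (2 * Real.pi) ∧
      (∀ᵐ k ∂momentumMeasure, τ k * f k = F k) ∧
      ∀ᵐ k ∂momentumMeasure, F' k = Complex.I * τ k ^ 2 * h k + 3 / 2 * τ' k * f k := by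
  have hc : Continuous fun k => ((τ k ^ 2 : ℝ) : ℂ) :=
    Complex.continuous_ofReal.comp (hτ.continuous.pow 2)
  have hmem : (mulCont _ hτ.continuous_ofReal f, mulCont _ hc h +
      (-Complex.I * (3 / 2)) • mulCont _ hτ.continuous_deriv_ofReal f) ∈ momentumOp.graph := by
    rw [← LinearPMap.isSelfAdjoint_def.1 isSelfAdjoint_momentumOp,
      mem_graph_adjoint dense_momentumOp]
    intro η ω hηω
    have := (mem_graph_adjoint hτ.dense_speedOp).1 hfh _ _ (hτ.mulCont_sq_mem_graph hηω)
    rw [inner_add_left, inner_smul_left, inner_mulCont_left, inner_mulCont_left,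
      inner_mulCont_left] at this
    rw [inner_add_right, inner_smul_right, ← this]
    simp only [map_mul, map_neg, Complex.conj_I, map_div₀, map_ofNat]
    ring
  obtain ⟨F, F', hF, hF0, h1, h2⟩ := mem_momentumOp_graph.1 hmem
  refine ⟨F, F', hF, hF0, ?_, ?_⟩
  · filter_upwards [h1, mulCont_ae _ hτ.continuous_ofReal f] with k h3 h4
    rw [← h3, h4]
  · filter_upwards [h2, mulCont_ae _ hc h, mulCont_ae _ hτ.continuous_deriv_ofReal f,
      Lp.coeFn_add (mulCont _ hc h) ((-Complex.I * (3 / 2)) •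
        mulCont _ hτ.continuous_deriv_ofReal f),
      Lp.coeFn_smul (-Complex.I * (3 / 2)) (mulCont _ hτ.continuous_deriv_ofReal f)]
      with k h3 h4 h5 h6 h7
    rw [h6, Pi.add_apply, h7, Pi.smul_apply, h4, h5, smul_eq_mul] at h3
    push_cast at h3
    linear_combination (-Complex.I) * h3 + (F' k - 3 / 2 * τ' k * f k) * Complex.I_mul_I

lemma isSelfAdjoint_speedOp (hτ : IsSpeed τ τ') (h0 : ∀ k, τ k ≠ 0) :
    IsSelfAdjoint (speedOp τ) := by
  refine hτ.isSymmetricOp_speedOp.isSelfAdjoint fun f hf => ?_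
  obtain ⟨h, hfh⟩ := LinearPMap.mem_domain_iff.1 hf
  obtain ⟨F, F', hF, hF0, h1, h2⟩ := hτ.exists_of_mem_adjoint_graph hfh
  have h0' : ∀ k, (τ k : ℂ) ≠ 0 := fun k => by exact_mod_cast h0 k
  have hinv : HasACDeriv (fun k => ((τ k : ℂ))⁻¹) (fun k => -(τ' k : ℂ) / (τ k : ℂ) ^ 2) 0
      (2 * Real.pi) :=
    hasACDeriv_of_hasDerivAt (fun k _ => ((hτ.hasDerivAt k).ofReal_comp).inv (h0' k))
      (Continuous.continuousOn (hτ.continuous_deriv_ofReal.neg.div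
        (hτ.continuous_ofReal.pow 2) fun k => pow_ne_zero 2 (h0' k)))
  have hcinv : Continuous fun k => ((τ k : ℂ))⁻¹ := hτ.continuous_ofReal.inv₀ h0'
  have hcq : Continuous fun k => (τ' k : ℂ) / τ k :=
    hτ.continuous_deriv_ofReal.div hτ.continuous_ofReal h0'
  have hE := (hF.mul hinv).mul hinv
  have hEm := memLp_mul_of_continuousOn (G := fun k => (τ' k : ℂ) / τ k) hcq.continuousOn
    (memLp_of_continuousOn hE.continuousOn)
  have hE' : MemLp (fun k => Complex.I * h k + (3 / 2 : ℂ) * ((τ' k : ℂ) / τ k *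
      ((τ k : ℂ)⁻¹ * f k)) - 2 * ((τ' k : ℂ) / τ k * ((τ k : ℂ)⁻¹ * f k))) 2 momentumMeasure := by
    have := memLp_mul_of_continuousOn hcq.continuousOn
      (memLp_mul_of_continuousOn hcinv.continuousOn (Lp.memLp f))
    exact (((Lp.memLp h).const_mul _).add (this.const_mul _)).sub (this.const_mul _)
  replace hE' := hE'.ae_eq (g := fun k => (F' k * (τ k : ℂ)⁻¹ + F k * (-(τ' k : ℂ) / τ k ^ 2)) *
      (τ k : ℂ)⁻¹ + F k * (τ k : ℂ)⁻¹ * (-(τ' k : ℂ) / τ k ^ 2)) (by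
    filter_upwards [h1, h2] with k h3 h4
    have := h0' k
    rw [h4, ← h3]
    field_simp
    ring)
  have hh : MemLp _ 2 momentumMeasure :=
    (hE'.add (hEm.const_mul (1 / 2 : ℂ))).const_mul (-Complex.I)
  refine LinearPMap.mem_domain_of_mem_graph (y := hh.toLp _) (hτ.mem_graph_speedOp.2
    ⟨_, _, hE, by simp only [hF0, hτ.periodic], hE', hEm, ?_, ?_⟩)
  · filter_upwards [h1] with k h3
    have := h0' k
    rw [← h3]
    field_simp
  · filter_upwards [hh.coeFn_toLp] with k h3
    have := h0' k
    rw [h3]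
    simp only [Pi.add_apply]
    field_simp

/-- Multiplication by a function `λ` with `λ' = i ε τ λ` shifts the operator by `ε`. -/
lemma mul_mem_graph_speedOp (hτ : IsSpeed τ τ') {ev : ℝ → ℂ} {ε : ℂ}
    (hev : ∀ k, HasDerivAt ev (Complex.I * ε * τ k * ev k) k)
    (hper : ev 0 = ev (2 * Real.pi)) {f h g l : K₁} (hfh : (f, h) ∈ (speedOp τ).graph)
    (hg : g =ᵐ[momentumMeasure] fun k => ev k * f k)
    (hl : l =ᵐ[momentumMeasure] fun k => ev k * (h k + ε * f k)) :
    (g, l) ∈ (speedOp τ).graph := by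
  obtain ⟨E, E', hE, hE0, hE', hτE, hf, hh⟩ := hτ.mem_graph_speedOp.1 hfh
  have hc : Continuous ev := continuous_iff_continuousAt.2 fun k => (hev k).continuousAt
  have hev' : HasACDeriv ev (fun k => Complex.I * ε * τ k * ev k) 0 (2 * Real.pi) :=
    hasACDeriv_of_hasDerivAt (fun k _ => hev k)
      ((continuous_const.mul hτ.continuous_ofReal).mul hc).continuousOn
  refine hτ.mem_graph_speedOp.2 ⟨_, _, hev'.mul hE, by rw [hper, hE0], ?_, ?_, ?_, ?_⟩
  · exact (memLp_mul_of_continuousOn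
      ((continuous_const.mul hτ.continuous_ofReal).mul hc).continuousOn
      (memLp_of_continuousOn hE.continuousOn)).add
      (memLp_mul_of_continuousOn hc.continuousOn hE')
  · refine (memLp_mul_of_continuousOn hc.continuousOn hτE).ae_eq
      (Filter.Eventually.of_forall fun k => ?_)
    ring
  · filter_upwards [hg, hf] with k h1 h2
    rw [h1, h2]
    ring
  · filter_upwards [hl, hf, hh] with k h1 h2 h3
    rw [h1, h2, h3]
    linear_combination (ev k * ε * τ k * E k) * Complex.I_mul_I

end IsSpeed

/-! ### Deficiency spaces in the presence of zeros of the speed -/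

/-- The solution `√|τ| e^{i z θ}` of `-i (f' - (τ' / 2τ) f) = z τ f`, where `θ' = τ`. -/
def phaseSolution (τ θ : ℝ → ℝ) (z : ℂ) (k : ℝ) : ℂ :=
  (√|τ k| : ℝ) * Complex.exp (Complex.I * z * θ k)

/-- The points `0 = p 0 < p 1 < ⋯ < p (m + 1) = 2π`, where `p 1, …, p m` are the zeros of `τ`
in `[0, 2π]`. -/
structure IsNodes (τ : ℝ → ℝ) (m : ℕ) (p : ℕ → ℝ) : Prop where
  first : p 0 = 0
  last : p (m + 1) = 2 * Real.pi
  lt : ∀ i ≤ m, p i < p (i + 1)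
  node : ∀ i, 1 ≤ i → i ≤ m → τ (p i) = 0
  ne_zero : ∀ i ≤ m, ∀ k ∈ Ioo (p i) (p (i + 1)), τ k ≠ 0
  ne_zero_first : τ 0 ≠ 0

namespace IsNodes

variable {τ : ℝ → ℝ} {m : ℕ} {p : ℕ → ℝ}

lemma mono (hp : IsNodes τ m p) {i j : ℕ} (hij : i ≤ j) (hj : j ≤ m + 1) : p i ≤ p j := by
  induction j, hij using Nat.le_induction with
  | base => exact le_rfl
  | succ n _ ih => exact (ih (by omega)).trans (hp.lt n (by omega)).le

lemma Icc_subset (hp : IsNodes τ m p) {i : ℕ} (hi : i ≤ m) :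
    Icc (p i) (p (i + 1)) ⊆ uIcc 0 (2 * Real.pi) := by
  rw [uIcc_of_le Real.two_pi_pos.le, ← hp.first, ← hp.last]
  exact Icc_subset_Icc (hp.mono (Nat.zero_le i) (by omega)) (hp.mono (by omega) le_rfl)

lemma eq_of_mem (hp : IsNodes τ m p) {i j : ℕ} (hi : i ≤ m) (hj : j ≤ m) {k : ℝ}
    (hki : k ∈ Ioo (p i) (p (i + 1))) (hkj : k ∈ Ioo (p j) (p (j + 1))) : i = j := by
  rcases lt_trichotomy i j with h | h | h
  · have := hp.mono (Nat.succ_le_of_lt h) (by omega)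
    exact absurd (hki.2.trans_le this) hkj.1.not_gt
  · exact h
  · have := hp.mono (Nat.succ_le_of_lt h) (by omega)
    exact absurd (hkj.2.trans_le this) hki.1.not_gt

lemma ae_exists_mem (hp : IsNodes τ m p) :
    ∀ᵐ k ∂momentumMeasure, ∃ i : Fin (m + 1), k ∈ Ioo (p i) (p (i + 1)) := by
  have h1 : ∀ᵐ k : ℝ, ∀ i, k ≠ p i := by
    rw [ae_all_iff]
    intro i
    simp [ae_iff, measure_singleton]
  rw [ae_momentumMeasure_iff]
  filter_upwards [h1] with k hk hk'
  rw [uIcc_of_le Real.two_pi_pos.le, ← hp.first, ← hp.last] at hk'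
  have key : ∀ n ≤ m + 1, k ≤ p n → ∃ i < n, k ∈ Ioo (p i) (p (i + 1)) := by
    intro n
    induction n with
    | zero => exact fun _ h => absurd (le_antisymm h hk'.1) (hk 0)
    | succ n ih =>
      intro hn h
      rcases le_or_gt k (p n) with h' | h'
      · obtain ⟨i, hi, hi'⟩ := ih (by omega) h'
        exact ⟨i, by omega, hi'⟩
      · exact ⟨n, by omega, h', lt_of_le_of_ne h (hk _)⟩
  obtain ⟨i, hi, hi'⟩ := key (m + 1) le_rfl hk'.2
  exact ⟨⟨i, hi⟩, hi'⟩

lemma ae_ne_zero (hp : IsNodes τ m p) : ∀ᵐ k ∂momentumMeasure, τ k ≠ 0 := by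
  filter_upwards [hp.ae_exists_mem] with k ⟨i, hi⟩
  exact hp.ne_zero i (by omega) k hi

lemma integral_eq_sum (hp : IsNodes τ m p) {G : ℝ → ℂ}
    (hG : IntervalIntegrable G volume 0 (2 * Real.pi)) :
    ∫ k in (0)..(2 * Real.pi), G k = ∑ i : Fin (m + 1), ∫ k in (p i)..(p (i + 1)), G k := by
  rw [← hp.first, ← hp.last, ← intervalIntegral.sum_integral_adjacent_intervals,
    Finset.sum_range]
  intro i hi
  refine hG.mono_set ?_
  rw [uIcc_of_le (hp.lt i (by omega)).le]
  exact hp.Icc_subset (by omega)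

/-- The step function with value `c i` on the `i`-th interval between nodes. -/
def step (p : ℕ → ℝ) (m : ℕ) (c : Fin (m + 1) → ℂ) (k : ℝ) : ℂ :=
  ∑ i : Fin (m + 1), (Ioo (p i) (p (i + 1))).indicator (fun _ => c i) k

lemma step_apply (hp : IsNodes τ m p) (c : Fin (m + 1) → ℂ) {i : Fin (m + 1)} {k : ℝ}
    (hk : k ∈ Ioo (p i) (p (i + 1))) : step p m c k = c i := by
  rw [step, Finset.sum_eq_single i]
  · exact indicator_of_mem hk _
  · intro j _ hj
    refine indicator_of_notMem (fun h => hj ?_) _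
    exact Fin.ext (hp.eq_of_mem (by omega) (by omega) h hk)
  · simp

lemma memLp_step (p : ℕ → ℝ) (m : ℕ) (c : Fin (m + 1) → ℂ) :
    MemLp (step p m c) 2 momentumMeasure := by
  have := memLp_finsetSum (p := 2) (μ := momentumMeasure) Finset.univ
    (f := fun (i : Fin (m + 1)) k => (Ioo (p i) (p (i + 1))).indicator (fun _ => c i) k)
    fun i _ => memLp_indicator_const 2 measurableSet_Ioo _ (Or.inr (measure_ne_top _ _))
  exact this

end IsNodes

/-- The linear map from `c` to the function equal to `c i φ` on the `i`-th interval between nodes.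
It is used for `φ = phaseSolution τ θ z`. -/
def piecewiseSolution (p : ℕ → ℝ) (m : ℕ) (φ : ℝ → ℂ) (hφ : Continuous φ) :
    (Fin (m + 1) → ℂ) →ₗ[ℂ] K₁ where
  toFun c := (memLp_mul_of_continuousOn hφ.continuousOn (IsNodes.memLp_step p m c)).toLp _
  map_add' c d := by
    rw [← MemLp.toLp_add, MemLp.toLp_eq_toLp_iff]
    refine Filter.Eventually.of_forall fun k => ?_
    simp only [IsNodes.step, Pi.add_apply, ← mul_add, ← Finset.sum_add_distrib]
    congr 2
    funext i
    exact congrFun (indicator_add _ _ _) k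
  map_smul' c d := by
    rw [RingHom.id_apply, ← MemLp.toLp_const_smul, MemLp.toLp_eq_toLp_iff]
    refine Filter.Eventually.of_forall fun k => ?_
    simp only [IsNodes.step, Pi.smul_apply, smul_eq_mul, Finset.mul_sum]
    refine Finset.sum_congr rfl fun i _ => ?_
    by_cases hk : k ∈ Ioo (p i) (p (i + 1))
    · simp only [indicator_of_mem hk]
      ring
    · simp only [indicator_of_notMem hk, mul_zero]

lemma IsNodes.piecewiseSolution_ae {τ : ℝ → ℝ} {m : ℕ} {p : ℕ → ℝ} (hp : IsNodes τ m p)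
    {φ : ℝ → ℂ} (hφ : Continuous φ) (c : Fin (m + 1) → ℂ) :
    ∀ᵐ k ∂momentumMeasure, ∀ i : Fin (m + 1), k ∈ Ioo (p i) (p (i + 1)) →
      piecewiseSolution p m φ hφ c k = c i * φ k := by
  filter_upwards [(memLp_mul_of_continuousOn hφ.continuousOn
    (IsNodes.memLp_step p m c)).coeFn_toLp] with k h1 i hi
  refine h1.trans ?_
  rw [hp.step_apply c hi, mul_comm]

namespace IsSpeed

variable {τ τ' θ : ℝ → ℝ} {m : ℕ} {p : ℕ → ℝ}

lemma hasDerivAt_phaseSolution (hτ : IsSpeed τ τ') (hθ : ∀ k, HasDerivAt θ (τ k) k) (z : ℂ)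
    {k : ℝ} (hk : τ k ≠ 0) :
    HasDerivAt (phaseSolution τ θ z)
      ((τ' k / (2 * τ k) + Complex.I * z * τ k) * phaseSolution τ θ z k) k := by
  have h1 : HasDerivAt (fun k => √|τ k|) (τ' k / (2 * τ k) * √|τ k|) k := by
    have h2 := ((hasDerivAt_abs hk).comp k (hτ.hasDerivAt k)).sqrt (abs_ne_zero.2 hk)
    convert! h2 using 1
    have h3 : √|τ k| ≠ 0 := Real.sqrt_ne_zero'.2 (abs_pos.2 hk)
    have h4 := Real.sq_sqrt (abs_nonneg (τ k))
    have h5 := sign_mul_self (τ k)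
    simp only [Function.comp_apply]
    field_simp
    rw [h4, ← h5]
    ring
  have h2 : HasDerivAt (fun k : ℝ => Complex.exp (Complex.I * z * θ k))
      (Complex.exp (Complex.I * z * θ k) * (Complex.I * z * τ k)) k :=
    ((hθ k).ofReal_comp.const_mul _).cexp
  convert! h1.ofReal_comp.mul h2 using 1
  simp only [phaseSolution]
  push_cast
  ring

lemma continuous_phaseSolution (hτ : IsSpeed τ τ') (hθ : ∀ k, HasDerivAt θ (τ k) k) (z : ℂ) :
    Continuous (phaseSolution τ θ z) := by
  have h1 : Continuous θ := continuous_iff_continuousAt.2 fun k => (hθ k).continuousAt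
  have h2 := hτ.continuous
  unfold phaseSolution
  fun_prop

lemma phaseSolution_ne_zero {z : ℂ} {k : ℝ} (hk : τ k ≠ 0) : phaseSolution τ θ z k ≠ 0 := by
  refine mul_ne_zero ?_ (Complex.exp_ne_zero _)
  exact_mod_cast Real.sqrt_ne_zero'.2 (abs_pos.2 hk)

/-- The piecewise solutions whose pieces on `[0, p 1]` and `[p m, 2π]` match periodically are
eigenvectors of the adjoint: the boundary terms at the zeros of `τ` vanish. -/
lemma piecewiseSolution_mem_eigenSpace (hτ : IsSpeed τ τ') (hθ : ∀ k, HasDerivAt θ (τ k) k)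
    (hp : IsNodes τ m p) (z : ℂ) {c : Fin (m + 1) → ℂ}
    (hc : c 0 * phaseSolution τ θ z 0 = c (Fin.last m) * phaseSolution τ θ z (2 * Real.pi)) :
    piecewiseSolution p m _ (hτ.continuous_phaseSolution hθ z) c ∈
      eigenSpace (speedOp τ).adjoint z := by
  rw [mem_eigenSpace, mem_graph_adjoint hτ.dense_speedOp]
  intro u v huv
  obtain ⟨E, E', hE, hE0, -, -, hu, hv⟩ := hτ.mem_graph_speedOp.1 huv
  set φ := phaseSolution τ θ z with hφdef
  have hφ := hτ.continuous_phaseSolution hθ z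
  set f := piecewiseSolution p m φ hφ c with hf
  set D : ℝ → ℂ := fun k => (starRingEnd ℂ) (v k) * f k - (starRingEnd ℂ) (u k) * (z • f : K₁) k
    with hD
  have hDi : Integrable D momentumMeasure := (integrable_conj_mul v f).sub (integrable_conj_mul u _)
  have hDi' := intervalIntegrable_of_integrable hDi
  have hDae : ∀ᵐ k, k ∈ uIcc 0 (2 * Real.pi) → ∀ i : Fin (m + 1), k ∈ Ioo (p i) (p (i + 1)) →
      c i * Complex.I * ((starRingEnd ℂ) (E' k) * φ k + (starRingEnd ℂ) (E k) *
        ((τ' k / (2 * τ k) + Complex.I * z * τ k) * φ k)) = D k := by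
    rw [← ae_momentumMeasure_iff]
    filter_upwards [hu, hv, hp.piecewiseSolution_ae hφ c, Lp.coeFn_smul z f, hτ.ae_ne_zero]
      with k h1 h2 h3 h4 h5 i hi
    have h5' : (τ k : ℂ) ≠ 0 := by exact_mod_cast h5
    rw [hD]
    simp only
    rw [h1, h2, h4, Pi.smul_apply, h3 i hi, smul_eq_mul]
    simp only [map_mul, map_neg, map_add, map_div₀, Complex.conj_I, Complex.conj_ofReal, map_ofNat]
    linear_combination (c i * z * τ k * φ k * (starRingEnd ℂ) (E k)) * Complex.I_mul_I
  set H : ℝ → ℂ := fun k => (starRingEnd ℂ) (E k) * φ k with hH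
  have hHc : ContinuousOn H (uIcc 0 (2 * Real.pi)) :=
    (Complex.continuous_conj.comp_continuousOn hE.continuousOn).mul hφ.continuousOn
  have hint : ∀ i : Fin (m + 1), ∫ k in (p i)..(p (i + 1)), D k =
      c i * Complex.I * H (p (i + 1)) - c i * Complex.I * H (p i) := by
    intro i
    have him : (i : ℕ) ≤ m := by omega
    have hsub := hp.Icc_subset him
    refine integral_eq_sub_of_hasACDeriv_interior (F := fun k => c i * Complex.I * H k)
      (hp.lt i him) (continuousOn_const.mul (hHc.mono hsub)) ?_ ?_
    · intro x y hx hxy hy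
      have hIcc : uIcc x y ⊆ Ioo (p i) (p (i + 1)) := by
        rw [uIcc_of_le hxy]
        exact fun t ht => ⟨hx.trans_le ht.1, ht.2.trans_lt hy⟩
      have hne : ∀ t ∈ uIcc x y, (τ t : ℂ) ≠ 0 := fun t ht => by
        exact_mod_cast hp.ne_zero i him t (hIcc ht)
      have hφ' : HasACDeriv φ (fun k => (τ' k / (2 * τ k) + Complex.I * z * τ k) * φ k) x y := by
        refine hasACDeriv_of_hasDerivAt (fun t ht => hτ.hasDerivAt_phaseSolution hθ z
          (hp.ne_zero i him t (hIcc ht))) ?_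
        refine ContinuousOn.mul (ContinuousOn.add (ContinuousOn.div
          hτ.continuous_deriv_ofReal.continuousOn
          (continuous_const.mul hτ.continuous_ofReal).continuousOn fun t ht => ?_)
          (continuous_const.mul hτ.continuous_ofReal).continuousOn) hφ.continuousOn
        exact mul_ne_zero two_ne_zero (hne t ht)
      have hsub2 : uIcc x y ⊆ uIcc 0 (2 * Real.pi) := hIcc.trans (Ioo_subset_Icc_self.trans hsub)
      refine (((hE.mono hsub2).conj.mul hφ').const_mul (c i * Complex.I)).congr_deriv ?_
      filter_upwards [hDae] with k hk hkx
      exact hk (hsub2 hkx) i (hIcc hkx)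
    · refine hDi'.mono_set ?_
      rwa [uIcc_of_le (hp.lt i him).le]
  have hsum : ∫ k, D k ∂momentumMeasure = 0 := by
    rw [integral_momentumMeasure, hp.integral_eq_sum hDi', Finset.sum_congr rfl fun i _ => hint i,
      Finset.sum_sub_distrib, Fintype.sum_eq_single (Fin.last m), Fintype.sum_eq_single 0]
    · simp only [hH, Fin.val_last, hp.last, Fin.val_zero, hp.first, ← hE0]
      linear_combination (-((2 * Real.pi)⁻¹ : ℝ) * Complex.I * (starRingEnd ℂ) (E 0)) * hc
    · intro i hi
      have : φ (p i) = 0 := by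
        rw [hφdef, phaseSolution, hp.node i (by have := Fin.val_ne_zero_iff.2 hi; omega) (by omega)]
        simp
      simp [hH, this]
    · intro i hi
      have : φ (p (i + 1)) = 0 := by
        have hi' : (i : ℕ) ≠ m := fun h => hi (Fin.ext (by simpa using h))
        rw [hφdef, phaseSolution, hp.node (i + 1) (by omega) (by omega)]
        simp
      simp [hH, this]
  rw [hD, integral_sub (integrable_conj_mul v f) (integrable_conj_mul u _), ← inner_K₁,
    ← inner_K₁, sub_eq_zero] at hsum
  exact hsum

/-- Every eigenvector of the adjoint is a piecewise solution. -/
lemma exists_of_mem_eigenSpace (hτ : IsSpeed τ τ') (hθ : ∀ k, HasDerivAt θ (τ k) k)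
    (hp : IsNodes τ m p) {z : ℂ} {f : K₁} (hf : f ∈ eigenSpace (speedOp τ).adjoint z) :
    ∃ c : Fin (m + 1) → ℂ,
      c 0 * phaseSolution τ θ z 0 = c (Fin.last m) * phaseSolution τ θ z (2 * Real.pi) ∧
      piecewiseSolution p m _ (hτ.continuous_phaseSolution hθ z) c = f := by
  obtain ⟨F, F', hF, hF0, h1, h2⟩ := hτ.exists_of_mem_adjoint_graph (mem_eigenSpace.1 hf)
  set φ := phaseSolution τ θ z with hφdef
  have hφ : Continuous φ := hτ.continuous_phaseSolution hθ z
  have hF' : ∀ᵐ k ∂momentumMeasure, τ k * F' k =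
      (Complex.I * z * τ k ^ 2 + 3 / 2 * τ' k) * F k := by
    filter_upwards [h1, h2, Lp.coeFn_smul z f] with k h3 h4 h5
    rw [h4, ← h3, h5, Pi.smul_apply, smul_eq_mul]
    ring
  rw [ae_momentumMeasure_iff] at hF'
  choose q hq using fun i : Fin (m + 1) => exists_between (hp.lt i (by omega))
  set c : Fin (m + 1) → ℂ := fun i => F (q i) * (τ (q i) * φ (q i))⁻¹ with hcdef
  -- on each interval between nodes the quotient of `F` by `τ φ` is constant
  have hEq : ∀ i : Fin (m + 1), EqOn F (fun k => c i * (τ k * φ k)) (Ioo (p i) (p (i + 1))) := by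
    intro i
    have him : (i : ℕ) ≤ m := by omega
    have hconst : ∀ x y, p i < x → x ≤ y → y < p (i + 1) →
        F x * (τ x * φ x)⁻¹ = F y * (τ y * φ y)⁻¹ := by
      intro x y hx hxy hy
      have hIcc : uIcc x y ⊆ Ioo (p i) (p (i + 1)) := by
        rw [uIcc_of_le hxy]
        exact fun t ht => ⟨hx.trans_le ht.1, ht.2.trans_lt hy⟩
      have hsub2 : uIcc x y ⊆ uIcc 0 (2 * Real.pi) :=
        hIcc.trans (Ioo_subset_Icc_self.trans (hp.Icc_subset him))
      have hne : ∀ t ∈ uIcc x y, (τ t : ℂ) ≠ 0 := fun t ht => by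
        exact_mod_cast hp.ne_zero i him t (hIcc ht)
      have hne2 : ∀ t ∈ uIcc x y, φ t ≠ 0 := fun t ht =>
        phaseSolution_ne_zero (hp.ne_zero i him t (hIcc ht))
      have hinv : HasACDeriv (fun t => (τ t * φ t)⁻¹)
          (fun t => -((Complex.I * z * τ t ^ 2 + 3 / 2 * τ' t) * φ t) / (τ t * φ t) ^ 2) x y := by
        refine hasACDeriv_of_hasDerivAt (fun t ht => ?_) ?_
        · have h3 := (hτ.hasDerivAt t).ofReal_comp.mul
            (hτ.hasDerivAt_phaseSolution hθ z (hp.ne_zero i him t (hIcc ht)))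
          convert! h3.inv (mul_ne_zero (hne t ht) (hne2 t ht)) using 1
          have := hne t ht
          simp only [Pi.mul_apply]
          congr 2
          field_simp
          ring
        · refine ContinuousOn.div ?_ ?_ fun t ht => pow_ne_zero 2
            (mul_ne_zero (hne t ht) (hne2 t ht))
          · exact (((continuous_const.mul (hτ.continuous_ofReal.pow 2)).add
              (continuous_const.mul hτ.continuous_deriv_ofReal)).mul hφ).neg.continuousOn
          · exact ((hτ.continuous_ofReal.mul hφ).pow 2).continuousOn
      refine ((hF.mono hsub2).mul hinv).eq_of_deriv_eq_zero ?_ left_mem_uIcc right_mem_uIcc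
      filter_upwards [hF'] with t ht htx
      have h3 := hne t htx
      have h4 := hne2 t htx
      field_simp
      linear_combination 2 * ht (hsub2 htx)
    intro k hk
    have h3 : (τ k : ℂ) * φ k ≠ 0 := mul_ne_zero (by exact_mod_cast hp.ne_zero i him k hk)
      (phaseSolution_ne_zero (hp.ne_zero i him k hk))
    have h4 : F k * (τ k * φ k)⁻¹ = c i := by
      rcases le_total k (q i) with h | h
      · exact hconst k (q i) hk.1 h (hq i).2
      · exact (hconst (q i) k (hq i).1 h hk.2).symm
    change F k = c i * _
    rw [← h4, mul_assoc, inv_mul_cancel₀ h3, mul_one]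
  have hEqc : ∀ i : Fin (m + 1), EqOn F (fun k => c i * (τ k * φ k)) (Icc (p i) (p (i + 1))) := by
    intro i
    refine (hEq i).of_subset_closure (hF.continuousOn.mono (hp.Icc_subset (by omega)))
      (continuous_const.mul (hτ.continuous_ofReal.mul hφ)).continuousOn Ioo_subset_Icc_self ?_
    rw [closure_Ioo (hp.lt i (by omega)).ne]
  refine ⟨c, ?_, ?_⟩
  · have e1 := hEqc 0 (left_mem_Icc.2 (hp.lt _ (by simp)).le)
    have e2 := hEqc (Fin.last m) (right_mem_Icc.2 (hp.lt _ (by simp)).le)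
    simp only [Fin.val_zero, hp.first, Fin.val_last, hp.last] at e1 e2
    rw [hF0, e2, ← hτ.periodic] at e1
    have h3 : (τ 0 : ℂ) ≠ 0 := by exact_mod_cast hp.ne_zero_first
    refine mul_left_cancel₀ h3 ?_
    linear_combination -e1
  · refine Lp.ext ?_
    filter_upwards [hp.piecewiseSolution_ae hφ c, hp.ae_exists_mem, h1] with k h3 ⟨i, hi⟩ h4
    have h5 : (τ k : ℂ) ≠ 0 := by exact_mod_cast hp.ne_zero i (by omega) k hi
    rw [h3 i hi]
    refine mul_left_cancel₀ h5 ?_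
    rw [h4, hEq i hi]
    ring

lemma piecewiseSolution_injective (hp : IsNodes τ m p) {φ : ℝ → ℂ} (hφ : Continuous φ)
    (hne : ∀ k, τ k ≠ 0 → φ k ≠ 0) : Function.Injective (piecewiseSolution p m φ hφ) := by
  rw [← LinearMap.ker_eq_bot, LinearMap.ker_eq_bot']
  intro c hc
  funext i
  have h1 := hp.piecewiseSolution_ae hφ c
  rw [hc] at h1
  have h2 : ∀ᵐ k, k ∈ uIcc 0 (2 * Real.pi) → k ∈ Ioo (p i) (p (i + 1)) → c i * φ k = 0 := by
    rw [← ae_momentumMeasure_iff]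
    filter_upwards [h1, Lp.coeFn_zero ℂ 2 momentumMeasure] with k h3 h4 hk
    rw [← h3 i hk, h4, Pi.zero_apply]
  have him : (i : ℕ) ≤ m := by omega
  have h3 : ∃ k ∈ Ioo (p i) (p (i + 1)), c i * φ k = 0 := by
    by_contra! hcon
    have h4 : volume (Ioo (p i) (p (i + 1))) = 0 := by
      refine measure_mono_null (fun k hk => ?_) h2
      simp only [mem_compl_iff, mem_ofPred_eq, not_forall]
      exact ⟨hp.Icc_subset him (Ioo_subset_Icc_self hk), hk, hcon k hk⟩
    rw [Real.volume_Ioo, ENNReal.ofReal_eq_zero] at h4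
    linarith [hp.lt i him]
  obtain ⟨k, hk, hk'⟩ := h3
  exact (mul_eq_zero.1 hk').resolve_right (hne k (hp.ne_zero i him k hk))

/-- When `τ` has `m ≥ 1` zeros, every complex number is an eigenvalue of the adjoint, of
multiplicity `m`: one solution for each of the `m` arcs into which the zeros cut the circle. -/
lemma rank_eigenSpace_adjoint (hτ : IsSpeed τ τ') (hθ : ∀ k, HasDerivAt θ (τ k) k)
    (hp : IsNodes τ m p) (hm : m ≠ 0) (z : ℂ) :
    Module.rank ℂ (eigenSpace (speedOp τ).adjoint z) = m := by
  set φ := phaseSolution τ θ z with hφdef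
  have hφ : Continuous φ := hτ.continuous_phaseSolution hθ z
  let l : (Fin (m + 1) → ℂ) →ₗ[ℂ] ℂ :=
    φ 0 • LinearMap.proj 0 - φ (2 * Real.pi) • LinearMap.proj (Fin.last m)
  have hl : ∀ c, l c = φ 0 * c 0 - φ (2 * Real.pi) * c (Fin.last m) := fun c => rfl
  have hinj : Function.Injective (piecewiseSolution p m φ hφ) :=
    piecewiseSolution_injective hp hφ fun k hk => phaseSolution_ne_zero hk
  have hmap : eigenSpace (speedOp τ).adjoint z =
      (LinearMap.ker l).map (piecewiseSolution p m φ hφ) := by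
    ext f
    rw [Submodule.mem_map]
    constructor
    · intro hf
      obtain ⟨c, hc, rfl⟩ := hτ.exists_of_mem_eigenSpace hθ hp hf
      refine ⟨c, ?_, rfl⟩
      rw [LinearMap.mem_ker, hl]
      linear_combination hc
    · rintro ⟨c, hc, rfl⟩
      rw [LinearMap.mem_ker, hl] at hc
      exact hτ.piecewiseSolution_mem_eigenSpace hθ hp z (by linear_combination hc)
  have hsurj : LinearMap.range l = ⊤ := by
    rw [LinearMap.range_eq_top]
    refine LinearMap.surjective fun h => ?_
    have h1 : l (Pi.single 0 1) = 0 := by rw [h, LinearMap.zero_apply]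
    have h2 : Fin.last m ≠ 0 := fun h => hm (by simpa using congrArg Fin.val h)
    rw [hl, Pi.single_eq_same, Pi.single_eq_of_ne h2, mul_one, mul_zero, sub_zero] at h1
    exact phaseSolution_ne_zero hp.ne_zero_first h1
  have hfin := l.finrank_range_add_finrank_ker
  rw [hsurj, finrank_top, Module.finrank_self, Module.finrank_fin_fun] at hfin
  rw [hmap, ← (Submodule.equivMapOfInjective _ hinj (LinearMap.ker l)).rank_eq,
    ← Module.finrank_eq_rank]
  congr 1
  omega

end IsSpeed

/-! ### Operators with an orthonormal basis of eigenvectors -/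

section Diagonal

variable {E F : Type*}
  [NormedAddCommGroup E] [InnerProductSpace ℂ E]
  [NormedAddCommGroup F] [InnerProductSpace ℂ F]

lemma hilbertBasis_ext_inner (b : HilbertBasis ℤ ℂ E) {x y : E}
    (h : ∀ n, inner ℂ (b n) x = inner ℂ (b n) y) : x = y := by
  refine b.repr.injective (lp.ext (funext fun n => ?_))
  rw [b.repr_apply_apply, b.repr_apply_apply, h n]

/-- The unitary operator that maps one orthonormal basis to another. -/
def basisChange (b : HilbertBasis ℤ ℂ E) (e : HilbertBasis ℤ ℂ F) : E ≃ₗᵢ[ℂ] F :=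
  b.repr.trans e.repr.symm

lemma inner_basisChange (b : HilbertBasis ℤ ℂ E) (e : HilbertBasis ℤ ℂ F) (n : ℤ) (x : E) :
    inner ℂ (e n) (basisChange b e x) = inner ℂ (b n) x := by
  rw [← e.repr_apply_apply, ← b.repr_apply_apply, basisChange, LinearIsometryEquiv.trans_apply,
    LinearIsometryEquiv.apply_symm_apply]

lemma inner_basisChange_symm (b : HilbertBasis ℤ ℂ E) (e : HilbertBasis ℤ ℂ F) (n : ℤ) (x : F) :
    inner ℂ (b n) ((basisChange b e).symm x) = inner ℂ (e n) x := by
  rw [← inner_basisChange b e, LinearIsometryEquiv.apply_symm_apply]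

/-- A self-adjoint operator with an orthonormal basis of eigenvectors `b n`, of eigenvalues `n`, is
the maximal diagonal operator. -/
lemma mem_graph_iff_of_hilbertBasis [CompleteSpace E] {A : E →ₗ.[ℂ] E} (hA : IsSelfAdjoint A)
    (b : HilbertBasis ℤ ℂ E) (hb : ∀ n : ℤ, (b n, (n : ℂ) • b n) ∈ A.graph) {x y : E} :
    (x, y) ∈ A.graph ↔ ∀ n : ℤ, inner ℂ (b n) y = n * inner ℂ (b n) x := by
  have key : ∀ u v, (u, v) ∈ A.graph → ∀ n : ℤ, inner ℂ (b n) v = n * inner ℂ (b n) u := by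
    intro u v huv n
    have := (isSymmetricOp_iff hA.dense_domain).1 (isSymmetricOp_of_isSelfAdjoint hA) _ _ _ _
      (hb n) huv
    rw [← this, inner_smul_left, map_intCast]
  refine ⟨key x y, fun h => ?_⟩
  rw [← LinearPMap.isSelfAdjoint_def.1 hA, mem_graph_adjoint hA.dense_domain]
  intro u v huv
  rw [← b.tsum_inner_mul_inner, ← b.tsum_inner_mul_inner]
  refine tsum_congr fun n => ?_
  rw [h n, ← inner_conj_symm v, key u v huv n, map_mul, map_intCast, inner_conj_symm]
  ring

lemma conjBy_basisChange [CompleteSpace E] [CompleteSpace F] {A : E →ₗ.[ℂ] E}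
    (hA : IsSelfAdjoint A) {b : HilbertBasis ℤ ℂ E}
    (hb : ∀ n : ℤ, (b n, (n : ℂ) • b n) ∈ A.graph) {B : F →ₗ.[ℂ] F} (hB : IsSelfAdjoint B)
    {e : HilbertBasis ℤ ℂ F} (he : ∀ n : ℤ, (e n, (n : ℂ) • e n) ∈ B.graph) :
    conjBy (basisChange b e) A = B := by
  refine graph_ext fun x y => ?_
  rw [mem_graph_conjBy, mem_graph_iff_of_hilbertBasis hA b hb,
    mem_graph_iff_of_hilbertBasis hB e he]
  simp only [inner_basisChange_symm]

lemma conjBy_directSum (V : Fin 2 → (E ≃ₗᵢ[ℂ] F)) (A : Fin 2 → (E →ₗ.[ℂ] E)) :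
    conjBy (LinearIsometryEquiv.piLpCongrRight 2 V) (directSum A) =
      directSum fun i => conjBy (V i) (A i) := by
  refine graph_ext fun x y => ?_
  simp only [mem_graph_conjBy, mem_graph_directSum]
  rfl

/-- The diagonal operator with bounded entries in an orthonormal basis. -/
lemma exists_diagonal (b : HilbertBasis ℤ ℂ E) {a : ℤ → ℂ} {C : ℝ} (ha : ∀ n, ‖a n‖ ≤ C) :
    ∃ R : E →L[ℂ] E, ∀ n x, inner ℂ (b n) (R x) = a n * inner ℂ (b n) x := by
  have hC : 0 ≤ C := (norm_nonneg _).trans (ha 0)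
  have hp : 0 < (2 : ENNReal).toReal := by norm_num
  have hbound : ∀ (y : lp (fun _ : ℤ => ℂ) 2) (s : Finset ℤ),
      ∑ n ∈ s, ‖a n * y n‖ ^ (2 : ENNReal).toReal ≤ (C * ‖y‖) ^ (2 : ENNReal).toReal := by
    intro y s
    rw [Real.mul_rpow hC (norm_nonneg _)]
    refine le_trans ?_ (mul_le_mul_of_nonneg_left (lp.sum_rpow_le_norm_rpow hp y s)
      (Real.rpow_nonneg hC _))
    rw [Finset.mul_sum]
    refine Finset.sum_le_sum fun n _ => ?_
    rw [norm_mul, Real.mul_rpow (norm_nonneg _) (norm_nonneg _)]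
    exact mul_le_mul_of_nonneg_right (Real.rpow_le_rpow (norm_nonneg _) (ha n) hp.le)
      (Real.rpow_nonneg (norm_nonneg _) _)
  let D : lp (fun _ : ℤ => ℂ) 2 →L[ℂ] lp (fun _ : ℤ => ℂ) 2 := LinearMap.mkContinuous
    { toFun := fun y => ⟨fun n => a n * y n, memℓp_gen' (hbound y)⟩
      map_add' := fun y w => lp.ext (funext fun n => mul_add _ _ _)
      map_smul' := fun c y => lp.ext (funext fun n => mul_left_comm _ _ _) } C fun y =>
    lp.norm_le_of_forall_sum_le hp (mul_nonneg hC (norm_nonneg _)) (hbound y)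
  refine ⟨(b.repr.symm.toContinuousLinearEquiv : lp (fun _ : ℤ => ℂ) 2 →L[ℂ] E) ∘L D ∘L
    (b.repr.toContinuousLinearEquiv : E →L[ℂ] lp (fun _ : ℤ => ℂ) 2), fun n x => ?_⟩
  rw [← b.repr_apply_apply, ← b.repr_apply_apply]
  simp only [ContinuousLinearMap.comp_apply, ContinuousLinearEquiv.coe_coe,
    LinearIsometryEquiv.coe_toContinuousLinearEquiv, LinearIsometryEquiv.apply_symm_apply]
  rfl

lemma exists_bound_inv_intCast_sub {z : ℂ} (hz : z ∉ range fun n : ℤ => (n : ℂ)) :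
    ∃ C : ℝ, ∀ n : ℤ, ‖((n : ℂ) - z)⁻¹‖ ≤ C := by
  have hcl : IsClosed (range fun n : ℤ => (n : ℂ)) := by
    have := (Complex.isometry_ofReal.isClosedEmbedding.comp
      Real.isClosedEmbedding_intCast).isClosed_range
    convert! this using 2
  have hpos := (hcl.notMem_iff_infDist_pos ⟨_, mem_range_self 0⟩).1 hz
  refine ⟨(Metric.infDist z (range fun n : ℤ => (n : ℂ)))⁻¹, fun n => ?_⟩
  rw [norm_inv]
  refine inv_anti₀ hpos ?_
  have := Metric.infDist_le_dist_of_mem (x := z) (mem_range_self (f := fun n : ℤ => (n : ℂ)) n)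
  rwa [dist_comm, dist_eq_norm] at this

/-- The spectrum of a direct sum of two self-adjoint operators with simple eigenvalues
`n ∈ ℤ` and complete systems of eigenvectors. -/
lemma opSpectrum_directSum_of_hilbertBasis [CompleteSpace E] {A : Fin 2 → (E →ₗ.[ℂ] E)}
    (hA : ∀ i, IsSelfAdjoint (A i)) (b : Fin 2 → HilbertBasis ℤ ℂ E)
    (hb : ∀ i, ∀ n : ℤ, (b i n, (n : ℂ) • b i n) ∈ (A i).graph) :
    opSpectrum (directSum A) = range fun n : ℤ => (n : ℂ) := by
  ext z
  rw [opSpectrum, mem_compl_iff, not_iff_comm]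
  constructor
  · intro hz
    obtain ⟨C, hC⟩ := exists_bound_inv_intCast_sub hz
    choose R hR using fun i => exists_diagonal (b i) hC
    have hne : ∀ n : ℤ, (n : ℂ) - z ≠ 0 := fun n h => hz ⟨n, sub_eq_zero.1 h⟩
    have hRi : ∀ (f : Double E) i, blockOp (Matrix.diagonal R) f i = R i (f i) := by
      intro f i
      rw [blockOp_apply, Finset.sum_eq_single i]
      · rw [Matrix.diagonal_apply_eq]
      · intro j _ hj
        rw [Matrix.diagonal_apply_ne _ hj.symm, zero_apply]
      · simp
    rw [mem_resolventSet_iff]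
    refine ⟨blockOp (Matrix.diagonal R), fun y => ?_, fun x y hxy => ?_⟩
    · rw [mem_graph_directSum]
      intro i
      rw [hRi, mem_graph_iff_of_hilbertBasis (hA i) (b i) (hb i)]
      intro n
      rw [PiLp.add_apply, PiLp.smul_apply, hRi, inner_add_right, inner_smul_right, hR]
      have := hne n
      field_simp
      ring
    · rw [mem_graph_directSum] at hxy
      refine PiLp.ext fun i => hilbertBasis_ext_inner (b i) fun n => ?_
      have h := (mem_graph_iff_of_hilbertBasis (hA i) (b i) (hb i)).1 (hxy i) n
      rw [hRi, hR, PiLp.sub_apply, PiLp.smul_apply, inner_sub_right, inner_smul_right, h]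
      have := hne n
      field_simp
  · rintro hz ⟨n, rfl⟩
    obtain ⟨R, -, h2⟩ := mem_resolventSet_iff.1 hz
    have h3 := h2 (WithLp.toLp 2 fun i => b i n) ((n : ℂ) • WithLp.toLp 2 fun i => b i n) (by
      rw [mem_graph_directSum]
      exact fun i => hb i n)
    rw [sub_self, map_zero] at h3
    have h4 : b 0 n = 0 := (congrArg (fun f : Double E => f 0) h3).symm
    have h5 := (b 0).orthonormal.1 n
    rw [h4, norm_zero] at h5
    exact zero_ne_one h5

end Diagonal

/-! ### The eigenfunctions of the momentum operator and of the operator with positive speed -/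

/-- The Hilbert basis `e^{ink}` of `L²`. -/
def expBasis : HilbertBasis ℤ ℂ K₁ :=
  HilbertBasis.mkOfOrthogonalEqBot (v := fun n => fourierMode (-n))
    (fourierMode_orthonormal.comp _ neg_injective) (by
      have : range (fun n : ℤ => fourierMode (-n)) = range fourierMode :=
        (Equiv.neg ℤ).surjective.range_comp fourierMode
      rw [this, fourierMode_complete])

lemma expBasis_apply (n : ℤ) : expBasis n = fourierMode (-n) := by
  rw [expBasis, HilbertBasis.coe_mkOfOrthogonalEqBot]

lemma expBasis_mem_graph (n : ℤ) : (expBasis n, (n : ℂ) • expBasis n) ∈ momentumOp.graph := by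
  rw [expBasis_apply]
  simpa only [Int.cast_neg, neg_neg] using fourierMode_mem_momentumOp_graph (-n)

lemma exp_mul_expBasis (n : ℤ) :
    expBasis (n + 1) =ᵐ[momentumMeasure] fun k => Complex.exp (Complex.I * k) * expBasis n k := by
  rw [expBasis_apply, expBasis_apply]
  filter_upwards [(memLp_fourierMode (-(n + 1))).coeFn_toLp, (memLp_fourierMode (-n)).coeFn_toLp]
    with k h1 h2
  rw [fourierMode, h1, fourierMode, h2, ← Complex.exp_add]
  push_cast
  ring_nf

/-- If multiplication by `u` maps `b n` to `b (n + 1)`, and multiplication by `v` maps `e n` to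
`e (n + 1)`, then the change of basis intertwines the two multiplications. -/
lemma basisChange_mul {b e : HilbertBasis ℤ ℂ K₁} {u v : ℝ → ℂ}
    (hu : ∀ k, ‖u k‖ = 1) (hv : ∀ k, ‖v k‖ = 1) (hvc : Continuous v)
    (hb : ∀ n, b (n + 1) =ᵐ[momentumMeasure] fun k => u k * b n k)
    (he : ∀ n, e (n + 1) =ᵐ[momentumMeasure] fun k => v k * e n k) {f g : K₁}
    (hfg : g =ᵐ[momentumMeasure] fun k => u k * f k) :
    basisChange b e g =ᵐ[momentumMeasure] fun k => v k * basisChange b e f k := by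
  have key : ∀ (c : HilbertBasis ℤ ℂ K₁) (w : ℝ → ℂ), (∀ k, ‖w k‖ = 1) →
      (∀ n, c (n + 1) =ᵐ[momentumMeasure] fun k => w k * c n k) → ∀ s t : K₁,
      (t =ᵐ[momentumMeasure] fun k => w k * s k) → ∀ n,
      inner ℂ (c (n + 1)) t = inner ℂ (c n) s := by
    intro c w hw hc s t hst n
    refine inner_eq_of_ae ?_
    filter_upwards [hc n, hst] with k h1 h2
    have h3 : (starRingEnd ℂ) (w k) * w k = 1 := by
      rw [Complex.conj_mul', hw k]
      norm_num
    rw [h1, h2, map_mul]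
    linear_combination ((starRingEnd ℂ) (c n k) * s k) * h3
  have h1 : basisChange b e g = mulCont v hvc (basisChange b e f) := by
    refine hilbertBasis_ext_inner e fun n => ?_
    have h2 := key e v hv he _ _ (mulCont_ae v hvc (basisChange b e f)) (n - 1)
    have h3 := key b u hu hb f g hfg (n - 1)
    rw [sub_add_cancel] at h2 h3
    rw [h2, inner_basisChange, inner_basisChange, h3]
  rw [h1]
  exact mulCont_ae v hvc _

namespace IsSpeed

variable {τ τ' θ : ℝ → ℝ}

/-- The functions `√τ e^{inθ}` as elements of `L²`. -/
def phaseMode (hτ : IsSpeed τ τ') (hθ : ∀ k, HasDerivAt θ (τ k) k) (n : ℤ) : K₁ :=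
  (memLp_of_continuousOn (hτ.continuous_phaseSolution hθ n).continuousOn).toLp _

lemma phaseMode_ae (hτ : IsSpeed τ τ') (hθ : ∀ k, HasDerivAt θ (τ k) k) (n : ℤ) :
    hτ.phaseMode hθ n =ᵐ[momentumMeasure] phaseSolution τ θ n :=
  MemLp.coeFn_toLp _

lemma phaseSolution_add_one (n : ℤ) (k : ℝ) :
    phaseSolution τ θ (n + 1 : ℤ) k = Complex.exp (Complex.I * θ k) * phaseSolution τ θ n k := by
  simp only [phaseSolution]
  rw [mul_left_comm, ← Complex.exp_add]
  push_cast
  ring_nf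

lemma phaseSolution_endpoints (hτ : IsSpeed τ τ') (h0 : θ 0 = 0)
    (h1 : θ (2 * Real.pi) = 2 * Real.pi) (n : ℤ) :
    phaseSolution τ θ n 0 = phaseSolution τ θ n (2 * Real.pi) := by
  have : Complex.exp (Complex.I * n * ((2 * Real.pi : ℝ) : ℂ)) = 1 := by
    rw [Complex.exp_eq_one_iff]
    refine ⟨n, ?_⟩
    push_cast
    ring
  rw [phaseSolution, phaseSolution, h0, h1, this, ← hτ.periodic]
  simp

/-- The function `√τ e^{inθ}` is an eigenvector with eigenvalue `n`. -/
lemma phaseMode_mem_graph (hτ : IsSpeed τ τ') (hθ : ∀ k, HasDerivAt θ (τ k) k)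
    (hne : ∀ k, τ k ≠ 0) (h0 : θ 0 = 0) (h1 : θ (2 * Real.pi) = 2 * Real.pi) (n : ℤ) :
    (hτ.phaseMode hθ n, (n : ℂ) • hτ.phaseMode hθ n) ∈ (speedOp τ).graph := by
  have hne' : ∀ k, (τ k : ℂ) ≠ 0 := fun k => by exact_mod_cast hne k
  have hφ := hτ.continuous_phaseSolution hθ n
  have hc := hτ.continuous_ofReal
  have hc' := hτ.continuous_deriv_ofReal
  have hE : ∀ k, HasDerivAt (fun k => phaseSolution τ θ n k * (τ k : ℂ)⁻¹)
      ((Complex.I * n * τ k - τ' k / (2 * τ k)) * (phaseSolution τ θ n k * (τ k : ℂ)⁻¹)) k := by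
    intro k
    convert! (hτ.hasDerivAt_phaseSolution hθ n (hne k)).mul
      ((hτ.hasDerivAt k).ofReal_comp.inv (hne' k)) using 1
    have := hne' k
    simp only [Pi.inv_apply]
    field_simp
    ring
  have hEc : Continuous fun k => phaseSolution τ θ n k * (τ k : ℂ)⁻¹ := hφ.mul (hc.inv₀ hne')
  have hE'c : Continuous fun k => (Complex.I * n * τ k - τ' k / (2 * τ k)) *
      (phaseSolution τ θ n k * (τ k : ℂ)⁻¹) :=
    ((continuous_const.mul hc).sub (hc'.div (continuous_const.mul hc) fun k =>
      mul_ne_zero two_ne_zero (hne' k))).mul hEc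
  refine hτ.mem_graph_speedOp.2 ⟨_, _, hasACDeriv_of_hasDerivAt (fun k _ => hE k)
    hE'c.continuousOn, ?_, memLp_of_continuousOn hE'c.continuousOn,
    memLp_of_continuousOn ((hc'.div hc hne').mul hEc).continuousOn, ?_, ?_⟩
  · rw [hτ.phaseSolution_endpoints h0 h1, hτ.periodic]
  · filter_upwards [hτ.phaseMode_ae hθ n] with k hk
    have := hne' k
    rw [hk]
    field_simp
  · filter_upwards [hτ.phaseMode_ae hθ n, Lp.coeFn_smul (n : ℂ) (hτ.phaseMode hθ n)] with k hk hk'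
    have := hne' k
    rw [hk', Pi.smul_apply, hk, smul_eq_mul]
    field_simp
    linear_combination (2 * n * τ k ^ 2 * phaseSolution τ θ n k) * Complex.I_mul_I

lemma orthonormal_phaseMode (hτ : IsSpeed τ τ') (hθ : ∀ k, HasDerivAt θ (τ k) k)
    (hpos : ∀ k, 0 < τ k) (h0 : θ 0 = 0) (h1 : θ (2 * Real.pi) = 2 * Real.pi) :
    Orthonormal ℂ (hτ.phaseMode hθ) := by
  have hne : ∀ k, τ k ≠ 0 := fun k => (hpos k).ne'
  rw [orthonormal_iff_ite]
  intro n m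
  split_ifs with h
  · subst h
    rw [inner_K₁, integral_congr_ae (g := fun k => (τ k : ℂ)), integral_momentumMeasure]
    · have hA : HasACDeriv (fun k => (θ k : ℂ)) (fun k => (τ k : ℂ)) 0 (2 * Real.pi) :=
        hasACDeriv_of_hasDerivAt (fun k _ => (hθ k).ofReal_comp) hτ.continuous_ofReal.continuousOn
      rw [hA.integral_eq_sub, h0, h1]
      have : (Real.pi : ℂ) ≠ 0 := by exact_mod_cast Real.pi_ne_zero
      push_cast
      field_simp
      simp
    · filter_upwards [hτ.phaseMode_ae hθ n] with k hk
      rw [hk, Complex.conj_mul', phaseSolution, norm_mul, Complex.norm_real, Complex.norm_exp,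
        Real.norm_of_nonneg (Real.sqrt_nonneg _)]
      have h2 : (Complex.I * n * θ k).re = 0 := by simp
      rw [h2, Real.exp_zero, mul_one, ← Complex.ofReal_pow, Real.sq_sqrt (abs_nonneg _),
        abs_of_pos (hpos k)]
  · have h2 := (isSymmetricOp_iff hτ.dense_speedOp).1 hτ.isSymmetricOp_speedOp _ _ _ _
      (hτ.phaseMode_mem_graph hθ hne h0 h1 n) (hτ.phaseMode_mem_graph hθ hne h0 h1 m)
    rw [inner_smul_left, inner_smul_right, map_intCast, ← sub_eq_zero, ← sub_mul] at h2
    refine (mul_eq_zero.1 h2).resolve_left ?_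
    exact_mod_cast sub_ne_zero.2 h

/-- Completeness of the functions `√τ e^{inθ}`: if `f` is orthogonal to all of them, then an
integration by parts shows that the primitive of `√τ f`, written in the variable `θ`, has no
nonzero Fourier modes, hence is constant. -/
lemma phaseMode_complete (hτ : IsSpeed τ τ') (hθ : ∀ k, HasDerivAt θ (τ k) k)
    (hpos : ∀ k, 0 < τ k) (h0 : θ 0 = 0) (h1 : θ (2 * Real.pi) = 2 * Real.pi)
    (hsurj : Function.Surjective θ) : (Submodule.span ℂ (range (hτ.phaseMode hθ)))ᗮ = ⊥ := by
  rw [eq_bot_iff]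
  intro f hf
  rw [Submodule.mem_bot]
  have hf0 : ∀ n : ℤ, inner ℂ (hτ.phaseMode hθ n) f = 0 := fun n =>
    (Submodule.mem_orthogonal _ f).1 hf _ (Submodule.subset_span ⟨n, rfl⟩)
  have hmono : StrictMono θ := strictMono_of_hasDerivAt_pos hθ hpos
  have hθc : Continuous θ := continuous_iff_continuousAt.2 fun k => (hθ k).continuousAt
  set ι := hmono.orderIsoOfSurjective θ hsurj with hι
  have hιθ : ∀ k, ι.symm (θ k) = k := fun k => ι.symm_apply_apply k
  have hιc : Continuous ι.symm := ι.symm.continuous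
  set s : ℝ → ℂ := fun k => (√(τ k) : ℝ) with hs
  have hsc : Continuous s :=
    Complex.continuous_ofReal.comp (Real.continuous_sqrt.comp hτ.continuous)
  have hint : IntervalIntegrable (fun k => s k * f k) volume 0 (2 * Real.pi) :=
    intervalIntegrable_of_integrable
      ((memLp_mul_of_continuousOn hsc.continuousOn (Lp.memLp f)).integrable (by norm_num))
  set Φ : ℝ → ℂ := fun x => ∫ t in (0)..x, s t * f t with hΦdef
  have hΦ := hasACDeriv_primitive hint
  have hcoef : ∀ n : ℤ, ∫ k in (0)..(2 * Real.pi),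
      s k * f k * Complex.exp (-Complex.I * n * θ k) = 0 := by
    intro n
    have h2 := hf0 n
    rw [inner_K₁, integral_congr_ae
      (g := fun k => s k * f k * Complex.exp (-Complex.I * n * θ k)),
      integral_momentumMeasure] at h2
    · exact (mul_eq_zero.1 h2).resolve_left (by simp [Real.pi_ne_zero])
    · filter_upwards [hτ.phaseMode_ae hθ n] with k hk
      rw [hk, phaseSolution, map_mul, Complex.conj_ofReal, ← Complex.exp_conj, abs_of_pos (hpos k)]
      simp only [map_mul, Complex.conj_I, Complex.conj_ofReal, map_intCast, hs]
      ring
  have hΦ0 : Φ 0 = 0 := intervalIntegral.integral_same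
  have hΦ1 : Φ (2 * Real.pi) = 0 := by
    have := hcoef 0
    simpa using this
  have hexp : ∀ (n : ℤ) (k : ℝ), HasDerivAt (fun k : ℝ => Complex.exp (-Complex.I * n * θ k))
      (Complex.exp (-Complex.I * n * θ k) * (-Complex.I * n * τ k)) k := fun n k =>
    ((hθ k).ofReal_comp.const_mul _).cexp
  have hΦn : ∀ n : ℤ, n ≠ 0 → ∫ k in (0)..(2 * Real.pi),
      τ k • (Φ k * Complex.exp (-Complex.I * n * θ k)) = 0 := by
    intro n hn
    have hec : Continuous fun k => Complex.exp (-Complex.I * n * θ k) := by fun_prop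
    have h2 : HasACDeriv _ _ 0 (2 * Real.pi) := hasACDeriv_of_hasDerivAt (fun k _ => hexp n k)
      (hec.mul (continuous_const.mul hτ.continuous_ofReal)).continuousOn
    have h3 := (hΦ.mul h2).integral_eq_sub
    rw [intervalIntegral.integral_add] at h3
    · change _ = Φ _ * _ - Φ _ * _ at h3
      rw [hcoef n, hΦ0, hΦ1, zero_mul, zero_mul, sub_zero, zero_add] at h3
      have h4 : (-Complex.I * n : ℂ) ≠ 0 :=
        mul_ne_zero (neg_ne_zero.2 Complex.I_ne_zero) (by exact_mod_cast hn)
      refine (mul_eq_zero.1 (Eq.trans ?_ h3)).resolve_left h4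
      rw [← intervalIntegral.integral_const_mul]
      refine intervalIntegral.integral_congr fun k _ => ?_
      simp only [Complex.real_smul, hΦdef]
      ring
    · exact hint.mul_continuousOn hec.continuousOn
    · exact (hΦ.continuousOn.mul
        (hec.mul (continuous_const.mul hτ.continuous_ofReal)).continuousOn).intervalIntegrable
  -- in the variable `y = θ k`
  set ψ : ℝ → ℂ := fun y => Φ (ι.symm y) with hψdef
  have hι0 : ι.symm 0 = 0 := by rw [← h0, hιθ, h0]
  have hι1 : ι.symm (2 * Real.pi) = 2 * Real.pi := by
    have := hιθ (2 * Real.pi)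
    rwa [h1] at this
  have hψc : ContinuousOn ψ (uIcc 0 (2 * Real.pi)) := by
    refine hΦ.continuousOn.comp hιc.continuousOn fun y hy => ?_
    rw [uIcc_of_le Real.two_pi_pos.le] at hy ⊢
    have e1 := ι.symm.monotone hy.1
    have e2 := ι.symm.monotone hy.2
    rw [hι0] at e1
    rw [hι1] at e2
    exact ⟨e1, e2⟩
  have hψn : ∀ n : ℤ, n ≠ 0 → ∫ y in (0)..(2 * Real.pi),
      Complex.exp (Complex.I * n * y) * ψ y = 0 := by
    intro n hn
    have h2 := intervalIntegral.integral_deriv_smul_comp_of_deriv_nonneg (a := 0)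
      (b := 2 * Real.pi) (f := θ) (f' := τ)
      (g := fun y => Complex.exp (Complex.I * n * y) * ψ y) hθc.continuousOn
      (fun k _ => hθ k) fun k _ => (hpos k).le
    rw [h0, h1] at h2
    rw [← h2, ← hΦn (-n) (neg_ne_zero.2 hn)]
    refine intervalIntegral.integral_congr fun k _ => ?_
    simp only [Function.comp_apply, hψdef, hιθ, Int.cast_neg]
    ring_nf
  have hψm : MemLp ψ 2 momentumMeasure := memLp_of_continuousOn hψc
  set g := hψm.toLp ψ with hg
  have hgz : g - inner ℂ (fourierMode 0) g • fourierMode 0 = 0 := by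
    refine eq_zero_of_inner_fourierMode fun n => ?_
    rw [inner_sub_right, inner_smul_right, orthonormal_iff_ite.1 fourierMode_orthonormal]
    rcases eq_or_ne n 0 with rfl | hn
    · simp
    · rw [if_neg hn, mul_zero, sub_zero, inner_K₁, integral_congr_ae
        (g := fun y : ℝ => Complex.exp (Complex.I * n * y) * ψ y), integral_momentumMeasure,
        hψn n hn, mul_zero]
      filter_upwards [(memLp_fourierMode n).coeFn_toLp, hψm.coeFn_toLp] with y h2 h3
      rw [fourierMode, h2, hg, h3, ← Complex.exp_conj]
      simp
  set c : ℂ := inner ℂ (fourierMode 0) g with hc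
  have hψconst : ∀ᵐ y, y ∈ uIcc 0 (2 * Real.pi) → ψ y = c := by
    rw [← ae_momentumMeasure_iff]
    rw [sub_eq_zero] at hgz
    filter_upwards [hψm.coeFn_toLp, (memLp_fourierMode 0).coeFn_toLp,
      Lp.coeFn_smul c (fourierMode 0)] with y h2 h3 h4
    rw [← h2, ← hg, hgz, h4, Pi.smul_apply, fourierMode, h3]
    simp
  have hψeq : EqOn ψ (fun _ => c) (uIcc 0 (2 * Real.pi)) := by
    rw [uIcc_of_le Real.two_pi_pos.le] at hψconst hψc ⊢
    refine Measure.eqOn_Icc_of_ae_eq volume Real.two_pi_pos.ne ?_ hψc continuousOn_const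
    rwa [Filter.EventuallyEq, ae_restrict_iff' measurableSet_Icc]
  have hc0 : c = 0 := by
    have h2 : ψ 0 = c := hψeq left_mem_uIcc
    rw [← h2, hψdef]
    simp only [hι0, hΦ0]
  have hΦz : ∀ k ∈ uIcc 0 (2 * Real.pi), Φ k = 0 := by
    intro k hk
    have hθk : θ k ∈ uIcc 0 (2 * Real.pi) := by
      rw [uIcc_of_le Real.two_pi_pos.le] at hk ⊢
      have e1 := hmono.monotone hk.1
      have e2 := hmono.monotone hk.2
      rw [h0] at e1
      rw [h1] at e2
      exact ⟨e1, e2⟩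
    have := hψeq hθk
    simpa only [hψdef, hιθ, hc0] using this
  have hz : HasACDeriv (fun _ => (0 : ℂ)) (fun _ => 0) 0 (2 * Real.pi) :=
    hasACDeriv_of_hasDerivAt (fun k _ => hasDerivAt_const k 0) continuousOn_const
  have hd := (hΦ.deriv_unique Real.two_pi_pos hz (Filter.Eventually.of_forall hΦz)).2
  rw [← ae_momentumMeasure_iff] at hd
  refine Lp.ext ?_
  filter_upwards [hd, Lp.coeFn_zero ℂ 2 momentumMeasure] with k h2 h3
  rw [h3]
  refine (mul_eq_zero.1 h2).resolve_left ?_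
  exact Complex.ofReal_ne_zero.2 (Real.sqrt_pos.2 (hpos k)).ne'

/-- For a positive speed, the operator has an orthonormal basis of eigenvectors with
eigenvalues `n ∈ ℤ`, on which multiplication by `e^{iθ}` acts as a shift. -/
lemma exists_hilbertBasis (hτ : IsSpeed τ τ') (hθ : ∀ k, HasDerivAt θ (τ k) k)
    (hpos : ∀ k, 0 < τ k) (h0 : θ 0 = 0) (h1 : θ (2 * Real.pi) = 2 * Real.pi)
    (hsurj : Function.Surjective θ) :
    ∃ b : HilbertBasis ℤ ℂ K₁, (∀ n : ℤ, (b n, (n : ℂ) • b n) ∈ (speedOp τ).graph) ∧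
      ∀ n, b (n + 1) =ᵐ[momentumMeasure] fun k => Complex.exp (Complex.I * θ k) * b n k := by
  refine ⟨HilbertBasis.mkOfOrthogonalEqBot (hτ.orthonormal_phaseMode hθ hpos h0 h1)
    (hτ.phaseMode_complete hθ hpos h0 h1 hsurj), ?_, ?_⟩
  · rw [HilbertBasis.coe_mkOfOrthogonalEqBot]
    exact hτ.phaseMode_mem_graph hθ (fun k => (hpos k).ne') h0 h1
  · rw [HilbertBasis.coe_mkOfOrthogonalEqBot]
    intro n
    filter_upwards [hτ.phaseMode_ae hθ n, hτ.phaseMode_ae hθ (n + 1)] with k h2 h3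
    rw [h2, h3, phaseSolution_add_one]

/-- The basis for the speed `-τ`, obtained by reflection of the index. -/
lemma exists_hilbertBasis_neg (hτ : IsSpeed τ τ') (hθ : ∀ k, HasDerivAt θ (τ k) k)
    (hpos : ∀ k, 0 < τ k) (h0 : θ 0 = 0) (h1 : θ (2 * Real.pi) = 2 * Real.pi)
    (hsurj : Function.Surjective θ) :
    ∃ b : HilbertBasis ℤ ℂ K₁,
      (∀ n : ℤ, (b n, (n : ℂ) • b n) ∈ (speedOp fun k => -τ k).graph) ∧
      ∀ n, b (n + 1) =ᵐ[momentumMeasure] fun k => Complex.exp (-Complex.I * θ k) * b n k := by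
  obtain ⟨b, hb, hb'⟩ := hτ.exists_hilbertBasis hθ hpos h0 h1 hsurj
  refine ⟨HilbertBasis.mk (v := fun n => b (-n)) (b.orthonormal.comp _ neg_injective) ?_, ?_, ?_⟩
  · have : range (fun n : ℤ => b (-n)) = range b := (Equiv.neg ℤ).surjective.range_comp b
    rw [this, b.dense_span]
  · rw [HilbertBasis.coe_mk]
    intro n
    rw [hτ.speedOp_neg, mem_graph_neg, ← neg_smul, ← Int.cast_neg]
    exact hb (-n)
  · rw [HilbertBasis.coe_mk]
    intro n
    have h2 := hb' (-(n + 1))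
    rw [neg_add_rev, neg_add_cancel_comm] at h2
    rw [neg_add_rev]
    filter_upwards [h2] with k h3
    rw [h3, ← mul_assoc, ← Complex.exp_add]
    simp

end IsSpeed

/-! ### The phase of the eigenvalues -/

/-- The expression under the square root in `eigenvalue₁`. -/
def radicand (b k : ℝ) : ℝ :=
  1 + (8 * b ^ 2 - 16 * b ^ 4) * Real.cos k ^ 2 + 16 * b ^ 4 * Real.cos k ^ 4

/-- The numerator of the derivative of the phase. -/
def speedNumerator (b k : ℝ) : ℝ := 1 - 4 * b ^ 2 + 12 * b ^ 2 * Real.cos k ^ 2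

/-- The derivative of the phase of `λ₁`. -/
def phaseSpeed (b k : ℝ) : ℝ := speedNumerator b k / √(radicand b k)

/-- The phase of `λ₁`. -/
def phase (b k : ℝ) : ℝ := ∫ t in (0)..k, phaseSpeed b t

/-- The derivative of `phaseSpeed`. -/
def phaseSpeedDeriv (b k : ℝ) : ℝ :=
  ((-24 * b ^ 2 * Real.cos k * Real.sin k) * √(radicand b k) -
    speedNumerator b k * (-(2 * Real.cos k * Real.sin k * (8 * b ^ 2 - 16 * b ^ 4) +
      64 * b ^ 4 * Real.cos k ^ 3 * Real.sin k) / (2 * √(radicand b k)))) / √(radicand b k) ^ 2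

section

variable {b : ℝ}

lemma radicand_pos (hb : b ^ 2 < 1) (k : ℝ) : 0 < radicand b k := by
  have h : radicand b k = (1 - 4 * (b * Real.cos k) ^ 2) ^ 2 +
      16 * (b * Real.cos k) ^ 2 * (1 - b ^ 2) := by
    rw [radicand]
    ring
  rw [h]
  rcases eq_or_ne (b * Real.cos k) 0 with h0 | h0
  · rw [h0]
    norm_num
  · have h1 : 0 < (b * Real.cos k) ^ 2 := by positivity
    have h2 : 0 < 1 - b ^ 2 := by linarith
    positivity

lemma sqrt_radicand_pos (hb : b ^ 2 < 1) (k : ℝ) : 0 < √(radicand b k) :=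
  Real.sqrt_pos.2 (radicand_pos hb k)

lemma hasDerivAt_sqrt_radicand (hb : b ^ 2 < 1) (k : ℝ) :
    HasDerivAt (fun k => √(radicand b k))
      (-(2 * Real.cos k * Real.sin k * (8 * b ^ 2 - 16 * b ^ 4) +
        64 * b ^ 4 * Real.cos k ^ 3 * Real.sin k) / (2 * √(radicand b k))) k := by
  have h : HasDerivAt (radicand b) (-(2 * Real.cos k * Real.sin k * (8 * b ^ 2 - 16 * b ^ 4) +
      64 * b ^ 4 * Real.cos k ^ 3 * Real.sin k)) k := by
    convert! ((((Real.hasDerivAt_cos k).pow 2).const_mul (8 * b ^ 2 - 16 * b ^ 4)).const_add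
      (1 : ℝ)).add (((Real.hasDerivAt_cos k).pow 4).const_mul (16 * b ^ 4)) using 1
    push_cast
    ring
  exact h.sqrt (radicand_pos hb k).ne'

lemma hasDerivAt_phaseSpeed (hb : b ^ 2 < 1) (k : ℝ) :
    HasDerivAt (phaseSpeed b) (phaseSpeedDeriv b k) k := by
  have h : HasDerivAt (speedNumerator b) (-24 * b ^ 2 * Real.cos k * Real.sin k) k := by
    convert! (((Real.hasDerivAt_cos k).pow 2).const_mul (12 * b ^ 2)).const_add
      (1 - 4 * b ^ 2) using 1
    push_cast
    ring
  exact h.div (hasDerivAt_sqrt_radicand hb k) (sqrt_radicand_pos hb k).ne'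

lemma continuous_phaseSpeed (hb : b ^ 2 < 1) : Continuous (phaseSpeed b) :=
  continuous_iff_continuousAt.2 fun k => (hasDerivAt_phaseSpeed hb k).continuousAt

lemma continuous_phaseSpeedDeriv (hb : b ^ 2 < 1) : Continuous (phaseSpeedDeriv b) := by
  have hs : Continuous fun k => √(radicand b k) := by
    unfold radicand
    fun_prop
  have hn : Continuous (speedNumerator b) := by
    unfold speedNumerator
    fun_prop
  have hne : ∀ k, √(radicand b k) ≠ 0 := fun k => (sqrt_radicand_pos hb k).ne'
  refine Continuous.div (Continuous.sub (by fun_prop) (hn.mul (Continuous.div (by fun_prop)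
    (by fun_prop) fun k => mul_ne_zero two_ne_zero (hne k)))) (hs.pow 2) fun k =>
    pow_ne_zero 2 (hne k)

lemma hasDerivAt_phase (hb : b ^ 2 < 1) (k : ℝ) :
    HasDerivAt (phase b) (phaseSpeed b k) k :=
  intervalIntegral.integral_hasDerivAt_right
    ((continuous_phaseSpeed hb).intervalIntegrable _ _)
    ((continuous_phaseSpeed hb).stronglyMeasurableAtFilter _ _)
    (continuous_phaseSpeed hb).continuousAt

lemma eigenvalue₁_eq (b k : ℝ) : eigenvalue₁ b k =
    (Real.cos k * (1 - 4 * b ^ 2 * Real.sin k ^ 2) : ℝ) +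
      Complex.I * (Real.sin k * √(radicand b k) : ℝ) := rfl

lemma eigenvalue₁_re (b k : ℝ) :
    (eigenvalue₁ b k).re = Real.cos k * (1 - 4 * b ^ 2 * Real.sin k ^ 2) := by
  rw [eigenvalue₁_eq, Complex.add_re, Complex.ofReal_re, Complex.re_mul_ofReal, Complex.I_re]
  ring

lemma eigenvalue₁_im (b k : ℝ) : (eigenvalue₁ b k).im = Real.sin k * √(radicand b k) := by
  rw [eigenvalue₁_eq, Complex.add_im, Complex.ofReal_im, Complex.im_mul_ofReal, Complex.I_im]
  ring

/-- The phase moves with speed `phaseSpeed`: the real part `X` and the imaginary part `Y` of `λ₁`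
satisfy `X' = -τ Y` and `Y' = τ X`. -/
lemma hasDerivAt_eigenvalue₁ (hb : b ^ 2 < 1) (k : ℝ) :
    HasDerivAt (eigenvalue₁ b) (Complex.I * phaseSpeed b k * eigenvalue₁ b k) k := by
  have hs := sqrt_radicand_pos hb k
  have hsq : √(radicand b k) ^ 2 = radicand b k := Real.sq_sqrt (radicand_pos hb k).le
  have hcs : Real.sin k ^ 2 = 1 - Real.cos k ^ 2 := Real.sin_sq k
  have hX : HasDerivAt (fun k => Real.cos k * (1 - 4 * b ^ 2 * Real.sin k ^ 2))
      (-(phaseSpeed b k * (Real.sin k * √(radicand b k)))) k := by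
    convert! (Real.hasDerivAt_cos k).mul
      ((((Real.hasDerivAt_sin k).fun_pow 2).const_mul (4 * b ^ 2)).const_sub 1) using 1
    rw [phaseSpeed, speedNumerator]
    field_simp
    push_cast
    linear_combination (-4 * b ^ 2 * Real.sin k) * hcs
  have hY : HasDerivAt (fun k => Real.sin k * √(radicand b k))
      (phaseSpeed b k * (Real.cos k * (1 - 4 * b ^ 2 * Real.sin k ^ 2))) k := by
    convert! (Real.hasDerivAt_sin k).mul (hasDerivAt_sqrt_radicand hb k) using 1
    rw [phaseSpeed]
    field_simp
    rw [hsq, speedNumerator, radicand]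
    ring_nf
    simp only [hcs]
    ring
  convert! hX.ofReal_comp.add (hY.ofReal_comp.const_mul Complex.I) using 1
  rw [eigenvalue₁_eq]
  push_cast
  linear_combination (phaseSpeed b k * (Complex.sin k * (√(radicand b k) : ℝ))) * Complex.I_mul_I

lemma eigenvalue₁_eq_exp (hb : b ^ 2 < 1) (k : ℝ) :
    eigenvalue₁ b k = Complex.exp (Complex.I * phase b k) := by
  have hd : ∀ k,
      HasDerivAt (fun k => eigenvalue₁ b k * Complex.exp (-Complex.I * phase b k)) 0 k := by
    intro k
    convert! (hasDerivAt_eigenvalue₁ hb k).mul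
      ((hasDerivAt_phase hb k).ofReal_comp.const_mul (-Complex.I)).cexp using 1
    ring
  have h := is_const_of_deriv_eq_zero (fun k => (hd k).differentiableAt) (fun k => (hd k).deriv) k 0
  have h0 : phase b 0 = 0 := intervalIntegral.integral_same
  have h1 : eigenvalue₁ b 0 = 1 := by simp [eigenvalue₁]
  simp only [h0, h1] at h
  rw [neg_mul, Complex.exp_neg] at h
  simpa [mul_inv_eq_one₀ (Complex.exp_ne_zero _)] using h

lemma norm_eigenvalue₁ (hb : b ^ 2 < 1) (k : ℝ) : ‖eigenvalue₁ b k‖ = 1 := by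
  rw [eigenvalue₁_eq_exp hb, mul_comm, Complex.norm_exp_ofReal_mul_I]

/-- The phase speed of the eigenvalue `λⱼ`. -/
def eigenSpeed (b : ℝ) (j : Fin 2) : ℝ → ℝ :=
  ![phaseSpeed b, fun k => -phaseSpeed b k] j

lemma hasDerivAt_eigenvalue (hb : b ^ 2 < 1) (j : Fin 2) (k : ℝ) :
    HasDerivAt (eigenvalue b j) (Complex.I * eigenSpeed b j k * eigenvalue b j k) k := by
  fin_cases j
  · exact hasDerivAt_eigenvalue₁ hb k
  · convert! (hasDerivAt_eigenvalue₁ hb k).star using 1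
    simp [eigenvalue, eigenSpeed]

lemma norm_eigenvalue (hb : b ^ 2 < 1) (j : Fin 2) (k : ℝ) : ‖eigenvalue b j k‖ = 1 := by
  fin_cases j
  · exact norm_eigenvalue₁ hb k
  · simpa [eigenvalue] using norm_eigenvalue₁ hb k

lemma eigenvalue_add_two_pi (b : ℝ) (j : Fin 2) (k : ℝ) :
    eigenvalue b j (k + 2 * Real.pi) = eigenvalue b j k := by
  have : eigenvalue₁ b (k + 2 * Real.pi) = eigenvalue₁ b k := by
    simp only [eigenvalue₁, Real.cos_add_two_pi, Real.sin_add_two_pi]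
  simp only [eigenvalue, this]

lemma continuous_eigenvalue (hb : b ^ 2 < 1) (j : Fin 2) : Continuous (eigenvalue b j) :=
  continuous_iff_continuousAt.2 fun k => (hasDerivAt_eigenvalue hb j k).continuousAt

/-- The operators `T̂ⱼ` depend on the eigenvalue `λⱼ` only through its speed. -/
lemma timeOpMomentum_eq (hb : b ^ 2 < 1) (j : Fin 2) :
    timeOpMomentum b j = speedOp (eigenSpeed b j) := by
  have : (fun k => eigenvalue b j k / deriv (eigenvalue b j) k) =
      fun k => -Complex.I / (eigenSpeed b j k : ℂ) := by
    funext k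
    have h0 : eigenvalue b j k ≠ 0 := by
      rw [← norm_ne_zero_iff, norm_eigenvalue hb]
      exact one_ne_zero
    rw [(hasDerivAt_eigenvalue hb j k).deriv]
    -- where the speed vanishes, both quotients are zero
    rcases eq_or_ne (eigenSpeed b j k : ℂ) 0 with h | h
    · simp [h]
    · field_simp
      simp
  rw [timeOpMomentum, speedOp, this]

lemma phaseSpeed_eq_zero_iff (hb : b ^ 2 < 1) (k : ℝ) :
    phaseSpeed b k = 0 ↔ speedNumerator b k = 0 := by
  rw [phaseSpeed, div_eq_zero_iff, or_iff_left (sqrt_radicand_pos hb k).ne']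

lemma phaseSpeed_pos (hb : b ^ 2 < 1 / 4) (k : ℝ) : 0 < phaseSpeed b k := by
  refine div_pos ?_ (sqrt_radicand_pos (by linarith) k)
  have : 0 ≤ 12 * b ^ 2 * Real.cos k ^ 2 := by positivity
  rw [speedNumerator]
  linarith

/-- The angle `α ∈ (0, π / 2]` at which the speed vanishes for `b² ≥ 1 / 4`; the other zeros in
`[0, 2π]` are `π - α`, `π + α` and `2π - α`. -/
def nodeAngle (b : ℝ) : ℝ := Real.arccos √((4 * b ^ 2 - 1) / (12 * b ^ 2))

lemma cos_nodeAngle_sq (hb : 1 / 4 ≤ b ^ 2) :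
    12 * b ^ 2 * Real.cos (nodeAngle b) ^ 2 = 4 * b ^ 2 - 1 := by
  have h1 : (4 * b ^ 2 - 1) / (12 * b ^ 2) ≤ 1 := by
    rw [div_le_one (by linarith)]
    linarith
  have h2 : 0 ≤ (4 * b ^ 2 - 1) / (12 * b ^ 2) := div_nonneg (by linarith) (by linarith)
  have h3 : 12 * b ^ 2 ≠ 0 := by linarith
  rw [nodeAngle, Real.cos_arccos (by linarith [Real.sqrt_nonneg ((4 * b ^ 2 - 1) / (12 * b ^ 2))])
    (Real.sqrt_le_one.2 h1), Real.sq_sqrt h2, mul_div_cancel₀ _ h3]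

lemma nodeAngle_pos (hb : 1 / 4 ≤ b ^ 2) : 0 < nodeAngle b := by
  rw [nodeAngle, Real.arccos_pos, Real.sqrt_lt' one_pos, one_pow, div_lt_one (by linarith)]
  linarith

lemma nodeAngle_lt (hb : 1 / 4 < b ^ 2) : nodeAngle b < Real.pi / 2 := by
  rw [nodeAngle, Real.arccos_lt_pi_div_two, Real.sqrt_pos]
  exact div_pos (by linarith) (by linarith)

lemma nodeAngle_eq (hb : b ^ 2 = 1 / 4) : nodeAngle b = Real.pi / 2 := by
  rw [nodeAngle, hb]
  norm_num

lemma speedNumerator_eq_zero_iff (hb : 1 / 4 ≤ b ^ 2) (k : ℝ) :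
    speedNumerator b k = 0 ↔
      Real.cos k = Real.cos (nodeAngle b) ∨ Real.cos k = -Real.cos (nodeAngle b) := by
  have h1 := cos_nodeAngle_sq hb
  have h2 : (0 : ℝ) < 12 * b ^ 2 := by linarith
  rw [← sq_eq_sq_iff_eq_or_eq_neg, speedNumerator]
  constructor
  · intro h
    exact mul_left_cancel₀ h2.ne' (by linarith)
  · intro h
    rw [h]
    linarith

lemma eq_nodeAngle_of_speedNumerator_eq_zero (hb : 1 / 4 ≤ b ^ 2) {k : ℝ}
    (h0 : 0 ≤ k) (h1 : k ≤ 2 * Real.pi) (hk : speedNumerator b k = 0) :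
    k = nodeAngle b ∨ k = Real.pi - nodeAngle b ∨ k = Real.pi + nodeAngle b ∨
      k = 2 * Real.pi - nodeAngle b := by
  have hα : Real.arccos (Real.cos (nodeAngle b)) = nodeAngle b :=
    Real.arccos_cos (nodeAngle_pos hb).le (Real.arccos_le_pi _)
  have key : ∀ x, 0 ≤ x → x ≤ Real.pi → Real.cos x = Real.cos (nodeAngle b) ∨
      Real.cos x = -Real.cos (nodeAngle b) → x = nodeAngle b ∨ x = Real.pi - nodeAngle b := by
    rintro x hx0 hx1 (h | h)
    · left
      rw [← hα, ← h, Real.arccos_cos hx0 hx1]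
    · right
      rw [← hα, ← Real.arccos_neg, ← h, Real.arccos_cos hx0 hx1]
  rw [speedNumerator_eq_zero_iff hb] at hk
  rcases le_total k Real.pi with h | h
  · rcases key k h0 h hk with h' | h'
    · exact Or.inl h'
    · exact Or.inr (Or.inl h')
  · rw [← Real.cos_two_pi_sub] at hk
    rcases key (2 * Real.pi - k) (by linarith) (by linarith) hk with h' | h'
    · right; right; right
      linarith
    · right; right; left
      linarith

lemma phaseSpeed_zero_ne_zero (hb : b ^ 2 < 1) : phaseSpeed b 0 ≠ 0 := by
  rw [Ne, phaseSpeed_eq_zero_iff hb, speedNumerator, Real.cos_zero]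
  nlinarith [sq_nonneg b]

/-- At the threshold `b² = 1 / 4` the speed has the two zeros `π / 2` and `3π / 2`. -/
lemma isNodes_phaseSpeed_two (hb : b ^ 2 = 1 / 4) :
    ∃ p, IsNodes (phaseSpeed b) 2 p := by
  have hb1 : b ^ 2 < 1 := by linarith
  have hb2 : 1 / 4 ≤ b ^ 2 := by linarith
  have hα := nodeAngle_eq hb
  have hπ := Real.pi_pos
  refine ⟨fun i => match i with
    | 0 => 0
    | 1 => Real.pi / 2
    | 2 => 3 * Real.pi / 2
    | _ => 2 * Real.pi, rfl, rfl, ?_, ?_, ?_, phaseSpeed_zero_ne_zero hb1⟩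
  · intro i hi
    interval_cases i <;> simp only [zero_add, Nat.reduceAdd] <;> linarith
  · intro i hi hi'
    rw [phaseSpeed_eq_zero_iff hb1, speedNumerator_eq_zero_iff hb2, hα, Real.cos_pi_div_two]
    interval_cases i
    · simp
    · have : (3 * Real.pi / 2 : ℝ) = Real.pi / 2 + Real.pi := by ring
      simp [this, Real.cos_add_pi]
  · intro i hi k hk h
    rw [phaseSpeed_eq_zero_iff hb1] at h
    interval_cases i <;> obtain ⟨h1, h2⟩ := hk <;> simp only [zero_add, Nat.reduceAdd] at h1 h2 <;>
      rcases eq_nodeAngle_of_speedNumerator_eq_zero hb2 (by linarith) (by linarith) h with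
        h' | h' | h' | h' <;> linarith

/-- Above the threshold the speed has four zeros in `[0, 2π]`. -/
lemma isNodes_phaseSpeed_four (hb : 1 / 4 < b ^ 2) (hb1 : b ^ 2 < 1) :
    ∃ p, IsNodes (phaseSpeed b) 4 p := by
  have hα0 := nodeAngle_pos hb.le
  have hα1 := nodeAngle_lt hb
  refine ⟨fun i => match i with
    | 0 => 0
    | 1 => nodeAngle b
    | 2 => Real.pi - nodeAngle b
    | 3 => Real.pi + nodeAngle b
    | 4 => 2 * Real.pi - nodeAngle b
    | _ => 2 * Real.pi, rfl, rfl, ?_, ?_, ?_, phaseSpeed_zero_ne_zero hb1⟩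
  · intro i hi
    interval_cases i <;> simp only [zero_add, Nat.reduceAdd] <;> linarith
  · intro i hi hi'
    rw [phaseSpeed_eq_zero_iff hb1, speedNumerator_eq_zero_iff hb.le]
    interval_cases i
    · exact Or.inl rfl
    · exact Or.inr (Real.cos_pi_sub _)
    · exact Or.inr ((congrArg Real.cos (add_comm _ _)).trans (Real.cos_add_pi _))
    · exact Or.inl (Real.cos_two_pi_sub _)
  · intro i hi k hk h
    rw [phaseSpeed_eq_zero_iff hb1] at h
    interval_cases i <;> obtain ⟨h1, h2⟩ := hk <;> simp only [zero_add, Nat.reduceAdd] at h1 h2 <;>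
      rcases eq_nodeAngle_of_speedNumerator_eq_zero hb.le (by linarith) (by linarith) h with
        h' | h' | h' | h' <;> linarith

lemma isSpeed_phaseSpeed (hb : b ^ 2 < 1) : IsSpeed (phaseSpeed b) (phaseSpeedDeriv b) where
  hasDerivAt := hasDerivAt_phaseSpeed hb
  continuous_deriv := continuous_phaseSpeedDeriv hb
  periodic := by simp [phaseSpeed, speedNumerator, radicand]
  ae_ne_zero := by
    rcases lt_trichotomy (b ^ 2) (1 / 4) with h | h | h
    · exact Filter.Eventually.of_forall fun k => (phaseSpeed_pos h k).ne'
    · obtain ⟨p, hp⟩ := isNodes_phaseSpeed_two h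
      exact hp.ae_ne_zero
    · obtain ⟨p, hp⟩ := isNodes_phaseSpeed_four h hb
      exact hp.ae_ne_zero

lemma exists_isSpeed_eigenSpeed (hb : b ^ 2 < 1) (j : Fin 2) :
    ∃ τ', IsSpeed (eigenSpeed b j) τ' := by
  fin_cases j
  · exact ⟨_, isSpeed_phaseSpeed hb⟩
  · exact ⟨_, (isSpeed_phaseSpeed hb).neg⟩

lemma rank_eigenSpace_adjoint_eigenSpeed (hb : b ^ 2 < 1) {m : ℕ} (hm : m ≠ 0) {p : ℕ → ℝ}
    (hp : IsNodes (phaseSpeed b) m p) (j : Fin 2) (z : ℂ) :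
    Module.rank ℂ (eigenSpace (speedOp (eigenSpeed b j)).adjoint z) = m := by
  fin_cases j
  · exact (isSpeed_phaseSpeed hb).rank_eigenSpace_adjoint (hasDerivAt_phase hb) hp hm z
  · refine (isSpeed_phaseSpeed hb).neg.rank_eigenSpace_adjoint
      (fun k => (hasDerivAt_phase hb k).neg) (p := p) ?_ hm z
    exact ⟨hp.first, hp.last, hp.lt, fun i h1 h2 => neg_eq_zero.2 (hp.node i h1 h2),
      fun i h1 k hk => neg_ne_zero.2 (hp.ne_zero i h1 k hk), neg_ne_zero.2 hp.ne_zero_first⟩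

/-! ### The winding of the phase below the threshold -/

lemma phase_zero (b : ℝ) : phase b 0 = 0 := intervalIntegral.integral_same

lemma cos_phase (hb : b ^ 2 < 1) (k : ℝ) :
    Real.cos (phase b k) = Real.cos k * (1 - 4 * b ^ 2 * Real.sin k ^ 2) := by
  rw [← eigenvalue₁_re, eigenvalue₁_eq_exp hb, mul_comm, Complex.exp_ofReal_mul_I_re]

lemma sin_phase (hb : b ^ 2 < 1) (k : ℝ) :
    Real.sin (phase b k) = Real.sin k * √(radicand b k) := by
  rw [← eigenvalue₁_im, eigenvalue₁_eq_exp hb, mul_comm, Complex.exp_ofReal_mul_I_im]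

lemma strictMono_phase (hb : b ^ 2 < 1 / 4) : StrictMono (phase b) :=
  strictMono_of_hasDerivAt_pos (hasDerivAt_phase (by linarith)) fun k => phaseSpeed_pos hb k

lemma continuous_phase (hb : b ^ 2 < 1) : Continuous (phase b) :=
  continuous_iff_continuousAt.2 fun k => (hasDerivAt_phase hb k).continuousAt

/-- As `k` runs through `[0, π]`, the point `λ₁(k)` runs once through the upper half circle. -/
lemma phase_pi (hb : b ^ 2 < 1 / 4) : phase b Real.pi = Real.pi := by
  have hb1 : b ^ 2 < 1 := by linarith
  have h0 : 0 ≤ phase b Real.pi := by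
    rw [← phase_zero b]
    exact (strictMono_phase hb).monotone Real.pi_pos.le
  have hcos : Real.cos (phase b Real.pi) = Real.cos Real.pi := by
    rw [cos_phase hb1]
    simp
  refine Real.injOn_cos ⟨h0, ?_⟩ ⟨Real.pi_pos.le, le_rfl⟩ hcos
  by_contra! hlt
  obtain ⟨k, hk, hk'⟩ := intermediate_value_Ioo Real.pi_pos.le
    (continuous_phase hb1).continuousOn (show Real.pi ∈ Ioo (phase b 0) (phase b Real.pi) from
      ⟨by rw [phase_zero]; exact Real.pi_pos, hlt⟩)
  have h1 := sin_phase hb1 k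
  rw [hk', Real.sin_pi] at h1
  have := mul_pos (Real.sin_pos_of_mem_Ioo hk) (sqrt_radicand_pos hb1 k)
  linarith

lemma phase_add_pi (hb : b ^ 2 < 1 / 4) (k : ℝ) : phase b (k + Real.pi) = phase b k + Real.pi := by
  have hb1 : b ^ 2 < 1 := by linarith
  have hper : ∀ k, phaseSpeed b (k + Real.pi) = phaseSpeed b k := by
    intro k
    have h4 : Even 4 := by decide
    simp only [phaseSpeed, speedNumerator, radicand, Real.cos_add_pi, even_two.neg_pow, h4.neg_pow]
  have hd : ∀ k, HasDerivAt (fun k => phase b (k + Real.pi) - phase b k) 0 k := by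
    intro k
    convert! ((hasDerivAt_phase hb1 (k + Real.pi)).comp_add_const k Real.pi).sub
      (hasDerivAt_phase hb1 k) using 1
    rw [hper, sub_self]
  have h := is_const_of_deriv_eq_zero (fun k => (hd k).differentiableAt) (fun k => (hd k).deriv) k 0
  simp only [zero_add, phase_pi hb, phase_zero] at h
  linarith

lemma phase_two_pi (hb : b ^ 2 < 1 / 4) : phase b (2 * Real.pi) = 2 * Real.pi := by
  rw [two_mul, phase_add_pi hb, phase_pi hb]

lemma surjective_phase (hb : b ^ 2 < 1 / 4) : Function.Surjective (phase b) := by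
  have hper : Function.Periodic (fun k => phase b k - k) Real.pi := fun k => by
    simp only [phase_add_pi hb]
    ring
  have hn : ∀ n : ℤ, phase b (n * Real.pi) = n * Real.pi := by
    intro n
    have := hper.int_mul_eq n
    simp only [phase_zero, sub_zero, sub_eq_zero] at this
    exact this
  intro y
  refine mem_range_of_exists_le_of_exists_ge (continuous_phase (by linarith)) ?_ ?_
  · refine ⟨⌊y / Real.pi⌋ * Real.pi, ?_⟩
    rw [hn, ← le_div_iff₀ Real.pi_pos]
    exact Int.floor_le _
  · refine ⟨⌈y / Real.pi⌉ * Real.pi, ?_⟩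
    rw [hn, ← div_le_iff₀ Real.pi_pos]
    exact Int.le_ceil _

end

/-! ### Multiplication by unitary matrix-valued functions -/

/-- A Borel function with values in the unitary matrices. -/
structure IsUnitarySymbol (M : ℝ → Matrix (Fin 2) (Fin 2) ℂ) : Prop where
  measurable : ∀ i j, Measurable fun k => M k i j
  unitary : ∀ k, M k ∈ Matrix.unitaryGroup (Fin 2) ℂ

namespace IsUnitarySymbol

variable {M N : ℝ → Matrix (Fin 2) (Fin 2) ℂ}

lemma adjoint (hM : IsUnitarySymbol M) : IsUnitarySymbol fun k => star (M k) where
  measurable i j := by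
    simp only [Matrix.star_apply]
    exact continuous_star.measurable.comp (hM.measurable j i)
  unitary k := Unitary.star_mem (hM.unitary k)

lemma memLp (hM : IsUnitarySymbol M) (f : Double K₁) (i : Fin 2) :
    MemLp (fun k => (M k).mulVec (fun j => f j k) i) 2 momentumMeasure := by
  have h : ∀ j, MemLp (fun k => M k i j * f j k) 2 momentumMeasure := fun j =>
    (Lp.memLp (f j)).of_le
      ((hM.measurable i j).aestronglyMeasurable.mul (Lp.memLp (f j)).aestronglyMeasurable)
      (Filter.Eventually.of_forall fun k => by
        rw [norm_mul]
        exact mul_le_of_le_one_left (norm_nonneg _)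
          (entry_norm_bound_of_unitary (hM.unitary k) i j))
  have := (h 0).add (h 1)
  refine this.ae_eq (Filter.Eventually.of_forall fun k => ?_)
  simp [Matrix.mulVec, dotProduct, Fin.sum_univ_two]

/-- Multiplication by a unitary symbol as a linear map. -/
def toLinearMap (hM : IsUnitarySymbol M) : Double K₁ →ₗ[ℂ] Double K₁ :=
  (mulMatrixOp M).toFun ∘ₗ LinearMap.id.codRestrict (mulMatrixOp M).domain fun f i => hM.memLp f i

lemma toLinearMap_ae (hM : IsUnitarySymbol M) (f : Double K₁) (i : Fin 2) :
    hM.toLinearMap f i =ᵐ[momentumMeasure] fun k => (M k).mulVec (fun j => f j k) i :=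
  (hM.memLp f i).coeFn_toLp

lemma toLinearMap_toLinearMap (hM : IsUnitarySymbol M) (hN : IsUnitarySymbol N)
    (h : ∀ k, M k * N k = 1) (f : Double K₁) : hM.toLinearMap (hN.toLinearMap f) = f := by
  refine PiLp.ext fun i => Lp.ext ?_
  filter_upwards [hM.toLinearMap_ae (hN.toLinearMap f) i,
    Filter.eventually_all.2 fun j => hN.toLinearMap_ae f j] with k h1 h2
  rw [h1]
  simp only [h2]
  change (M k).mulVec ((N k).mulVec fun j => f j k) i = _
  rw [Matrix.mulVec_mulVec, h k, Matrix.one_mulVec]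

lemma inner_toLinearMap (hM : IsUnitarySymbol M) (f g : Double K₁) :
    inner ℂ (hM.toLinearMap f) (hM.toLinearMap g) = inner ℂ f g := by
  have key : ∀ u v : Double K₁, inner ℂ u v =
      ∫ k, ((fun j => v j k) ⬝ᵥ star fun j => u j k) ∂momentumMeasure := by
    intro u v
    rw [PiLp.inner_apply, Fin.sum_univ_two, L2.inner_def, L2.inner_def,
      ← integral_add (L2.integrable_inner _ _) (L2.integrable_inner _ _)]
    simp [dotProduct, Fin.sum_univ_two]
  rw [key, key]
  refine integral_congr_ae ?_
  filter_upwards [Filter.eventually_all.2 fun j => hM.toLinearMap_ae f j,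
    Filter.eventually_all.2 fun j => hM.toLinearMap_ae g j] with k h1 h2
  simp only [h1, h2]
  change (M k).mulVec _ ⬝ᵥ star ((M k).mulVec _) = _
  rw [Matrix.star_mulVec, dotProduct_comm, ← Matrix.dotProduct_mulVec, Matrix.mulVec_mulVec,
    ← Matrix.star_eq_conjTranspose, Unitary.star_mul_self_of_mem (hM.unitary k),
    Matrix.one_mulVec, dotProduct_comm]

/-- Multiplication by a unitary symbol as a unitary operator. -/
def toUnitary (hM : IsUnitarySymbol M) : Double K₁ ≃ₗᵢ[ℂ] Double K₁ :=
  LinearEquiv.isometryOfInner (LinearEquiv.ofLinearMap hM.toLinearMap hM.adjoint.toLinearMap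
    (LinearMap.ext (hM.toLinearMap_toLinearMap hM.adjoint fun k =>
      Unitary.mul_star_self_of_mem (hM.unitary k)))
    (LinearMap.ext (hM.adjoint.toLinearMap_toLinearMap hM fun k =>
      Unitary.star_mul_self_of_mem (hM.unitary k)))) hM.inner_toLinearMap

lemma toUnitary_ae (hM : IsUnitarySymbol M) (f : Double K₁) (i : Fin 2) :
    hM.toUnitary f i =ᵐ[momentumMeasure] fun k => (M k).mulVec (fun j => f j k) i :=
  hM.toLinearMap_ae f i

lemma toUnitary_symm_ae (hM : IsUnitarySymbol M) (f : Double K₁) (i : Fin 2) :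
    hM.toUnitary.symm f i =ᵐ[momentumMeasure] fun k => (star (M k)).mulVec (fun j => f j k) i :=
  hM.adjoint.toLinearMap_ae f i

lemma mulMatrixOp_eq (hM : IsUnitarySymbol M) {V : Double K₁ ≃ₗᵢ[ℂ] Double K₁}
    (hV : ∀ f i, V f i =ᵐ[momentumMeasure] fun k => (M k).mulVec (fun j => f j k) i) :
    mulMatrixOp M = ofUnitary V := by
  refine graph_ext fun f g => ?_
  rw [mem_graph_ofUnitary, mem_graph_iff_exists]
  constructor
  · rintro ⟨h, rfl⟩
    exact PiLp.ext fun i => Lp.ext ((hM.memLp f i).coeFn_toLp.trans (hV f i).symm)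
  · rintro rfl
    exact ⟨fun i => hM.memLp f i, PiLp.ext fun i =>
      Lp.ext ((hM.memLp f i).coeFn_toLp.trans (hV f i).symm)⟩

lemma conjBy_toUnitary (hM : IsUnitarySymbol M) (A : Double K₁ →ₗ.[ℂ] Double K₁) :
    natComp (mulMatrixOp M) (natComp A (mulMatrixOp fun k => (M k)⁻¹)) =
      conjBy hM.toUnitary A := by
  have : (fun k => (M k)⁻¹) = fun k => star (M k) := funext fun k =>
    Matrix.inv_eq_left_inv (Unitary.star_mul_self_of_mem (hM.unitary k))
  rw [this, hM.mulMatrixOp_eq hM.toUnitary_ae, hM.adjoint.mulMatrixOp_eq hM.toUnitary_symm_ae,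
    conjBy]

end IsUnitarySymbol

/-! ### The symbol of the walk -/

lemma inner_fourierMode_fourierUnitary₁ (n : ℤ) (ψ : EllTwo) :
    inner ℂ (fourierMode n) (fourierUnitary₁ ψ) = ψ n := by
  rw [← fourierUnitary₁_single, LinearIsometryEquiv.inner_map_map, lp.inner_single_left]
  simp

/-- The Fourier transform turns the translation into multiplication by `e^{ik}`. -/
lemma fourierUnitary₁_translation (ψ : EllTwo) :
    fourierUnitary₁ (translation ψ) =ᵐ[momentumMeasure]
      fun k => Complex.exp (Complex.I * k) * fourierUnitary₁ ψ k := by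
  have hc : Continuous fun k : ℝ => Complex.exp (Complex.I * k) := by fun_prop
  have h : fourierUnitary₁ (translation ψ) - mulCont _ hc (fourierUnitary₁ ψ) = 0 := by
    refine eq_zero_of_inner_fourierMode fun n => ?_
    rw [inner_sub_right, inner_fourierMode_fourierUnitary₁, translation_apply, sub_eq_zero,
      ← inner_fourierMode_fourierUnitary₁]
    refine inner_eq_of_ae ?_
    filter_upwards [(memLp_fourierMode n).coeFn_toLp, (memLp_fourierMode (n + 1)).coeFn_toLp,
      mulCont_ae _ hc (fourierUnitary₁ ψ)] with k h1 h2 h3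
    rw [fourierMode, h2, fourierMode, h1, h3, ← Complex.exp_conj, ← Complex.exp_conj, ← mul_assoc,
      ← Complex.exp_add]
    congr 2
    simp
    ring
  rw [sub_eq_zero] at h
  rw [h]
  exact mulCont_ae _ hc _

lemma fourierUnitary₁_adjoint_translation (ψ : EllTwo) :
    fourierUnitary₁ (translation.adjoint ψ) =ᵐ[momentumMeasure]
      fun k => Complex.exp (-Complex.I * k) * fourierUnitary₁ ψ k := by
  have hc : Continuous fun k : ℝ => Complex.exp (-Complex.I * k) := by fun_prop
  have h : fourierUnitary₁ (translation.adjoint ψ) - mulCont _ hc (fourierUnitary₁ ψ) = 0 := by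
    refine eq_zero_of_inner_fourierMode fun n => ?_
    rw [inner_sub_right, sub_eq_zero, ← fourierUnitary₁_single, LinearIsometryEquiv.inner_map_map,
      ContinuousLinearMap.adjoint_inner_right, ← LinearIsometryEquiv.inner_map_map fourierUnitary₁]
    refine inner_eq_of_ae ?_
    filter_upwards [fourierUnitary₁_translation (lp.single 2 n 1),
      mulCont_ae _ hc (fourierUnitary₁ ψ)] with k h1 h2
    rw [h1, h2, map_mul, ← Complex.exp_conj]
    simp
    ring
  rw [sub_eq_zero] at h
  rw [h]
  exact mulCont_ae _ hc _

lemma fourierUnitary_apply (ψ : StateSpace) (i : Fin 2) :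
    fourierUnitary ψ i = fourierUnitary₁ (ψ i) := rfl

/-- The Fourier transform turns the operator `A` into multiplication by the function `M`. -/
def HasSymbol (A : StateSpace →L[ℂ] StateSpace) (M : ℝ → Matrix (Fin 2) (Fin 2) ℂ) : Prop :=
  ∀ ψ i, fourierUnitary (A ψ) i =ᵐ[momentumMeasure]
    fun k => (M k).mulVec (fun j => fourierUnitary ψ j k) i

lemma HasSymbol.comp {A B : StateSpace →L[ℂ] StateSpace} {M N : ℝ → Matrix (Fin 2) (Fin 2) ℂ}
    (hA : HasSymbol A M) (hB : HasSymbol B N) : HasSymbol (A ∘L B) fun k => M k * N k := by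
  intro ψ i
  filter_upwards [hA (B ψ) i, Filter.eventually_all.2 fun j => hB ψ j] with k h1 h2
  rw [ContinuousLinearMap.comp_apply, h1]
  simp only [h2]
  change (M k).mulVec ((N k).mulVec fun j => fourierUnitary ψ j k) i = _
  rw [Matrix.mulVec_mulVec]

lemma hasSymbol_shiftOp : HasSymbol shiftOp fun k =>
    !![Complex.exp (Complex.I * k), 0; 0, Complex.exp (-Complex.I * k)] := by
  intro ψ i
  rw [fourierUnitary_apply, shiftOp, blockOp_apply, Fin.sum_univ_two]
  fin_cases i
  · filter_upwards [fourierUnitary₁_translation (ψ 0)] with k hk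
    simpa [Matrix.mulVec, dotProduct, fourierUnitary_apply] using hk
  · filter_upwards [fourierUnitary₁_adjoint_translation (ψ 1)] with k hk
    simpa [Matrix.mulVec, dotProduct, fourierUnitary_apply] using hk

lemma hasSymbol_coinOp (C : Matrix (Fin 2) (Fin 2) ℂ) : HasSymbol (coinOp C) fun _ => C := by
  intro ψ i
  rw [fourierUnitary_apply, coinOp, blockOp_apply, Fin.sum_univ_two, map_add]
  simp only [Matrix.map_apply, smul_apply, ContinuousLinearMap.id_apply,
    map_smul]
  filter_upwards [Lp.coeFn_add (C i 0 • fourierUnitary₁ (ψ 0)) (C i 1 • fourierUnitary₁ (ψ 1)),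
    Lp.coeFn_smul (C i 0) (fourierUnitary₁ (ψ 0)), Lp.coeFn_smul (C i 1) (fourierUnitary₁ (ψ 1))]
    with k h1 h2 h3
  rw [h1, Pi.add_apply, h2, h3]
  simp [Matrix.mulVec, dotProduct, Fin.sum_univ_two, fourierUnitary_apply]

lemma hasSymbol_U₃ (a b : ℝ) : HasSymbol (U₃ a b) (walkSymbol a b) := by
  have h := hasSymbol_shiftOp.comp ((hasSymbol_coinOp !![1, 0; 0, 1]).comp (hasSymbol_shiftOp.comp
    ((hasSymbol_coinOp !![(b : ℂ), (a : ℂ); -(a : ℂ), (b : ℂ)]).comp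
      (hasSymbol_shiftOp.comp (hasSymbol_coinOp !![(b : ℂ), -(a : ℂ); (a : ℂ), (b : ℂ)])))))
  convert! h using 1
  funext k
  have he : ∀ n : ℤ, Complex.exp (Complex.I * n * k) = Complex.exp (Complex.I * k) ^ n := by
    intro n
    rw [← Complex.exp_int_mul]
    ring_nf
  have hinv : Complex.exp (-Complex.I * k) = (Complex.exp (Complex.I * k))⁻¹ := by
    rw [← Complex.exp_neg]
    ring_nf
  have hne := Complex.exp_ne_zero (Complex.I * k)
  simp only [walkSymbol, he, hinv]
  generalize Complex.exp (Complex.I * k) = e at hne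
  ext i j
  fin_cases i <;> fin_cases j <;>
    simp [Matrix.mul_apply, Fin.sum_univ_two, zpow_neg] <;> field_simp <;> norm_cast <;> ring

/-! ### Eigenframes -/

/-- The diagonal entry of the symbol. -/
def symbolDiag (a b k : ℝ) : ℂ :=
  a ^ 2 * Complex.exp (Complex.I * k) + b ^ 2 * Complex.exp (3 * (Complex.I * k))

/-- The off-diagonal entry of the symbol. -/
def symbolOffDiag (a b k : ℝ) : ℂ :=
  a * b * Complex.exp (Complex.I * k) - a * b * Complex.exp (3 * (Complex.I * k))

section

variable {a b : ℝ}

lemma walkSymbol_eq (a b k : ℝ) : walkSymbol a b k =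
    !![symbolDiag a b k, symbolOffDiag a b k;
      -(starRingEnd ℂ) (symbolOffDiag a b k), (starRingEnd ℂ) (symbolDiag a b k)] := by
  ext i j
  fin_cases i <;> fin_cases j <;>
    simp [walkSymbol, symbolDiag, symbolOffDiag, ← Complex.exp_conj, Complex.conj_ofNat] <;>
    ring_nf <;> simp

lemma symbolDiag_re (hab : a ^ 2 + b ^ 2 = 1) (k : ℝ) :
    (symbolDiag a b k).re = (eigenvalue₁ b k).re := by
  have h : symbolDiag a b k =
      (a ^ 2 : ℝ) * Complex.exp ((k : ℝ) * Complex.I) +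
        (b ^ 2 : ℝ) * Complex.exp (((3 * k : ℝ) : ℂ) * Complex.I) := by
    rw [symbolDiag]
    push_cast
    ring_nf
  rw [eigenvalue₁_re, h, Complex.add_re, Complex.re_ofReal_mul, Complex.re_ofReal_mul,
    Complex.exp_ofReal_mul_I_re, Complex.exp_ofReal_mul_I_re, Real.cos_three_mul]
  linear_combination Real.cos k * hab + 4 * b ^ 2 * Real.cos k * Real.sin_sq_add_cos_sq k

lemma symbolDiag_im (a b k : ℝ) :
    (symbolDiag a b k).im = a ^ 2 * Real.sin k + b ^ 2 * Real.sin (3 * k) := by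
  have h : symbolDiag a b k =
      (a ^ 2 : ℝ) * Complex.exp ((k : ℝ) * Complex.I) +
        (b ^ 2 : ℝ) * Complex.exp (((3 * k : ℝ) : ℂ) * Complex.I) := by
    rw [symbolDiag]
    push_cast
    ring_nf
  rw [h, Complex.add_im, Complex.im_ofReal_mul, Complex.im_ofReal_mul,
    Complex.exp_ofReal_mul_I_im, Complex.exp_ofReal_mul_I_im]

/-- The symbol has the trace `λ₁ + λ₂`. -/
lemma symbolDiag_add_conj (hab : a ^ 2 + b ^ 2 = 1) (k : ℝ) :
    symbolDiag a b k + (starRingEnd ℂ) (symbolDiag a b k) =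
      eigenvalue₁ b k + (starRingEnd ℂ) (eigenvalue₁ b k) := by
  rw [Complex.add_conj, Complex.add_conj, symbolDiag_re hab]

/-- The symbol has determinant one. -/
lemma symbol_det (hab : a ^ 2 + b ^ 2 = 1) (k : ℝ) :
    symbolDiag a b k * (starRingEnd ℂ) (symbolDiag a b k) +
      symbolOffDiag a b k * (starRingEnd ℂ) (symbolOffDiag a b k) = 1 := by
  have h3 : Complex.exp (3 * (Complex.I * k)) = Complex.exp (Complex.I * k) ^ 3 := by
    rw [← Complex.exp_nat_mul]
    norm_num
  have hc : Complex.exp (Complex.I * k) * (starRingEnd ℂ) (Complex.exp (Complex.I * k)) = 1 := by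
    rw [← Complex.exp_conj, ← Complex.exp_add]
    simp
  have hab' : (a : ℂ) ^ 2 + (b : ℂ) ^ 2 = 1 := by exact_mod_cast hab
  simp only [symbolDiag, symbolOffDiag, h3, map_add, map_sub, map_mul, map_pow,
    Complex.conj_ofReal]
  generalize Complex.exp (Complex.I * k) = e at hc
  generalize (starRingEnd ℂ) e = e' at hc
  have hc3 : e ^ 3 * e' ^ 3 = 1 := by rw [← mul_pow, hc, one_pow]
  linear_combination (a ^ 2 * (a ^ 2 + b ^ 2) : ℂ) * hc + (b ^ 2 * (a ^ 2 + b ^ 2) : ℂ) * hc3 +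
    (a ^ 2 + b ^ 2 + 1 : ℂ) * hab'

/-- Where the symbol is diagonal, its first diagonal entry is `λ₁`. -/
lemma symbolDiag_eq_of_symbolOffDiag_eq_zero (hab : a ^ 2 + b ^ 2 = 1) (hb : b ^ 2 < 1) {k : ℝ}
    (h : symbolOffDiag a b k = 0) : symbolDiag a b k = eigenvalue₁ b k := by
  have ha : (a : ℂ) ≠ 0 := by
    intro h0
    have : a = 0 := by exact_mod_cast h0
    rw [this] at hab
    linarith
  refine Complex.ext (symbolDiag_re hab k) ?_
  rw [symbolDiag_im, eigenvalue₁_im]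
  rw [symbolOffDiag, ← mul_sub, mul_eq_zero, mul_eq_zero, or_iff_right ha] at h
  rcases h with h | h
  · have hb0 : b = 0 := by exact_mod_cast h
    rw [hb0] at hab ⊢
    simp only [radicand]
    norm_num at hab ⊢
    rcases hab with hab | hab <;> simp [hab]
  · -- `e^{ik} = e^{3ik}` only for `sin k = 0`
    have h1 := congrArg Complex.re h
    have h2 := congrArg Complex.im h
    have e1 : Complex.I * k = (k : ℂ) * Complex.I := mul_comm _ _
    have e2 : 3 * (Complex.I * k) = ((3 * k : ℝ) : ℂ) * Complex.I := by
      push_cast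
      ring
    rw [e2, e1, Complex.sub_re, Complex.exp_ofReal_mul_I_re, Complex.exp_ofReal_mul_I_re,
      Real.cos_three_mul, Complex.zero_re] at h1
    rw [e2, e1, Complex.sub_im, Complex.exp_ofReal_mul_I_im, Complex.exp_ofReal_mul_I_im,
      Real.sin_three_mul, Complex.zero_im] at h2
    have hs : Real.sin k = 0 := by
      have h3 := Real.sin_sq_add_cos_sq k
      have h4 : Real.sin k ^ 2 = 0 := by
        linear_combination (Real.cos k / 2) * h1 + (Real.sin k / 2) * h2 -
          2 * (Real.sin k ^ 2 - Real.cos k ^ 2) * h3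
      exact pow_eq_zero_iff two_ne_zero |>.1 h4
    rw [Real.sin_three_mul, hs]
    ring

lemma continuous_symbolDiag (a b : ℝ) : Continuous (symbolDiag a b) := by
  unfold symbolDiag
  fun_prop

lemma continuous_symbolOffDiag (a b : ℝ) : Continuous (symbolOffDiag a b) := by
  unfold symbolOffDiag
  fun_prop

lemma exp_add_two_pi (k : ℝ) : Complex.exp (Complex.I * (k + 2 * Real.pi : ℝ)) =
    Complex.exp (Complex.I * k) ∧ Complex.exp (3 * (Complex.I * (k + 2 * Real.pi : ℝ))) =
    Complex.exp (3 * (Complex.I * k)) := by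
  have h : Complex.exp (Complex.I * (k + 2 * Real.pi : ℝ)) = Complex.exp (Complex.I * k) := by
    rw [← Complex.exp_periodic (Complex.I * k)]
    push_cast
    ring_nf
  have h3 : ∀ z : ℂ, Complex.exp (3 * z) = Complex.exp z ^ 3 := fun z => by
    rw [← Complex.exp_nat_mul]
    norm_num
  exact ⟨h, by rw [h3, h3, h]⟩

/-- The squared length of the eigenvector `(β, λ - α)` of the matrix with first row `(α, β)`. -/
def frameNormSq (a b k : ℝ) : ℝ :=
  ‖symbolOffDiag a b k‖ ^ 2 + ‖eigenvalue₁ b k - symbolDiag a b k‖ ^ 2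

open Classical in
/-- An eigenframe: the standard basis where the symbol is diagonal, and elsewhere the normalized
vectors `(β, λ₁ - α)` and `(-conj (λ₁ - α), conj β)`, where `(α, β)` is the first row of the
symbol. -/
def frame (a b k : ℝ) : Matrix (Fin 2) (Fin 2) ℂ :=
  if symbolOffDiag a b k = 0 then 1 else
    ((√(frameNormSq a b k))⁻¹ : ℂ) •
      !![symbolOffDiag a b k, -(starRingEnd ℂ) (eigenvalue₁ b k - symbolDiag a b k);
        eigenvalue₁ b k - symbolDiag a b k, (starRingEnd ℂ) (symbolOffDiag a b k)]

lemma frameNormSq_pos {k : ℝ} (h : symbolOffDiag a b k ≠ 0) : 0 < frameNormSq a b k := by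
  have := norm_pos_iff.2 h
  rw [frameNormSq]
  positivity

lemma frame_mem_unitaryGroup (a b k : ℝ) : frame a b k ∈ Matrix.unitaryGroup (Fin 2) ℂ := by
  rw [frame]
  split_ifs with h
  · exact one_mem _
  · have hN := frameNormSq_pos h
    have hs : ((√(frameNormSq a b k) : ℝ) : ℂ) ≠ 0 :=
      Complex.ofReal_ne_zero.2 (Real.sqrt_pos.2 hN).ne'
    have hsq : ((√(frameNormSq a b k) : ℝ) : ℂ) ^ 2 =
        symbolOffDiag a b k * (starRingEnd ℂ) (symbolOffDiag a b k) +
        (eigenvalue₁ b k - symbolDiag a b k) *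
          (starRingEnd ℂ) (eigenvalue₁ b k - symbolDiag a b k) := by
      rw [← Complex.ofReal_pow, Real.sq_sqrt hN.le, frameNormSq, Complex.mul_conj',
        Complex.mul_conj']
      push_cast
      ring
    rw [Matrix.mem_unitaryGroup_iff']
    generalize √(frameNormSq a b k) = s at hs hsq
    generalize eigenvalue₁ b k - symbolDiag a b k = γ at hsq
    generalize symbolOffDiag a b k = β at hsq
    ext i j
    fin_cases i <;> fin_cases j <;>
      simp [Matrix.mul_apply, Fin.sum_univ_two, Matrix.star_apply] <;> field_simp
    · linear_combination -hsq
    · ring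
    · ring
    · linear_combination -hsq

lemma conj_mul_eigenvalue₁ (hb : b ^ 2 < 1) (k : ℝ) :
    eigenvalue₁ b k * (starRingEnd ℂ) (eigenvalue₁ b k) = 1 := by
  rw [Complex.mul_conj', norm_eigenvalue₁ hb]
  norm_num

/-- The columns of the frame are eigenvectors of the symbol. -/
lemma walkSymbol_mul_frame (hab : a ^ 2 + b ^ 2 = 1) (hb : b ^ 2 < 1) (k : ℝ) :
    walkSymbol a b k * frame a b k =
      frame a b k * Matrix.diagonal fun j => eigenvalue b j k := by
  have hl := conj_mul_eigenvalue₁ hb k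
  have ht := symbolDiag_add_conj hab k
  have hd := symbol_det hab k
  have hdiag : (Matrix.diagonal fun j => eigenvalue b j k) =
      !![eigenvalue₁ b k, 0; 0, (starRingEnd ℂ) (eigenvalue₁ b k)] := by
    ext i j
    fin_cases i <;> fin_cases j <;> simp [eigenvalue]
  rw [walkSymbol_eq, hdiag, frame]
  split_ifs with h
  · rw [mul_one, one_mul, symbolDiag_eq_of_symbolOffDiag_eq_zero hab hb h, h, map_zero, neg_zero]
  · rw [Matrix.mul_smul, Matrix.smul_mul]
    congr 1
    generalize eigenvalue₁ b k = l at *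
    generalize symbolDiag a b k = α at *
    generalize symbolOffDiag a b k = β at *
    generalize hl' : (starRingEnd ℂ) l = l' at *
    generalize hα' : (starRingEnd ℂ) α = α' at *
    generalize hβ' : (starRingEnd ℂ) β = β' at *
    -- the characteristic equation: the symbol has trace `α + α'` and determinant one
    have hc : l ^ 2 - (α + α') * l + 1 = 0 := by linear_combination -hl - l * ht
    have hc' : l' ^ 2 - (α + α') * l' + 1 = 0 := by linear_combination -hl - l' * ht
    ext i j
    fin_cases i <;> fin_cases j <;>
      simp [Matrix.mul_apply, Fin.sum_univ_two, hl', hα']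
    · ring
    · linear_combination hd + hc'
    · linear_combination -hd - hc
    · ring

lemma isEigenframe_frame (hab : a ^ 2 + b ^ 2 = 1) (hb : b ^ 2 < 1) :
    IsEigenframe a b (frame a b) where
  measurable i j := by
    have hβ := continuous_symbolOffDiag a b
    have hγ : Continuous fun k => eigenvalue₁ b k - symbolDiag a b k :=
      (continuous_eigenvalue hb 0).sub (continuous_symbolDiag a b)
    have hN : Measurable fun k => ((√(frameNormSq a b k) : ℝ) : ℂ)⁻¹ := by
      have : Continuous fun k => ((√(frameNormSq a b k) : ℝ) : ℂ) := by
        unfold frameNormSq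
        fun_prop
      exact this.measurable.inv
    have hs : MeasurableSet {k | symbolOffDiag a b k = 0} :=
      (isClosed_singleton.preimage hβ).measurableSet
    have hM : ∀ k, frame a b k i j = if symbolOffDiag a b k = 0 then
        (1 : Matrix (Fin 2) (Fin 2) ℂ) i j else ((√(frameNormSq a b k) : ℝ) : ℂ)⁻¹ *
          !![symbolOffDiag a b k, -(starRingEnd ℂ) (eigenvalue₁ b k - symbolDiag a b k);
            eigenvalue₁ b k - symbolDiag a b k, (starRingEnd ℂ) (symbolOffDiag a b k)] i j := by
      intro k
      rw [frame]
      split_ifs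
      · rfl
      · simp
    simp only [hM]
    refine Measurable.ite hs measurable_const (hN.mul (Continuous.measurable ?_))
    fin_cases i <;> fin_cases j
    · exact hβ
    · exact (Complex.continuous_conj.comp hγ).neg
    · exact hγ
    · exact Complex.continuous_conj.comp hβ
  periodic k := by
    have h1 : eigenvalue₁ b (k + 2 * Real.pi) = eigenvalue₁ b k := eigenvalue_add_two_pi b 0 k
    simp only [frame, frameNormSq, symbolDiag, symbolOffDiag, (exp_add_two_pi k).1,
      (exp_add_two_pi k).2, h1]
    congr
  unitary := frame_mem_unitaryGroup a b
  diagonalizes k := by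
    rw [Matrix.mul_assoc, walkSymbol_mul_frame hab hb, ← Matrix.mul_assoc, Matrix.inv_eq_left_inv
      (Unitary.star_mul_self_of_mem (frame_mem_unitaryGroup a b k)),
      Unitary.star_mul_self_of_mem (frame_mem_unitaryGroup a b k), one_mul]

/-! ### The spectral representation of the walk and of the time operator -/

lemma isUnitarySymbol_eigenvalue (hb : b ^ 2 < 1) :
    IsUnitarySymbol fun k => Matrix.diagonal fun j => eigenvalue b j k where
  measurable i j := by
    rcases eq_or_ne i j with rfl | h
    · simp only [Matrix.diagonal_apply_eq]
      exact (continuous_eigenvalue hb i).measurable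
    · simp only [Matrix.diagonal_apply_ne _ h]
      exact measurable_const
  unitary k := by
    rw [Matrix.mem_unitaryGroup_iff, Matrix.star_eq_conjTranspose, Matrix.diagonal_conjTranspose,
      Matrix.diagonal_mul_diagonal, ← Matrix.diagonal_one]
    congr 1
    funext j
    rw [Pi.star_apply, ← starRingEnd_apply, Complex.mul_conj', norm_eigenvalue hb]
    norm_num

/-- Multiplication by `λⱼ` in the `j`-th component. -/
def eigenvalueUnitary (hb : b ^ 2 < 1) : Double K₁ ≃ₗᵢ[ℂ] Double K₁ :=
  (isUnitarySymbol_eigenvalue hb).toUnitary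

lemma eigenvalueUnitary_ae (hb : b ^ 2 < 1) (f : Double K₁) (i : Fin 2) :
    eigenvalueUnitary hb f i =ᵐ[momentumMeasure] fun k => eigenvalue b i k * f i k := by
  filter_upwards [(isUnitarySymbol_eigenvalue hb).toUnitary_ae f i] with k hk
  rw [eigenvalueUnitary, hk, Matrix.mulVec_diagonal]

end

namespace IsEigenframe

variable {a b : ℝ} {W : ℝ → Matrix (Fin 2) (Fin 2) ℂ}

lemma isUnitarySymbol (hW : IsEigenframe a b W) : IsUnitarySymbol W := ⟨hW.measurable, hW.unitary⟩

/-- The unitary `ℱ⁻¹ W` onto the state space. -/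
def diagonalizer (hW : IsEigenframe a b W) : Double K₁ ≃ₗᵢ[ℂ] StateSpace :=
  hW.isUnitarySymbol.toUnitary.trans fourierUnitary.symm

lemma timeOp_eq (hW : IsEigenframe a b W) (hb : b ^ 2 < 1) :
    timeOp b W = conjBy hW.diagonalizer (directSum fun j => speedOp (eigenSpeed b j)) := by
  rw [timeOp, hW.isUnitarySymbol.conjBy_toUnitary, conjBy_conjBy, diagonalizer]
  congr 2
  funext j
  exact timeOpMomentum_eq hb j

lemma U₃_diagonalizer (hW : IsEigenframe a b W) (hb : b ^ 2 < 1) (f : Double K₁) :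
    U₃ a b (hW.diagonalizer f) = hW.diagonalizer (eigenvalueUnitary hb f) := by
  refine fourierUnitary.injective (PiLp.ext fun i => Lp.ext ?_)
  have hinv : ∀ k, walkSymbol a b k * W k = W k * Matrix.diagonal fun j => eigenvalue b j k := by
    intro k
    rw [← hW.diagonalizes k, Matrix.inv_eq_left_inv (Unitary.star_mul_self_of_mem (hW.unitary k)),
      ← Matrix.mul_assoc, ← Matrix.mul_assoc, Unitary.mul_star_self_of_mem (hW.unitary k), one_mul]
  have hd : ∀ g : Double K₁, fourierUnitary (hW.diagonalizer g) =
      hW.isUnitarySymbol.toUnitary g := fun g => by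
    rw [diagonalizer, LinearIsometryEquiv.trans_apply, LinearIsometryEquiv.apply_symm_apply]
  rw [hd]
  filter_upwards [hasSymbol_U₃ a b (hW.diagonalizer f) i,
    Filter.eventually_all.2 fun j => hW.isUnitarySymbol.toUnitary_ae f j,
    hW.isUnitarySymbol.toUnitary_ae (eigenvalueUnitary hb f) i,
    Filter.eventually_all.2 fun j => eigenvalueUnitary_ae hb f j] with k h1 h2 h3 h4
  rw [h1, h3, hd]
  simp only [h2, h4]
  have h5 : (fun j => eigenvalue b j k * f j k) =
      (Matrix.diagonal fun j => eigenvalue b j k).mulVec fun j => f j k := by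
    funext j
    rw [Matrix.mulVec_diagonal]
  rw [h5, Matrix.mulVec_mulVec, Matrix.mulVec_mulVec, hinv]

/-- The walk is unitarily equivalent to multiplication by its eigenvalues. -/
lemma U₃_eq (hW : IsEigenframe a b W) (hb : b ^ 2 < 1) :
    U₃ a b = (((hW.diagonalizer.symm.trans (eigenvalueUnitary hb)).trans
      hW.diagonalizer).toContinuousLinearEquiv : StateSpace →L[ℂ] StateSpace) := by
  refine ContinuousLinearMap.ext fun ψ => ?_
  have := hW.U₃_diagonalizer hb (hW.diagonalizer.symm ψ)
  rwa [LinearIsometryEquiv.apply_symm_apply] at this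

lemma U₃_mem_unitary (hW : IsEigenframe a b W) (hb : b ^ 2 < 1) :
    U₃ a b ∈ _root_.unitary (StateSpace →L[ℂ] StateSpace) := by
  rw [hW.U₃_eq hb]
  exact (Unitary.linearIsometryEquiv.symm
    ((hW.diagonalizer.symm.trans (eigenvalueUnitary hb)).trans hW.diagonalizer)).2

/-- The walk shifts the time operator by one: this is `T U = U (T + 1)` and its converse. -/
lemma U₃_mem_graph_timeOp_iff (hW : IsEigenframe a b W) (hb : b ^ 2 < 1) {x y : StateSpace} :
    (U₃ a b x, U₃ a b (y + x)) ∈ (timeOp b W).graph ↔ (x, y) ∈ (timeOp b W).graph := by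
  obtain ⟨f, rfl⟩ := hW.diagonalizer.surjective x
  obtain ⟨g, rfl⟩ := hW.diagonalizer.surjective y
  rw [← map_add, hW.U₃_diagonalizer hb, hW.U₃_diagonalizer hb, hW.timeOp_eq hb]
  simp only [mem_graph_conjBy, LinearIsometryEquiv.symm_apply_apply, mem_graph_directSum]
  refine forall_congr' fun i => ?_
  obtain ⟨τ', hτ⟩ := exists_isSpeed_eigenSpeed hb i
  have hnorm : ∀ k, (starRingEnd ℂ) (eigenvalue b i k) * eigenvalue b i k = 1 := fun k => by
    rw [Complex.conj_mul', norm_eigenvalue hb]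
    norm_num
  have hper : eigenvalue b i 0 = eigenvalue b i (2 * Real.pi) := by
    rw [← eigenvalue_add_two_pi b i 0, zero_add]
  constructor
  · intro h
    refine hτ.mul_mem_graph_speedOp (ev := fun k => (starRingEnd ℂ) (eigenvalue b i k)) (ε := -1)
      (fun k => ?_) (by rw [hper]) h ?_ ?_
    · convert! (hasDerivAt_eigenvalue hb i k).star using 1
      simp
    · filter_upwards [eigenvalueUnitary_ae hb f i] with k h1
      rw [h1, ← mul_assoc, hnorm, one_mul]
    · filter_upwards [eigenvalueUnitary_ae hb f i, eigenvalueUnitary_ae hb (g + f) i,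
        Lp.coeFn_add (g i) (f i)] with k h1 h2 h3
      rw [h1, h2, PiLp.add_apply, h3, Pi.add_apply]
      linear_combination (-g i k) * hnorm k
  · intro h
    refine hτ.mul_mem_graph_speedOp (ev := eigenvalue b i) (ε := 1)
      (fun k => ?_) hper h (eigenvalueUnitary_ae hb f i) ?_
    · rw [mul_one]
      exact hasDerivAt_eigenvalue hb i k
    · filter_upwards [eigenvalueUnitary_ae hb (g + f) i, Lp.coeFn_add (g i) (f i)] with k h2 h3
      rw [h2, PiLp.add_apply, h3, Pi.add_apply, one_mul]

end IsEigenframe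

namespace IsEigenframe

variable {a b : ℝ} {W : ℝ → Matrix (Fin 2) (Fin 2) ℂ}

/-! ### Properties of the time operator -/

lemma isSymmetricOp_timeOp (hW : IsEigenframe a b W) (hb : b ^ 2 < 1) :
    IsSymmetricOp (timeOp b W) := by
  rw [hW.timeOp_eq hb]
  refine isSymmetricOp_conjBy _ (isSymmetricOp_directSum fun j => ?_)
  obtain ⟨τ', hτ⟩ := exists_isSpeed_eigenSpeed hb j
  exact hτ.isSymmetricOp_speedOp

lemma isStrongTimeOperator_timeOp (hW : IsEigenframe a b W) (hb : b ^ 2 < 1) :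
    IsStrongTimeOperator (timeOp b W) (U₃ a b) := by
  have hU := hW.U₃_mem_unitary hb
  refine ⟨hU, hW.isSymmetricOp_timeOp hb, graph_ext fun x y => ?_⟩
  have h1 : ∀ x, (U₃ a b).adjoint (U₃ a b x) = x := fun x =>
    congrArg (fun A : StateSpace →L[ℂ] StateSpace => A x) (Unitary.star_mul_self_of_mem hU)
  have h2 : ∀ x, U₃ a b ((U₃ a b).adjoint x) = x := fun x =>
    congrArg (fun A : StateSpace →L[ℂ] StateSpace => A x) (Unitary.mul_star_self_of_mem hU)
  simp only [mem_graph_natComp, mem_graph_ofCLM, mem_graph_add, ContinuousLinearMap.id_apply]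
  constructor
  · rintro ⟨w, ⟨_, rfl, hw⟩, rfl⟩
    refine ⟨(U₃ a b).adjoint w - x, x, ?_, rfl, (sub_add_cancel _ _).symm⟩
    rwa [← hW.U₃_mem_graph_timeOp_iff hb, sub_add_cancel, h2]
  · rintro ⟨v, _, hv, rfl, rfl⟩
    exact ⟨_, ⟨_, rfl, (hW.U₃_mem_graph_timeOp_iff hb).2 hv⟩, (h1 _).symm⟩

/-- An extension satisfies the commutation relation on the domain of the time operator. -/
lemma isTimeOperator_of_le (hW : IsEigenframe a b W) (hb : b ^ 2 < 1)
    {A : StateSpace →ₗ.[ℂ] StateSpace} (hA : timeOp b W ≤ A) (hA' : IsSelfAdjoint A) :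
    IsTimeOperator A (U₃ a b) := by
  refine ⟨hW.U₃_mem_unitary hb, isSymmetricOp_of_isSelfAdjoint hA', (timeOp b W).domain, ?_, ?_⟩
  · intro h
    have hd := (hW.isSymmetricOp_timeOp hb).1
    rw [h, Submodule.bot_coe, dense_iff_closure_eq, closure_singleton] at hd
    have h0 : hW.diagonalizer (WithLp.toLp 2 fun _ => fourierMode 0) = 0 := by
      rw [← mem_singleton_iff, hd]
      exact mem_univ _
    rw [LinearIsometryEquiv.map_eq_zero_iff] at h0
    have h1 : fourierMode 0 = 0 := congrArg (fun f : Double K₁ => f 0) h0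
    have h2 := fourierMode_orthonormal.1 0
    rw [h1, norm_zero] at h2
    exact zero_ne_one h2
  · intro ψ hψ
    obtain ⟨φ, hφ⟩ := LinearPMap.mem_domain_iff.1 hψ
    obtain ⟨h1, rfl⟩ := mem_graph_iff_exists.1 (LinearPMap.le_graph_of_le hA hφ)
    obtain ⟨h2, h3⟩ := mem_graph_iff_exists.1 (LinearPMap.le_graph_of_le hA
      ((hW.U₃_mem_graph_timeOp_iff hb).2 hφ))
    refine ⟨h2, h1, ?_⟩
    rw [h3, map_add, add_sub_cancel_left]

lemma exists_selfAdjoint_extension (hW : IsEigenframe a b W) (hb : b ^ 2 < 1) :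
    ∃ A : StateSpace →ₗ.[ℂ] StateSpace, timeOp b W ≤ A ∧ IsSelfAdjoint A := by
  have hτ := isSpeed_phaseSpeed hb
  obtain ⟨B, hB, hB'⟩ := hτ.isSymmetricOp_speedOp.exists_selfAdjoint_extension
  refine ⟨conjBy hW.diagonalizer B, ?_, isSelfAdjoint_conjBy _ hB'⟩
  have h : (fun j => speedOp (eigenSpeed b j)) =
      ![speedOp (phaseSpeed b), -speedOp (phaseSpeed b)] := by
    funext j
    fin_cases j
    · rfl
    · exact hτ.speedOp_neg
  rw [hW.timeOp_eq hb, h, ← LinearPMap.le_graph_iff]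
  rintro ⟨x, y⟩ hxy
  rw [mem_graph_conjBy] at hxy ⊢
  exact LinearPMap.le_graph_of_le hB hxy

lemma rank_eigenSpace_adjoint_timeOp (hW : IsEigenframe a b W) (hb : b ^ 2 < 1) {m : ℕ}
    (hm : m ≠ 0) {p : ℕ → ℝ} (hp : IsNodes (phaseSpeed b) m p) (z : ℂ) :
    Module.rank ℂ (eigenSpace (timeOp b W).adjoint z) = (2 * m : ℕ) := by
  have hd : ∀ j, Dense ((speedOp (eigenSpeed b j)).domain : Set K₁) := fun j => by
    obtain ⟨τ', hτ⟩ := exists_isSpeed_eigenSpeed hb j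
    exact hτ.dense_speedOp
  rw [hW.timeOp_eq hb, adjoint_conjBy _ (dense_directSum hd), adjoint_directSum hd]
  exact rank_eigenSpace_conjBy _ (rank_eigenSpace_directSum fun j =>
    rank_eigenSpace_adjoint_eigenSpeed hb hm hp j z)

lemma deficiency_of_isNodes (hW : IsEigenframe a b W) (hb : b ^ 2 < 1) {m : ℕ}
    (hm : m ≠ 0) {p : ℕ → ℝ} (hp : IsNodes (phaseSpeed b) m p) :
    dPlus (timeOp b W) = (2 * m : ℕ) ∧ dMinus (timeOp b W) = (2 * m : ℕ) ∧
      opSpectrum (timeOp b W) = univ := by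
  have h := hW.rank_eigenSpace_adjoint_timeOp hb hm hp
  refine ⟨(rank_eigenKer _ _).trans (h _), (rank_eigenKer _ _).trans (h _), ?_⟩
  refine eq_univ_of_forall fun z => mem_opSpectrum_of_eigenSpace_adjoint
    (hW.isSymmetricOp_timeOp hb).1 fun h0 => ?_
  have h1 := h ((starRingEnd ℂ) z)
  rw [h0, rank_bot] at h1
  have h2 : 2 * m = 0 := by exact_mod_cast h1.symm
  omega

/-- Below the threshold, the change of basis to the exponentials diagonalizes the walk and the time
operator simultaneously. -/
lemma timeOp_of_sq_lt (hW : IsEigenframe a b W) (hb : b ^ 2 < 1 / 4) :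
    IsSelfAdjoint (timeOp b W) ∧
      opSpectrum (timeOp b W) = range (fun n : ℤ => (n : ℂ)) ∧
      ∃ V : StateSpace ≃ₗᵢ[ℂ] Double K₁,
        conjBy V (timeOp b W) = directSum (fun _ => momentumOp) ∧
        conjBy V (ofCLM (U₃ a b)) =
          directSum (fun _ => mulOp fun k => Complex.exp (Complex.I * k)) := by
  have hb1 : b ^ 2 < 1 := by linarith
  have hτ := isSpeed_phaseSpeed hb1
  have hθ := hasDerivAt_phase hb1
  have hsa : ∀ j, IsSelfAdjoint (speedOp (eigenSpeed b j)) := by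
    intro j
    fin_cases j
    · exact hτ.isSelfAdjoint_speedOp fun k => (phaseSpeed_pos hb k).ne'
    · exact hτ.neg.isSelfAdjoint_speedOp fun k => neg_ne_zero.2 (phaseSpeed_pos hb k).ne'
  have hbasis : ∀ j, ∃ e : HilbertBasis ℤ ℂ K₁,
      (∀ n : ℤ, (e n, (n : ℂ) • e n) ∈ (speedOp (eigenSpeed b j)).graph) ∧
      ∀ n, e (n + 1) =ᵐ[momentumMeasure] fun k => eigenvalue b j k * e n k := by
    intro j
    fin_cases j
    · obtain ⟨e, h1, h2⟩ := hτ.exists_hilbertBasis hθ (phaseSpeed_pos hb) (phase_zero b)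
        (phase_two_pi hb) (surjective_phase hb)
      refine ⟨e, h1, fun n => (h2 n).trans (Filter.Eventually.of_forall fun k => ?_)⟩
      simp [eigenvalue, eigenvalue₁_eq_exp hb1]
    · obtain ⟨e, h1, h2⟩ := hτ.exists_hilbertBasis_neg hθ (phaseSpeed_pos hb) (phase_zero b)
        (phase_two_pi hb) (surjective_phase hb)
      refine ⟨e, h1, fun n => (h2 n).trans (Filter.Eventually.of_forall fun k => ?_)⟩
      simp [eigenvalue, eigenvalue₁_eq_exp hb1, ← Complex.exp_conj]
  choose e he hmul using hbasis
  rw [hW.timeOp_eq hb1]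
  refine ⟨isSelfAdjoint_conjBy _ (isSelfAdjoint_directSum hsa), ?_,
    hW.diagonalizer.symm.trans (LinearIsometryEquiv.piLpCongrRight 2 fun j =>
      basisChange (e j) expBasis), ?_, ?_⟩
  · rw [opSpectrum_conjBy, opSpectrum_directSum_of_hilbertBasis hsa e he]
  · rw [← conjBy_conjBy, conjBy_symm_conjBy, conjBy_directSum]
    congr 1
    funext j
    exact conjBy_basisChange (hsa j) (he j) isSelfAdjoint_momentumOp expBasis_mem_graph
  · refine graph_ext fun x y => ?_
    obtain ⟨f, rfl⟩ := (LinearIsometryEquiv.piLpCongrRight 2 fun j =>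
      basisChange (e j) expBasis).surjective x
    rw [mem_graph_conjBy, mem_graph_ofCLM, mem_graph_directSum, LinearIsometryEquiv.symm_trans,
      LinearIsometryEquiv.trans_apply, LinearIsometryEquiv.trans_apply,
      LinearIsometryEquiv.symm_symm, LinearIsometryEquiv.symm_apply_apply,
      hW.U₃_diagonalizer hb1, hW.diagonalizer.injective.eq_iff, LinearIsometryEquiv.symm_apply_eq]
    simp only [mem_graph_mulOp]
    have key : ∀ i, basisChange (e i) expBasis (eigenvalueUnitary hb1 f i) =ᵐ[momentumMeasure]
        fun k => Complex.exp (Complex.I * k) * basisChange (e i) expBasis (f i) k := fun i =>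
      basisChange_mul (u := eigenvalue b i) (v := fun k => Complex.exp (Complex.I * k))
        (norm_eigenvalue hb1 i) (fun k => by rw [mul_comm, Complex.norm_exp_ofReal_mul_I])
        (by fun_prop) (hmul i) exp_mul_expBasis (eigenvalueUnitary_ae hb1 f i)
    constructor
    · rintro rfl i
      exact key i
    · exact fun h => PiLp.ext fun i => Lp.ext ((h i).trans (key i).symm)

end IsEigenframe

end QuantumWalk

end

theorem mainTheorem3 (a b : ℝ) (hab : a ^ 2 + b ^ 2 = 1) (hb : b ^ 2 < 1) :
    (∃ W, IsEigenframe a b W) ∧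
    ∀ W, IsEigenframe a b W →
      IsStrongTimeOperator (timeOp b W) (U₃ a b) ∧
      (b ^ 2 < 1 / 4 →
        IsSelfAdjoint (timeOp b W) ∧
        opSpectrum (timeOp b W) = Set.range (fun n : ℤ => (n : ℂ)) ∧
        ∃ V : StateSpace ≃ₗᵢ[ℂ] Double K₁,
          conjBy V (timeOp b W) = directSum (fun _ => momentumOp) ∧
          conjBy V (ofCLM (U₃ a b)) =
            directSum (fun _ => mulOp fun k => Complex.exp (Complex.I * k))) ∧
      (b ^ 2 = 1 / 4 →
        dPlus (timeOp b W) = 4 ∧ dMinus (timeOp b W) = 4 ∧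
        opSpectrum (timeOp b W) = Set.univ) ∧
      (1 / 4 < b ^ 2 →
        dPlus (timeOp b W) = 8 ∧ dMinus (timeOp b W) = 8 ∧
        opSpectrum (timeOp b W) = Set.univ) ∧
      (1 / 4 ≤ b ^ 2 →
        (∃ A : StateSpace →ₗ.[ℂ] StateSpace, timeOp b W ≤ A ∧ IsSelfAdjoint A) ∧
        ∀ A : StateSpace →ₗ.[ℂ] StateSpace, timeOp b W ≤ A → IsSelfAdjoint A →
          IsTimeOperator A (U₃ a b)) := by
  refine ⟨⟨_, isEigenframe_frame hab hb⟩, fun W hW => ⟨hW.isStrongTimeOperator_timeOp hb,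
    hW.timeOp_of_sq_lt, fun h => ?_, fun h => ?_, fun _ => ⟨hW.exists_selfAdjoint_extension hb,
    fun A h h' => hW.isTimeOperator_of_le hb h h'⟩⟩⟩
  · obtain ⟨p, hp⟩ := isNodes_phaseSpeed_two h
    simpa using hW.deficiency_of_isNodes hb two_ne_zero hp
  · obtain ⟨p, hp⟩ := isNodes_phaseSpeed_four h hb
    simpa using hW.deficiency_of_isNodes hb four_ne_zero hp
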